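/- Let $k$ be an algebraically closed field of characteristic zero and $G$ a finite group. Let ${\cal Z}(G)$ be the $k$-linear braided monoidal category of finite-dimensional $G$-graded vector spaces $X=\bigoplus_{g\in G}X_g$ with a $G$-action such that $f(X_g)=X_{fgf^{-1}}$; morphisms preserve grading and action, the tensor product is that of graded vector spaces with diagonal action, and the braiding is $c_{X,Y}(x\otimes y)=f(y)\otimes x$ for $x\in X_f$, $y\in Y$. An algebra $A$ in ${\cal Z}(G)$ (associative, unital, with multiplication $\mu$ and unit $\iota$) is separable if there are morphisms $\epsilon:A\to 1$ and $\kappa:1\to A\otimes A$ such that the pairing $\epsilon\mu:A\otimes A\to 1$ is non-degenerate with copairing $\kappa$, and $\mu\kappa=\iota$. It is indecomposable if it is non-zero and is not a direct product of two non-zero algebras. A right $A$-module $(M,\nu)$ is local if $\nu\circ c_{A,M}\circ c_{M,A}=\nu$. A commutative separable indecomposable algebra $A$ is trivialising if its category of local right modules is equivalent, as a $k$-linear category, to the category of finite-dimensional $k$-vector spaces. Let $H\subset G$ be a subgroup, $F\lhd H$ a normal subgroup, $\gamma\in Z^2(F,k^*)$ a normalised 2-cocycle, and $\varepsilon:H\times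 F\to k^*$ a map such that, for all $g,h\in H$ and $f,f'\in F$, $$\varepsilon_{gh}(f)=\varepsilon_g(hfh^{-1})\varepsilon_h(f),\quad \gamma(f,f')\varepsilon_h(ff')=\varepsilon_h(f)\varepsilon_h(f')\gamma(hfh^{-1},hf'h^{-1}),\quad \gamma(f,f')=\varepsilon_f(f')\gamma(ff'f^{-1},f).$$ Let $A(H,F,\gamma,\varepsilon)$ be the vector space spanned by $a_{g,f}$, $g\in G$, $f\in F$, modulo the relations $a_{gh,f}=\varepsilon_h(f)a_{g,hfh^{-1}}$, $h\in H$, with $a_{g,f}$ in degree $gfg^{-1}$, with $G$-action $x(a_{g,f})=a_{xg,f}$, and with the multiplication determined by $a_{g,f}a_{g,f'}=\gamma(f,f')a_{g,ff'}$ and $a_{g,f}a_{g',f'}=0$ if $gH\neq g'H$. Theorem. (1) $A(H,F,\gamma,\varepsilon)$ is a commutative separable indecomposable algebra in ${\cal Z}(G)$, and it is trivialising if and only if $F=H$. (2) Consequently trivialising algebras in ${\cal Z}(G)$ correspond to pairs $(H,\gamma)$, with $H\subset G$ a subgroup and $\gamma\in Z^2(H,k^*)$ a normalised 2-cocycle,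 in the following sense. For each such pair there is exactly one $\varepsilon:H\times H\to k^*$ satisfying the conditions above with $F=H$; write $A(H,\gamma)=A(H,H,\gamma,\varepsilon)$. An algebra in ${\cal Z}(G)$ is trivialising if and only if it is isomorphic to some $A(H,\gamma)$. Finally, $A(H,\gamma)\simeq A(H',\gamma')$ as algebras in ${\cal Z}(G)$ if and only if there are $g\in G$ with $H'=gHg^{-1}$ and a map $c:H\to k^*$ with $c(xy)\gamma(x,y)=\gamma'(gxg^{-1},gyg^{-1})c(x)c(y)$ for all $x,y\in H$. -/

import Mathlib

open CategoryTheory MonoidalCategory Limits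
open scoped TensorProduct

universe v u

/-! ## Algebras and local modules in a braided monoidal category -/

section Algebras

open scoped MonObj

variable {C : Type u} [Category.{v} C] [MonoidalCategory C]

/-- An algebra `A` is separable if there are `ε : A ⟶ 𝟙` and `κ : 𝟙 ⟶ A ⊗ A` such that the pairing
`e = ε ∘ μ : A ⊗ A ⟶ 𝟙` is non-degenerate with copairing `κ`, and such that the loop `μ ∘ κ` can be
contracted, i.e. equals the unit of `A` (in other words, `A` is a special Frobenius algebra). -/
def IsSeparableAlgebra (A : C) [MonObj A] : Prop :=
  ∃ (ε : A ⟶ 𝟙_ C) (κ : 𝟙_ C ⟶ A ⊗ A),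
    ((ρ_ A).inv ≫ A ◁ κ ≫ (α_ A A A).inv ≫ (μ[A] ≫ ε) ▷ A ≫ (λ_ A).hom = 𝟙 A) ∧
    ((λ_ A).inv ≫ κ ▷ A ≫ (α_ A A A).hom ≫ A ◁ (μ[A] ≫ ε) ≫ (ρ_ A).hom = 𝟙 A) ∧
    κ ≫ μ[A] = η[A]

/-- An algebra is indecomposable if it is non-zero, and whenever it is the product (direct sum) of
two algebras, one of the two is zero. -/
def IsIndecomposableAlgebra (A : Mon C) : Prop :=
  ¬ IsZero A.X ∧
    ∀ (B₁ B₂ : Mon C) (p₁ : A ⟶ B₁) (p₂ : A ⟶ B₂),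
      Nonempty (IsLimit (BinaryFan.mk p₁ p₂)) → IsZero B₁.X ∨ IsZero B₂.X

/-- A right module over an algebra `A`. -/
structure RightModule (A : Mon C) where
  /-- the underlying object -/
  X : C
  /-- the action map -/
  act : X ⊗ A.X ⟶ X
  act_one : X ◁ η[A.X] ≫ act = (ρ_ X).hom
  act_act : act ▷ A.X ≫ act = (α_ X A.X A.X).hom ≫ X ◁ μ[A.X] ≫ act

namespace RightModule

variable {A : Mon C}

/-- A homomorphism of right `A`-modules. -/
@[ext]
structure Hom (M N : RightModule A) where
  /-- the underlying morphism -/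
  hom : M.X ⟶ N.X
  comm : hom ▷ A.X ≫ N.act = M.act ≫ hom

instance : Category (RightModule A) where
  Hom M N := Hom M N
  id M := ⟨𝟙 M.X, by simp⟩
  comp f g := ⟨f.hom ≫ g.hom, by
    rw [comp_whiskerRight, Category.assoc, g.comm, ← Category.assoc, f.comm, Category.assoc]⟩

@[ext]
theorem hom_ext {M N : RightModule A} {f g : M ⟶ N} (h : f.hom = g.hom) : f = g := Hom.ext h

@[simp] theorem id_hom (M : RightModule A) : (𝟙 M : M ⟶ M).hom = 𝟙 M.X := rfl

@[simp] theorem comp_hom {M N K : RightModule A} (f : M ⟶ N) (g : N ⟶ K) :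
    (f ≫ g).hom = f.hom ≫ g.hom := rfl

section Linear

variable [Preadditive C] [MonoidalPreadditive C] (M N : RightModule A)

instance : Zero (M ⟶ N) := ⟨⟨0, by simp⟩⟩

instance : Add (M ⟶ N) := ⟨fun f g => ⟨f.hom + g.hom, by
  simp [MonoidalPreadditive.add_whiskerRight, f.comm, g.comm]⟩⟩

instance : Neg (M ⟶ N) := ⟨fun f => ⟨-f.hom, by
  have h : (-f.hom) ▷ A.X = -(f.hom ▷ A.X) := by
    rw [eq_neg_iff_add_eq_zero, ← MonoidalPreadditive.add_whiskerRight]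
    simp
  simp [h, f.comm]⟩⟩

variable {M N} in
@[simp] theorem add_hom (f g : M ⟶ N) : (f + g).hom = f.hom + g.hom := rfl

@[simp] theorem zero_hom : (0 : M ⟶ N).hom = 0 := rfl

variable {M N} in
@[simp] theorem neg_hom (f : M ⟶ N) : (-f).hom = -f.hom := rfl

instance : AddCommGroup (M ⟶ N) where
  add_assoc f g h := by ext; simp [add_assoc]
  zero_add f := by ext; simp
  add_zero f := by ext; simp
  neg_add_cancel f := by ext; simp
  add_comm f g := by ext; simp [add_comm]
  nsmul := nsmulRec
  zsmul := zsmulRec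

instance : Preadditive (RightModule A) where
  add_comp _ _ _ f g h := by ext; simp
  comp_add _ _ _ f g h := by ext; simp

variable (k : Type*) [Field k] [Linear k C] [MonoidalLinear k C]

instance : SMul k (M ⟶ N) := ⟨fun r f => ⟨r • f.hom, by
  simp [MonoidalLinear.smul_whiskerRight, f.comm]⟩⟩

variable {M N k} in
@[simp] theorem smul_hom (r : k) (f : M ⟶ N) : (r • f).hom = r • f.hom := rfl

instance : Module k (M ⟶ N) where
  one_smul f := by ext; simp
  mul_smul r s f := by ext; simp [mul_smul]
  smul_zero r := by ext; simp
  smul_add r f g := by ext; simp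
  add_smul r s f := by ext; simp [add_smul]
  zero_smul f := by ext; simp

instance : Linear k (RightModule A) where
  smul_comp _ _ _ r f g := by ext; simp
  comp_smul _ _ _ f r g := by ext; simp

end Linear

/-- A right module `(M, ν)` is local if `ν` is unchanged by precomposition with the double
braiding `M ⊗ A ⟶ A ⊗ M ⟶ M ⊗ A`. -/
def isLocal [BraidedCategory C] (A : Mon C) : ObjectProperty (RightModule A) := fun M =>
  (β_ M.X A.X).hom ≫ (β_ A.X M.X).hom ≫ M.act = M.act

end RightModule

/-- The category of local right modules over an algebra `A`, a full subcategory of the category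
of right `A`-modules. -/
abbrev LocalModule [BraidedCategory C] (A : Mon C) : Type _ :=
  (RightModule.isLocal A).FullSubcategory

/-- `A` is a commutative separable indecomposable algebra. -/
structure IsCommSepIndec [BraidedCategory C] (A : Mon C) : Prop where
  comm : IsCommMonObj A.X
  separable : IsSeparableAlgebra A.X
  indecomposable : IsIndecomposableAlgebra A

/-- A commutative separable indecomposable algebra `A` is trivialising if its category of local
modules is `k`-linearly equivalent to the category of finite-dimensional `k`-vector spaces. -/
structure IsTrivialising (k : Type v) [Field k] [BraidedCategory C] [Preadditive C]
    [MonoidalPreadditive C] [Linear k C] [MonoidalLinear k C] (A : Mon C) : Prop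
    extends IsCommSepIndec A where
  local_equiv_vect : ∃ E : LocalModule A ≌ FGModuleCat.{v} k,
    E.functor.Additive ∧ E.functor.Linear k

end Algebras

/-! ## The braided monoidal category `Z(G)` -/

/-- Objects of `Z(G)`: finite-dimensional `G`-graded vector spaces `V = ⨁ V_g` with a compatible
`G`-action, `f (V_g) = V_{f g f⁻¹}`. The grading is recorded by its projections
`proj g : V → V_g ⊆ V`, a complete family of orthogonal idempotents. -/
structure ZG (k G : Type u) [Field k] [Group G] [Fintype G] where
  /-- the underlying vector space -/
  V : Type u
  [addCommGroup : AddCommGroup V]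
  [module : Module k V]
  [finite : FiniteDimensional k V]
  /-- the `G`-action -/
  act : Representation k G V
  /-- the projection onto the component of degree `g` -/
  proj : G → V →ₗ[k] V
  proj_self : ∀ g v, proj g (proj g v) = proj g v
  proj_ne : ∀ g h, g ≠ h → ∀ v, proj g (proj h v) = 0
  sum_proj : ∀ v, ∑ g, proj g v = v
  act_proj : ∀ f g v, act f (proj g v) = proj (f * g * f⁻¹) (act f v)

noncomputable section

namespace ZG

attribute [instance] addCommGroup module finite

section

variable {k G : Type u} [Field k] [Group G] [Fintype G]

/-- The homogeneous component `V_g`. -/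
def component (X : ZG k G) (g : G) : Submodule k X.V := LinearMap.range (X.proj g)

theorem mem_component {X : ZG k G} {g : G} {v : X.V} : v ∈ X.component g ↔ X.proj g v = v :=
  ⟨by rintro ⟨w, rfl⟩; exact X.proj_self g w, fun h => ⟨v, h⟩⟩

/-- `V` is the internal direct sum of the components `V_g`. -/
theorem isInternal_component [DecidableEq G] (X : ZG k G) :
    DirectSum.IsInternal X.component := by
  rw [DirectSum.isInternal_submodule_iff_iSupIndep_and_iSup_eq_top]
  constructor
  · rw [iSupIndep_def]
    intro g
    rw [Submodule.disjoint_def]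
    intro v hv hv'
    rw [mem_component] at hv
    have : (⨆ j, ⨆ (_ : j ≠ g), X.component j) ≤ LinearMap.ker (X.proj g) := by
      refine iSup₂_le fun j hj => ?_
      rintro _ ⟨w, rfl⟩
      exact X.proj_ne g j hj.symm w
    rw [← hv]
    exact this hv'
  · rw [eq_top_iff]
    intro v _
    rw [← X.sum_proj v]
    exact Submodule.sum_mem _ fun g _ => Submodule.mem_iSup_of_mem g ⟨v, rfl⟩

theorem act_mem_component (X : ZG k G) {f g : G} {v : X.V} (hv : v ∈ X.component g) :
    X.act f v ∈ X.component (f * g * f⁻¹) := by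
  rw [mem_component] at hv ⊢
  rw [← X.act_proj, hv]

theorem sum_proj_proj (X : ZG k G) {M : Type*} [AddCommMonoid M] (F : G → X.V → M)
    (hF : ∀ a, F a 0 = 0) (b : G) (x : X.V) :
    ∑ a, F a (X.proj a (X.proj b x)) = F b (X.proj b x) := by
  rw [Finset.sum_eq_single b, X.proj_self]
  · intro a _ h
    rw [X.proj_ne a b h, hF]
  · simp

/-- Morphisms of `Z(G)`: linear maps preserving the grading and the action. -/
@[ext]
structure Hom (X Y : ZG k G) where
  /-- the underlying linear map -/
  toLin : X.V →ₗ[k] Y.V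
  map_act : ∀ g v, toLin (X.act g v) = Y.act g (toLin v)
  map_proj : ∀ g v, toLin (X.proj g v) = Y.proj g (toLin v)

instance : Category (ZG k G) where
  Hom := Hom
  id X := ⟨LinearMap.id, fun _ _ => rfl, fun _ _ => rfl⟩
  comp f g := ⟨g.toLin ∘ₗ f.toLin, by simp [f.map_act, g.map_act],
    by simp [f.map_proj, g.map_proj]⟩

@[ext]
theorem hom_ext {X Y : ZG k G} {f g : X ⟶ Y} (h : f.toLin = g.toLin) : f = g := Hom.ext h

@[simp] theorem id_toLin (X : ZG k G) : (𝟙 X : X ⟶ X).toLin = LinearMap.id := rfl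

@[simp] theorem comp_toLin {X Y Z : ZG k G} (f : X ⟶ Y) (g : Y ⟶ Z) :
    (f ≫ g).toLin = g.toLin ∘ₗ f.toLin := rfl

/-- An isomorphism of `Z(G)` from a linear equivalence. -/
def mkIso {X Y : ZG k G} (e : X.V ≃ₗ[k] Y.V) (ha : ∀ g v, e (X.act g v) = Y.act g (e v))
    (hp : ∀ g v, e (X.proj g v) = Y.proj g (e v)) : X ≅ Y where
  hom := ⟨e, ha, hp⟩
  inv := ⟨e.symm, fun g v => by simp [LinearEquiv.symm_apply_eq, ha],
    fun g v => by simp [LinearEquiv.symm_apply_eq, hp]⟩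
  hom_inv_id := by ext; simp
  inv_hom_id := by ext; simp

/-! ### Linear structure -/

section Linear

variable (X Y : ZG k G)

instance : Zero (X ⟶ Y) := ⟨⟨0, by simp, by simp⟩⟩

instance : Add (X ⟶ Y) := ⟨fun f g => ⟨f.toLin + g.toLin, by simp [f.map_act, g.map_act],
  by simp [f.map_proj, g.map_proj]⟩⟩

instance : Neg (X ⟶ Y) := ⟨fun f => ⟨-f.toLin, by simp [f.map_act], by simp [f.map_proj]⟩⟩

instance : SMul k (X ⟶ Y) := ⟨fun r f => ⟨r • f.toLin, by simp [f.map_act],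
  by simp [f.map_proj]⟩⟩

@[simp] theorem zero_toLin : (0 : X ⟶ Y).toLin = 0 := rfl

variable {X Y}

@[simp] theorem add_toLin (f g : X ⟶ Y) : (f + g).toLin = f.toLin + g.toLin := rfl

@[simp] theorem neg_toLin (f : X ⟶ Y) : (-f).toLin = -f.toLin := rfl

@[simp] theorem smul_toLin (r : k) (f : X ⟶ Y) : (r • f).toLin = r • f.toLin := rfl

variable (X Y)

instance : AddCommGroup (X ⟶ Y) where
  add_assoc f g h := by ext; simp [add_assoc]
  zero_add f := by ext; simp
  add_zero f := by ext; simp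
  neg_add_cancel f := by ext; simp
  add_comm f g := by ext; simp [add_comm]
  nsmul := nsmulRec
  zsmul := zsmulRec

instance : Preadditive (ZG k G) where
  add_comp _ _ _ f g h := by ext; simp
  comp_add _ _ _ f g h := by ext; simp

instance : Module k (X ⟶ Y) where
  one_smul f := by ext; simp
  mul_smul r s f := by ext; simp [mul_smul]
  smul_zero r := by ext; simp
  smul_add r f g := by ext; simp
  add_smul r s f := by ext; simp [add_smul]
  zero_smul f := by ext; simp

instance : Linear k (ZG k G) where
  smul_comp _ _ _ r f g := by ext; simp
  comp_smul _ _ _ f r g := by ext; simp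

end Linear

/-! ### Tensor product -/

/-- The tensor product of graded vector spaces, `(X ⊗ Y)_g = ⨁_{ab=g} X_a ⊗ Y_b`, with the diagonal
action. -/
@[reducible] def tensor (X Y : ZG k G) : ZG k G where
  V := X.V ⊗[k] Y.V
  act := X.act.tprod Y.act
  proj g := ∑ a, TensorProduct.map (X.proj a) (Y.proj (a⁻¹ * g))
  proj_self g v := by
    induction v with
    | zero => simp
    | add v w hv hw => simp only [map_add, hv, hw]
    | tmul x y =>
      simp only [LinearMap.sum_apply, TensorProduct.map_tmul, map_sum]
      refine Finset.sum_congr rfl fun b _ => ?_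
      rw [sum_proj_proj X (fun a z => z ⊗ₜ[k] (Y.proj (a⁻¹ * g)) ((Y.proj (b⁻¹ * g)) y))
        (by simp), Y.proj_self]
  proj_ne g h hgh v := by
    induction v with
    | zero => simp
    | add v w hv hw => simp only [map_add, hv, hw, add_zero]
    | tmul x y =>
      simp only [LinearMap.sum_apply, TensorProduct.map_tmul, map_sum]
      refine Finset.sum_eq_zero fun b _ => ?_
      rw [sum_proj_proj X (fun a z => z ⊗ₜ[k] (Y.proj (a⁻¹ * g)) ((Y.proj (b⁻¹ * h)) y))
        (by simp), Y.proj_ne _ _ (by simpa using hgh), TensorProduct.tmul_zero]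
  sum_proj v := by
    induction v with
    | zero => simp
    | add v w hv hw => simp only [map_add, Finset.sum_add_distrib, hv, hw]
    | tmul x y =>
      simp only [LinearMap.sum_apply, TensorProduct.map_tmul]
      rw [Finset.sum_comm]
      simp_rw [← TensorProduct.tmul_sum]
      conv_lhs =>
        enter [2, a, 3]
        rw [show ∑ g, Y.proj (a⁻¹ * g) y = y from
          (Equiv.sum_comp (Equiv.mulLeft a⁻¹) (fun g => Y.proj g y)).trans (Y.sum_proj y)]
      rw [← TensorProduct.sum_tmul, X.sum_proj]
  act_proj f g v := by
    induction v with
    | zero => simp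
    | add v w hv hw => simp only [map_add, hv, hw]
    | tmul x y =>
      simp only [LinearMap.sum_apply, TensorProduct.map_tmul, map_sum, Representation.tprod_apply,
        X.act_proj, Y.act_proj]
      rw [← Equiv.sum_comp (MulAut.conj f).toEquiv
        (fun a => X.proj a (X.act f x) ⊗ₜ[k] Y.proj (a⁻¹ * (f * g * f⁻¹)) (Y.act f y))]
      refine Finset.sum_congr rfl fun a _ => ?_
      simp [_root_.mul_assoc]

theorem tensor_act_tmul (X Y : ZG k G) (g : G) (x : X.V) (y : Y.V) :
    (X.tensor Y).act g (x ⊗ₜ[k] y) = X.act g x ⊗ₜ[k] Y.act g y := rfl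

theorem tensor_proj_tmul (X Y : ZG k G) (g : G) (x : X.V) (y : Y.V) :
    (X.tensor Y).proj g (x ⊗ₜ[k] y) = ∑ a, X.proj a x ⊗ₜ[k] Y.proj (a⁻¹ * g) y := by
  change (∑ a, TensorProduct.map (X.proj a) (Y.proj (a⁻¹ * g))) (x ⊗ₜ[k] y) = _
  simp [LinearMap.sum_apply]

/-- If `x` has degree `a` and `y` has degree `b` then `x ⊗ y` has degree `a b`. -/
theorem tmul_mem_component (X Y : ZG k G) {a b : G} {x : X.V} {y : Y.V}
    (hx : x ∈ X.component a) (hy : y ∈ Y.component b) :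
    (x ⊗ₜ[k] y : X.V ⊗[k] Y.V) ∈ (X.tensor Y).component (a * b) := by
  rw [mem_component] at hx hy ⊢
  rw [tensor_proj_tmul, ← hx]
  rw [sum_proj_proj X (fun c z => z ⊗ₜ[k] (Y.proj (c⁻¹ * (a * b))) y) (by simp)]
  simp [hy, hx]

open Classical in
/-- The unit object: `k` in degree `e` with trivial action. -/
@[reducible] def unit (k G : Type u) [Field k] [Group G] [Fintype G] : ZG k G where
  V := k
  act := 1
  proj g := if g = 1 then LinearMap.id else 0
  proj_self g v := by split_ifs <;> simp
  proj_ne g h hgh v := by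
    by_cases h1 : h = 1
    · rw [if_neg (by rintro rfl; exact hgh h1.symm)]; simp
    · simp [h1]
  sum_proj v := by
    rw [Finset.sum_eq_single 1] <;> simp +contextual
  act_proj f g v := by
    by_cases h : g = 1 <;> simp [h]

theorem unit_act (g : G) (v : k) : (unit k G).act g v = v := rfl

theorem unit_proj_one (v : k) : (unit k G).proj 1 v = v := by simp [unit]

theorem unit_proj_ne {g : G} (hg : g ≠ 1) (v : k) : (unit k G).proj g v = 0 := by simp [unit, hg]

/-- The tensor product of morphisms. -/
def tensorMap {X X' Y Y' : ZG k G} (f : X ⟶ X') (g : Y ⟶ Y') : X.tensor Y ⟶ X'.tensor Y' where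
  toLin := TensorProduct.map f.toLin g.toLin
  map_act h v := by
    induction v using TensorProduct.induction_on with
    | zero => simp
    | add v w hv hw => simp only [map_add, hv, hw]
    | tmul x y => simp [f.map_act, g.map_act]
  map_proj h v := by
    induction v using TensorProduct.induction_on with
    | zero => simp
    | add v w hv hw => simp only [map_add, hv, hw]
    | tmul x y => simp [f.map_proj, g.map_proj]

/-- The associator. -/
def assocIso (X Y Z : ZG k G) : (X.tensor Y).tensor Z ≅ X.tensor (Y.tensor Z) :=
  mkIso (TensorProduct.assoc k X.V Y.V Z.V)
    (fun g v => by
      have : (TensorProduct.assoc k X.V Y.V Z.V).toLinearMap ∘ₗ ((X.tensor Y).tensor Z).act g =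
          (X.tensor (Y.tensor Z)).act g ∘ₗ (TensorProduct.assoc k X.V Y.V Z.V).toLinearMap :=
        TensorProduct.ext_threefold fun x y z => rfl
      exact LinearMap.congr_fun this v)
    (fun g v => by
      have : (TensorProduct.assoc k X.V Y.V Z.V).toLinearMap ∘ₗ ((X.tensor Y).tensor Z).proj g =
          (X.tensor (Y.tensor Z)).proj g ∘ₗ (TensorProduct.assoc k X.V Y.V Z.V).toLinearMap := by
        refine TensorProduct.ext_threefold fun x y z => ?_
        simp only [LinearMap.comp_apply, LinearEquiv.coe_coe, TensorProduct.assoc_tmul]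
        simp only [LinearMap.sum_apply, TensorProduct.map_tmul, TensorProduct.sum_tmul, TensorProduct.tmul_sum, map_sum,
          TensorProduct.assoc_tmul]
        rw [Finset.sum_comm]
        refine Finset.sum_congr rfl fun a _ => ?_
        rw [← Equiv.sum_comp (Equiv.mulLeft a)]
        simp [_root_.mul_assoc]
      exact LinearMap.congr_fun this v)

/-- The left unitor. -/
def leftIso (X : ZG k G) : (unit k G).tensor X ≅ X :=
  mkIso (TensorProduct.lid k X.V)
    (fun g v => by
      induction v using TensorProduct.induction_on with
      | zero => simp
      | add v w hv hw => simp only [map_add, hv, hw]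
      | tmul x y =>
        rw [tensor_act_tmul, unit_act]
        simp)
    (fun g v => by
      induction v using TensorProduct.induction_on with
      | zero => simp
      | add v w hv hw => simp only [map_add, hv, hw]
      | tmul x y =>
        rw [tensor_proj_tmul, Finset.sum_eq_single 1]
        · rw [unit_proj_one]; simp
        · intro a _ ha
          rw [unit_proj_ne ha]
          exact TensorProduct.zero_tmul _ _
        · simp)

/-- The right unitor. -/
def rightIso (X : ZG k G) : X.tensor (unit k G) ≅ X :=
  mkIso (TensorProduct.rid k X.V)
    (fun g v => by
      induction v using TensorProduct.induction_on with
      | zero => simp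
      | add v w hv hw => simp only [map_add, hv, hw]
      | tmul x y =>
        rw [tensor_act_tmul, unit_act]
        simp)
    (fun g v => by
      induction v using TensorProduct.induction_on with
      | zero => simp
      | add v w hv hw => simp only [map_add, hv, hw]
      | tmul x y =>
        rw [tensor_proj_tmul, Finset.sum_eq_single g]
        · rw [inv_mul_cancel, unit_proj_one]; simp
        · intro a _ ha
          rw [unit_proj_ne (by simpa [inv_mul_eq_one] using ha)]
          exact TensorProduct.tmul_zero _ _
        · simp)

instance : MonoidalCategoryStruct (ZG k G) where
  tensorObj := tensor
  tensorUnit := unit k G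
  tensorHom f g := tensorMap f g
  whiskerLeft X _ _ f := tensorMap (𝟙 X) f
  whiskerRight f Y := tensorMap f (𝟙 Y)
  associator := assocIso
  leftUnitor := leftIso
  rightUnitor := rightIso

theorem tensorHom_toLin {X X' Y Y' : ZG k G} (f : X ⟶ X') (g : Y ⟶ Y') :
    (f ⊗ₘ g).toLin = TensorProduct.map f.toLin g.toLin := rfl

theorem whiskerLeft_toLin (X : ZG k G) {Y Y' : ZG k G} (f : Y ⟶ Y') :
    (X ◁ f).toLin = TensorProduct.map LinearMap.id f.toLin := rfl

theorem whiskerRight_toLin {X X' : ZG k G} (f : X ⟶ X') (Y : ZG k G) :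
    (f ▷ Y).toLin = TensorProduct.map f.toLin LinearMap.id := rfl

theorem associator_hom_toLin (X Y Z : ZG k G) :
    (α_ X Y Z).hom.toLin = (TensorProduct.assoc k X.V Y.V Z.V).toLinearMap := rfl

theorem associator_inv_toLin (X Y Z : ZG k G) :
    (α_ X Y Z).inv.toLin = (TensorProduct.assoc k X.V Y.V Z.V).symm.toLinearMap := rfl

theorem leftUnitor_hom_toLin (X : ZG k G) :
    (λ_ X).hom.toLin = (TensorProduct.lid k X.V).toLinearMap := rfl

theorem rightUnitor_hom_toLin (X : ZG k G) :
    (ρ_ X).hom.toLin = (TensorProduct.rid k X.V).toLinearMap := rfl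

instance : MonoidalCategory (ZG k G) where
  tensorHom_def f g := hom_ext (TensorProduct.ext' fun _ _ => rfl)
  id_tensorHom_id X Y := hom_ext (TensorProduct.ext' fun _ _ => rfl)
  tensorHom_comp_tensorHom f g f' g' := hom_ext (TensorProduct.ext' fun _ _ => rfl)
  whiskerLeft_id X Y := hom_ext (TensorProduct.ext' fun _ _ => rfl)
  id_whiskerRight X Y := hom_ext (TensorProduct.ext' fun _ _ => rfl)
  associator_naturality f g h := hom_ext (TensorProduct.ext_threefold fun _ _ _ => rfl)
  leftUnitor_naturality {X Y} f := hom_ext <| TensorProduct.ext' fun (r : k) x => by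
    change r • f.toLin x = f.toLin (r • x)
    simp
  rightUnitor_naturality {X Y} f := hom_ext <| TensorProduct.ext' fun x (r : k) => by
    change r • f.toLin x = f.toLin (r • x)
    simp
  pentagon W X Y Z := hom_ext (TensorProduct.ext_fourfold fun _ _ _ _ => rfl)
  triangle X Y := hom_ext <| TensorProduct.ext_threefold fun x (r : k) y => by
    exact (TensorProduct.smul_tmul r x y).symm

instance : MonoidalPreadditive (ZG k G) where
  whiskerLeft_zero := hom_ext (TensorProduct.ext' fun _ _ => TensorProduct.tmul_zero _ _)
  zero_whiskerRight := hom_ext (TensorProduct.ext' fun _ _ => TensorProduct.zero_tmul _ _)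
  whiskerLeft_add _ _ := hom_ext (TensorProduct.ext' fun _ _ => TensorProduct.tmul_add _ _ _)
  add_whiskerRight _ _ := hom_ext (TensorProduct.ext' fun _ _ => TensorProduct.add_tmul _ _ _)

instance : MonoidalLinear k (ZG k G) where
  whiskerLeft_smul _ _ _ r f :=
    hom_ext (TensorProduct.ext' fun x y => TensorProduct.tmul_smul r x (f.toLin y))
  smul_whiskerRight r _ _ f _ :=
    hom_ext (TensorProduct.ext' fun x y => (TensorProduct.smul_tmul' r (f.toLin x) y).symm)

/-! ### Braiding -/

/-- The map `x ⊗ y ↦ ∑ f, f(y) ⊗ x_f`, i.e. `x ⊗ y ↦ f(y) ⊗ x` for `x` of degree `f`. -/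
def braidLin (X Y : ZG k G) : X.V ⊗[k] Y.V →ₗ[k] Y.V ⊗[k] X.V :=
  ∑ f, TensorProduct.map (Y.act f) (X.proj f) ∘ₗ (TensorProduct.comm k X.V Y.V).toLinearMap

/-- The inverse map `y ⊗ x ↦ x ⊗ f⁻¹(y)` for `x` of degree `f`. -/
def braidInvLin (X Y : ZG k G) : Y.V ⊗[k] X.V →ₗ[k] X.V ⊗[k] Y.V :=
  ∑ f, TensorProduct.map (X.proj f) (Y.act f⁻¹) ∘ₗ (TensorProduct.comm k Y.V X.V).toLinearMap

theorem braidLin_tmul (X Y : ZG k G) (x : X.V) (y : Y.V) :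
    braidLin X Y (x ⊗ₜ[k] y) = ∑ f, Y.act f y ⊗ₜ[k] X.proj f x := by
  simp [braidLin, LinearMap.sum_apply]

theorem braidInvLin_tmul (X Y : ZG k G) (x : X.V) (y : Y.V) :
    braidInvLin X Y (y ⊗ₜ[k] x) = ∑ f, X.proj f x ⊗ₜ[k] Y.act f⁻¹ y := by
  simp [braidInvLin, LinearMap.sum_apply]

theorem braidLin_tmul_of_mem (X Y : ZG k G) {f : G} {x : X.V} (hx : x ∈ X.component f) (y : Y.V) :
    braidLin X Y (x ⊗ₜ[k] y) = Y.act f y ⊗ₜ[k] x := by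
  rw [mem_component] at hx
  rw [braidLin_tmul, ← hx, sum_proj_proj X (fun a z => Y.act a y ⊗ₜ[k] z) (by simp)]

/-- The braiding as a linear equivalence. -/
def braidEquiv (X Y : ZG k G) : X.V ⊗[k] Y.V ≃ₗ[k] Y.V ⊗[k] X.V :=
  LinearEquiv.ofLinearMap (braidLin X Y) (braidInvLin X Y)
    (TensorProduct.ext' fun y x => by
      simp only [LinearMap.comp_apply, braidInvLin_tmul, map_sum, braidLin_tmul]
      have : ∀ b, ∑ a, Y.act a (Y.act b⁻¹ y) ⊗ₜ[k] X.proj a (X.proj b x) = y ⊗ₜ[k] X.proj b x := by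
        intro b
        rw [sum_proj_proj X (fun a z => Y.act a (Y.act b⁻¹ y) ⊗ₜ[k] z) (by simp)]
        simp
      simp only [this, ← TensorProduct.tmul_sum, X.sum_proj, LinearMap.id_apply])
    (TensorProduct.ext' fun x y => by
      simp only [LinearMap.comp_apply, braidInvLin_tmul, map_sum, braidLin_tmul]
      have : ∀ b, ∑ a, X.proj a (X.proj b x) ⊗ₜ[k] Y.act a⁻¹ (Y.act b y) = X.proj b x ⊗ₜ[k] y := by
        intro b
        rw [sum_proj_proj X (fun a z => z ⊗ₜ[k] Y.act a⁻¹ (Y.act b y)) (by simp)]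
        simp
      simp only [this, ← TensorProduct.sum_tmul, X.sum_proj, LinearMap.id_apply])

/-- The braiding `c_{X,Y}(x ⊗ y) = f(y) ⊗ x` for `x ∈ X_f`, `y ∈ Y`. -/
def braidIso (X Y : ZG k G) : X.tensor Y ≅ Y.tensor X :=
  mkIso (braidEquiv X Y)
    (fun g v => by
      induction v using TensorProduct.induction_on with
      | zero => simp
      | add v w hv hw => simp only [map_add, hv, hw]
      | tmul x y =>
        change braidLin X Y _ = (Y.tensor X).act g (braidLin X Y (x ⊗ₜ[k] y))
        rw [tensor_act_tmul, braidLin_tmul, braidLin_tmul, map_sum]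
        rw [← Equiv.sum_comp (MulAut.conj g).toEquiv]
        refine Finset.sum_congr rfl fun a _ => ?_
        rw [tensor_act_tmul, X.act_proj]
        simp [← Module.End.mul_apply, ← map_mul])
    (fun g v => by
      induction v using TensorProduct.induction_on with
      | zero => simp
      | add v w hv hw => simp only [map_add, hv, hw]
      | tmul x y =>
        change braidLin X Y _ = (Y.tensor X).proj g (braidLin X Y (x ⊗ₜ[k] y))
        rw [tensor_proj_tmul, braidLin_tmul, map_sum, map_sum]
        refine Finset.sum_congr rfl fun a _ => ?_
        rw [tensor_proj_tmul, braidLin_tmul,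
          sum_proj_proj X (fun b z => Y.act b (Y.proj (a⁻¹ * g) y) ⊗ₜ[k] z) (by simp),
          Finset.sum_eq_single (g * a⁻¹)]
        · rw [Y.act_proj]
          simp [_root_.mul_assoc, X.proj_self]
        · intro b _ hb
          rw [X.proj_ne _ _ (fun h => hb (by rw [← h]; simp)), TensorProduct.tmul_zero]
        · simp)

instance : BraidedCategory (ZG k G) where
  braiding := braidIso
  braiding_naturality_right X Y Z f := hom_ext <| TensorProduct.ext' fun x y => by
    change braidLin X Z (x ⊗ₜ[k] f.toLin y) =
      TensorProduct.map f.toLin LinearMap.id (braidLin X Y (x ⊗ₜ[k] y))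
    simp [braidLin_tmul, f.map_act]
  braiding_naturality_left {X Y} f Z := hom_ext <| TensorProduct.ext' fun x z => by
    change braidLin Y Z (f.toLin x ⊗ₜ[k] z) =
      TensorProduct.map LinearMap.id f.toLin (braidLin X Z (x ⊗ₜ[k] z))
    simp [braidLin_tmul, f.map_proj]
  hexagon_forward X Y Z := hom_ext <| TensorProduct.ext_threefold fun x y z => by
    change TensorProduct.assoc k Y.V Z.V X.V (braidLin X (Y.tensor Z) (x ⊗ₜ[k] (y ⊗ₜ[k] z))) =
      TensorProduct.map LinearMap.id (braidLin X Z) (TensorProduct.assoc k Y.V X.V Z.V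
        (braidLin X Y (x ⊗ₜ[k] y) ⊗ₜ[k] z))
    rw [braidLin_tmul, braidLin_tmul]
    simp only [TensorProduct.sum_tmul, map_sum]
    refine Finset.sum_congr rfl fun a _ => ?_
    rw [tensor_act_tmul, TensorProduct.assoc_tmul, TensorProduct.assoc_tmul,
      TensorProduct.map_tmul, braidLin_tmul,
      sum_proj_proj X (fun b t => Z.act b z ⊗ₜ[k] t) (by simp)]
    rfl
  hexagon_reverse X Y Z := hom_ext <| TensorProduct.ext (LinearMap.ext fun x =>
      TensorProduct.ext' fun y z => by
    change (TensorProduct.assoc k Z.V X.V Y.V).symm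
        (braidLin (X.tensor Y) Z ((x ⊗ₜ[k] y) ⊗ₜ[k] z)) =
      TensorProduct.map (braidLin X Z) LinearMap.id ((TensorProduct.assoc k X.V Z.V Y.V).symm
        (x ⊗ₜ[k] braidLin Y Z (y ⊗ₜ[k] z)))
    rw [braidLin_tmul, braidLin_tmul]
    simp only [TensorProduct.tmul_sum, map_sum, TensorProduct.assoc_symm_tmul,
      TensorProduct.map_tmul, braidLin_tmul, TensorProduct.sum_tmul, LinearMap.sum_apply]
    rw [Finset.sum_comm]
    conv_rhs => rw [Finset.sum_comm]
    refine Finset.sum_congr rfl fun a _ => ?_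
    rw [← Equiv.sum_comp (Equiv.mulLeft a)]
    simp)

theorem braiding_hom_toLin (X Y : ZG k G) : (β_ X Y).hom.toLin = braidLin X Y := rfl

end

end ZG

end

/-! ## The algebras `A(H, F, γ, ε)` -/

/-- A normalised 2-cocycle on a group `F` with values in `kˣ` (trivial action). -/
@[ext]
structure TwoCocycle (k F : Type*) [Field k] [Group F] where
  /-- the underlying function -/
  toFun : F → F → kˣ
  one_left : ∀ g, toFun 1 g = 1
  one_right : ∀ f, toFun f 1 = 1
  cocycle : ∀ f g h, toFun f g * toFun (f * g) h = toFun g h * toFun f (g * h)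

namespace TwoCocycle

instance (k F : Type*) [Field k] [Group F] : CoeFun (TwoCocycle k F) (fun _ => F → F → kˣ) :=
  ⟨toFun⟩

/-- Restriction of a 2-cocycle to a subgroup. -/
def restrict {k H : Type*} [Field k] [Group H] (γ : TwoCocycle k H) (F : Subgroup H) :
    TwoCocycle k F where
  toFun x y := γ x y
  one_left _ := γ.one_left _
  one_right _ := γ.one_right _
  cocycle _ _ _ := γ.cocycle _ _ _

end TwoCocycle

/-- The conditions on `ε : H × F → kˣ` relative to a 2-cocycle `γ` on the normal subgroup `F` of
`H`. Here `MulAut.conjNormal h f = h f h⁻¹`. -/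
structure IsCompatible {k H : Type*} [Field k] [Group H] {F : Subgroup H} [F.Normal]
    (γ : TwoCocycle k F) (ε : H → F → kˣ) : Prop where
  mul_act : ∀ (g h : H) (f : F), ε (g * h) f = ε g (MulAut.conjNormal h f) * ε h f
  act_mul : ∀ (h : H) (f g : F), γ f g * ε h (f * g) =
    ε h f * ε h g * γ (MulAut.conjNormal h f) (MulAut.conjNormal h g)
  comm : ∀ f g : F, γ f g = ε f g * γ (MulAut.conjNormal (f : H) g) f

namespace IsCompatible

variable {k H : Type*} [Field k] [Group H] {F : Subgroup H} [F.Normal]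
  {γ : TwoCocycle k F} {ε : H → F → kˣ}

theorem apply_one (hε : IsCompatible γ ε) (h : H) : ε h 1 = 1 := by
  have := hε.act_mul h 1 1
  simpa [γ.one_left] using this

theorem one_apply (hε : IsCompatible γ ε) (f : F) : ε 1 f = 1 := by
  have := hε.mul_act 1 1 f
  simpa using this

end IsCompatible

noncomputable section

namespace AlgA

section

variable {k G : Type u} [Field k] [Group G] {H : Subgroup G} {F : Subgroup H} [F.Normal]

/-- The subspace of `k[G × F]` spanned by the relations
`a_{gh,f} = ε_h(f) a_{g,h f h⁻¹}` for `g ∈ G`, `h ∈ H`, `f ∈ F`. -/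
def relations (ε : H → F → kˣ) : Submodule k (G × F →₀ k) :=
  Submodule.span k {v | ∃ (g : G) (h : H) (f : F),
    v = Finsupp.single (g * h, f) 1 -
      ((ε h f : kˣ) : k) • Finsupp.single (g, MulAut.conjNormal h f) 1}

/-- The vector space spanned by the symbols `a_{g,f}`, `g ∈ G`, `f ∈ F`, modulo the relations. -/
def Carrier (ε : H → F → kˣ) : Type u := (G × F →₀ k) ⧸ relations ε

instance (ε : H → F → kˣ) : AddCommGroup (Carrier ε) :=
  inferInstanceAs (AddCommGroup ((G × F →₀ k) ⧸ relations ε))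

instance (ε : H → F → kˣ) : Module k (Carrier ε) :=
  inferInstanceAs (Module k ((G × F →₀ k) ⧸ relations ε))

instance [Finite G] (ε : H → F → kˣ) : FiniteDimensional k (Carrier ε) :=
  inferInstanceAs (FiniteDimensional k ((G × F →₀ k) ⧸ relations ε))

variable (ε : H → F → kˣ)

/-- The spanning vector `a_{g,f}`. -/
def gen (g : G) (f : F) : Carrier ε :=
  (Submodule.Quotient.mk (Finsupp.single (g, f) 1) : (G × F →₀ k) ⧸ relations ε)

theorem gen_mul (g : G) (h : H) (f : F) :
    gen ε (g * h) f = ((ε h f : kˣ) : k) • gen ε g (MulAut.conjNormal h f) :=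
  (Submodule.Quotient.eq (relations ε)).2 (Submodule.subset_span ⟨g, h, f, rfl⟩)

variable {ε} {M : Type*} [AddCommGroup M] [Module k M]

/-- Linear maps out of the space spanned by the `a_{g,f}` are given by their values on the
`a_{g,f}`, subject to the relations. -/
def lift (φ : G → F → M)
    (hφ : ∀ g (h : H) f, φ (g * h) f = ((ε h f : kˣ) : k) • φ g (MulAut.conjNormal h f)) :
    Carrier ε →ₗ[k] M :=
  (relations ε).liftQ (Finsupp.linearCombination k fun p : G × F => φ p.1 p.2) (by
    rw [relations, Submodule.span_le]
    rintro _ ⟨g, h, f, rfl⟩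
    simp [hφ])

@[simp]
theorem lift_gen (φ : G → F → M) (hφ) (g : G) (f : F) :
    lift (ε := ε) φ hφ (gen ε g f) = φ g f := by
  have : lift (ε := ε) φ hφ (gen ε g f) =
      Finsupp.linearCombination k (fun p : G × F => φ p.1 p.2) (Finsupp.single (g, f) 1) := rfl
  rw [this]
  simp

theorem hom_ext {φ ψ : Carrier ε →ₗ[k] M} (h : ∀ g f, φ (gen ε g f) = ψ (gen ε g f)) : φ = ψ := by
  refine Submodule.linearMap_qext _ (Finsupp.lhom_ext' fun p => LinearMap.ext_ring ?_)
  exact h p.1 p.2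

/-- The action `x (a_{g,f}) = a_{xg,f}`. -/
def act (ε : H → F → kˣ) : Representation k G (Carrier ε) where
  toFun x := lift (fun g f => gen ε (x * g) f) fun g h f => by
    rw [← mul_assoc, gen_mul]
  map_one' := hom_ext fun g f => by simp
  map_mul' x y := hom_ext fun g f => by simp [mul_assoc]

@[simp]
theorem act_gen (x g : G) (f : F) : act ε x (gen ε g f) = gen ε (x * g) f :=
  lift_gen (ε := ε) (fun g f => gen ε (x * g) f)
    (fun g h f => by rw [← mul_assoc, gen_mul]) g f

open Classical in
/-- The projection to degree `x`, where `a_{g,f}` has degree `g f g⁻¹`. -/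
def proj (ε : H → F → kˣ) (x : G) : Carrier ε →ₗ[k] Carrier ε :=
  lift (fun g f => if g * f * g⁻¹ = x then gen ε g f else 0) fun g h f => by
    have : g * h * f * (g * h : G)⁻¹ = g * (MulAut.conjNormal h f : F) * g⁻¹ := by
      simp [mul_assoc]
    simp only [this]
    split_ifs <;> simp [gen_mul]

theorem proj_gen_self (g : G) (f : F) : proj ε (g * f * g⁻¹) (gen ε g f) = gen ε g f := by
  simp [proj]

theorem proj_gen_ne {x g : G} {f : F} (h : g * f * g⁻¹ ≠ x) : proj ε x (gen ε g f) = 0 := by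
  simp [proj, h]

open Classical in
theorem proj_gen (x g : G) (f : F) :
    proj ε x (gen ε g f) = if g * f * g⁻¹ = x then gen ε g f else 0 := by
  simp [proj]

variable (ε) in
/-- The object of `Z(G)` underlying `A(H, F, γ, ε)`. -/
@[reducible] def obj [Fintype G] : ZG k G where
  V := Carrier ε
  act := act ε
  proj := proj ε
  proj_self x v := by
    have : proj ε x ∘ₗ proj ε x = proj ε x := hom_ext fun g f => by
      simp only [LinearMap.comp_apply, proj_gen]
      split_ifs with h <;> simp [proj_gen, h]
    exact LinearMap.congr_fun this v
  proj_ne x y hxy v := by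
    have : proj ε x ∘ₗ proj ε y = 0 := hom_ext fun g f => by
      simp only [LinearMap.comp_apply, proj_gen]
      split_ifs with h
      · rw [proj_gen_ne (by rw [h]; exact hxy.symm)]; simp
      · simp
    exact LinearMap.congr_fun this v
  sum_proj v := by
    have : ∑ x, proj ε x = LinearMap.id := hom_ext fun g f => by
      classical
      simp [LinearMap.sum_apply, proj_gen, Finset.sum_ite_eq]
    simpa [LinearMap.sum_apply] using LinearMap.congr_fun this v
  act_proj x y v := by
    have : act ε x ∘ₗ proj ε y = proj ε (x * y * x⁻¹) ∘ₗ act ε x := hom_ext fun g f => by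
      have h : x * g * f * (x * g)⁻¹ = x * y * x⁻¹ ↔ g * f * g⁻¹ = y := by
        constructor
        · intro h
          have := congrArg (fun t => x⁻¹ * t * x) h
          simpa [mul_assoc] using this
        · rintro rfl
          simp [mul_assoc]
      simp only [LinearMap.comp_apply, proj_gen, act_gen]
      by_cases hy : g * f * g⁻¹ = y
      · rw [if_pos hy, if_pos (h.2 hy), act_gen]
      · rw [if_neg hy, if_neg (fun h' => hy (h.1 h')), map_zero]
    exact LinearMap.congr_fun this v

variable {γ : TwoCocycle k F}

open Classical in
/-- The product of two spanning vectors. It is determined by bilinearity, by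
`a_{g,f} a_{g,f'} = γ(f,f') a_{g,ff'}` and by `a_{g,f} a_{g',f'} = 0` for `gH ≠ g'H`: if
`g' = g h` with `h ∈ H`, then `a_{g',f'} = ε_h(f') a_{g, h f' h⁻¹}`. -/
def genMul (γ : TwoCocycle k F) (ε : H → F → kˣ) (g : G) (f : F) (g' : G) (f' : F) : Carrier ε :=
  if hg : g⁻¹ * g' ∈ H then
    ((ε ⟨g⁻¹ * g', hg⟩ f' * γ f (MulAut.conjNormal (⟨g⁻¹ * g', hg⟩ : H) f') : kˣ) : k) •
      gen ε g (f * MulAut.conjNormal (⟨g⁻¹ * g', hg⟩ : H) f')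
  else 0

theorem genMul_coset (g : G) (h : H) (f f' : F) :
    genMul γ ε g f (g * h) f' =
      ((ε h f' * γ f (MulAut.conjNormal h f') : kˣ) : k) • gen ε g (f * MulAut.conjNormal h f') := by
  have h1 : g⁻¹ * (g * h) ∈ H := by simp
  have h2 : (⟨g⁻¹ * (g * h), h1⟩ : H) = h := by ext; simp
  rw [genMul, dif_pos h1]
  simp only [h2]

theorem genMul_of_notMem {g g' : G} (hg : g⁻¹ * g' ∉ H) (f f' : F) :
    genMul γ ε g f g' f' = 0 := dif_neg hg

theorem genMul_right (hε : IsCompatible γ ε) (g : G) (f : F) (g' : G) (h : H) (f' : F) :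
    genMul γ ε g f (g' * h) f' =
      ((ε h f' : kˣ) : k) • genMul γ ε g f g' (MulAut.conjNormal h f') := by
  by_cases hg : g⁻¹ * g' ∈ H
  · obtain ⟨t, rfl⟩ : ∃ t : H, g' = g * t := ⟨⟨_, hg⟩, by simp⟩
    rw [mul_assoc, ← Subgroup.coe_mul, genMul_coset, genMul_coset, smul_smul, ← Units.val_mul,
      hε.mul_act, map_mul, MulAut.mul_apply]
    congr 2
    rw [mul_comm (ε t _) (ε h _), mul_assoc]
  · rw [genMul_of_notMem hg, genMul_of_notMem, smul_zero]
    rwa [← mul_assoc, H.mul_mem_cancel_right h.2]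

theorem genMul_left (hε : IsCompatible γ ε) (g : G) (h : H) (f : F) (g' : G) (f' : F) :
    genMul γ ε (g * h) f g' f' =
      ((ε h f : kˣ) : k) • genMul γ ε g (MulAut.conjNormal h f) g' f' := by
  by_cases hg : g⁻¹ * g' ∈ H
  · obtain ⟨t, rfl⟩ : ∃ t : H, g' = g * h * t :=
      ⟨h⁻¹ * ⟨_, hg⟩, by simp⟩
    rw [genMul_coset, gen_mul, mul_assoc, ← Subgroup.coe_mul, genMul_coset, smul_smul, smul_smul,
      ← Units.val_mul, ← Units.val_mul, hε.mul_act, map_mul, map_mul, MulAut.mul_apply]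
    congr 2
    have := hε.act_mul h f (MulAut.conjNormal t f')
    calc _ = ε t f' * (γ f (MulAut.conjNormal t f') * ε h (f * MulAut.conjNormal t f')) := by
          rw [mul_assoc]
      _ = _ := by
          rw [this, mul_assoc, mul_left_comm, mul_assoc,
            mul_left_comm (ε t f')]
  · rw [genMul_of_notMem hg, genMul_of_notMem, smul_zero]
    rw [mul_inv_rev, mul_assoc, ← Subgroup.coe_inv]
    rwa [H.mul_mem_cancel_left (h⁻¹).2]

/-- The multiplication of `A(H, F, γ, ε)` as a bilinear map. -/
def mulBilin (hε : IsCompatible γ ε) : Carrier ε →ₗ[k] Carrier ε →ₗ[k] Carrier ε :=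
  lift (fun g f => lift (fun g' f' => genMul γ ε g f g' f') (genMul_right hε g f))
    fun g h f => hom_ext fun g' f' => by simp [genMul_left hε]

theorem mulBilin_gen (hε : IsCompatible γ ε) (g : G) (f : F) (g' : G) (f' : F) :
    mulBilin hε (gen ε g f) (gen ε g' f') = genMul γ ε g f g' f' := by
  simp [mulBilin]

theorem mulBilin_gen_same (hε : IsCompatible γ ε) (g : G) (f f' : F) :
    mulBilin hε (gen ε g f) (gen ε g f') = ((γ f f' : kˣ) : k) • gen ε g (f * f') := by
  have := genMul_coset (γ := γ) (ε := ε) g 1 f f'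
  simpa [hε.one_apply, mulBilin_gen] using this

theorem mulBilin_gen_of_ne (hε : IsCompatible γ ε) {g g' : G}
    (hg : (g : G ⧸ H) ≠ (g' : G ⧸ H)) (f f' : F) :
    mulBilin hε (gen ε g f) (gen ε g' f') = 0 := by
  rw [mulBilin_gen, genMul_of_notMem (by rwa [← QuotientGroup.eq])]

theorem mulBilin_gen_coset (hε : IsCompatible γ ε) (g : G) (h : H) (f f' : F) :
    mulBilin hε (gen ε g f) (gen ε (g * h) f') =
      ((ε h f' * γ f (MulAut.conjNormal h f') : kˣ) : k) •
        gen ε g (f * MulAut.conjNormal h f') := by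
  rw [mulBilin_gen, genMul_coset]

theorem mulBilin_act (hε : IsCompatible γ ε) (x : G) (v w : Carrier ε) :
    mulBilin hε (act ε x v) (act ε x w) = act ε x (mulBilin hε v w) := by
  have : (mulBilin hε).compl₁₂ (act ε x) (act ε x) = (mulBilin hε).compr₂ (act ε x) :=
    hom_ext fun g f => hom_ext fun g' f' => by
      simp only [LinearMap.compl₁₂_apply, LinearMap.compr₂_apply, act_gen]
      by_cases hg : g⁻¹ * g' ∈ H
      · obtain ⟨t, rfl⟩ : ∃ t : H, g' = g * t := ⟨⟨_, hg⟩, by simp⟩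
        rw [← mul_assoc, mulBilin_gen_coset, mulBilin_gen_coset, map_smul, act_gen]
      · rw [mulBilin_gen, mulBilin_gen, genMul_of_notMem hg, genMul_of_notMem, map_zero]
        simpa [mul_assoc] using hg
  exact LinearMap.congr_fun (LinearMap.congr_fun this v) w

theorem mulBilin_proj [Fintype G] (hε : IsCompatible γ ε) (x : G) (v w : Carrier ε) :
    ∑ a, mulBilin hε (proj ε a v) (proj ε (a⁻¹ * x) w) = proj ε x (mulBilin hε v w) := by
  have : ∑ a, (mulBilin hε).compl₁₂ (proj ε a) (proj ε (a⁻¹ * x)) =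
      (mulBilin hε).compr₂ (proj ε x) :=
    hom_ext fun g f => hom_ext fun g' f' => by
      simp only [LinearMap.sum_apply, LinearMap.compl₁₂_apply, LinearMap.compr₂_apply]
      rw [Finset.sum_eq_single (g * f * g⁻¹), proj_gen_self]
      · by_cases hg : g⁻¹ * g' ∈ H
        · obtain ⟨t, rfl⟩ : ∃ t : H, g' = g * t := ⟨⟨_, hg⟩, by simp⟩
          have key : g * t * f' * (g * t : G)⁻¹ = (g * f * g⁻¹)⁻¹ * x ↔
              g * ((f * MulAut.conjNormal t f' : F) : H) * g⁻¹ = x := by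
            rw [eq_inv_mul_iff_mul_eq]
            simp [mul_assoc]
          rw [proj_gen, mulBilin_gen_coset, map_smul, proj_gen]
          by_cases hx : g * ((f * MulAut.conjNormal t f' : F) : H) * g⁻¹ = x
          · rw [if_pos (key.2 hx), if_pos hx, mulBilin_gen_coset]
          · rw [if_neg (fun h' => hx (key.1 h')), if_neg hx, map_zero, smul_zero]
        · rw [mulBilin_gen, genMul_of_notMem hg, map_zero, proj_gen]
          split_ifs
          · rw [mulBilin_gen, genMul_of_notMem hg]
          · simp
      · intro a _ ha
        rw [proj_gen_ne ha.symm]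
        simp
      · simp
  simpa [LinearMap.sum_apply] using LinearMap.congr_fun (LinearMap.congr_fun this v) w

theorem mulBilin_assoc (hε : IsCompatible γ ε) (u v w : Carrier ε) :
    mulBilin hε (mulBilin hε u v) w = mulBilin hε u (mulBilin hε v w) := by
  have key : ∀ (g : G) (f : F) (g' : G) (f' : F) (g'' : G) (f'' : F),
      mulBilin hε (mulBilin hε (gen ε g f) (gen ε g' f')) (gen ε g'' f'') =
        mulBilin hε (gen ε g f) (mulBilin hε (gen ε g' f') (gen ε g'' f'')) := by
    intro g f g' f' g'' f''
    by_cases hg : g⁻¹ * g' ∈ H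
    · obtain ⟨t, rfl⟩ : ∃ t : H, g' = g * t := ⟨⟨_, hg⟩, by simp⟩
      by_cases hg' : g⁻¹ * g'' ∈ H
      · obtain ⟨s, rfl⟩ : ∃ s : H, g'' = g * s := ⟨⟨_, hg'⟩, by simp⟩
        rw [gen_mul, gen_mul]
        simp only [map_smul, LinearMap.smul_apply, mulBilin_gen_same]
        simp only [smul_smul, ← Units.val_mul, mul_assoc]
        congr 2
        rw [γ.cocycle, mul_left_comm]
      · rw [gen_mul]
        have h1 : (g : G ⧸ H) ≠ (g'' : G ⧸ H) := fun h => hg' (QuotientGroup.eq.1 h)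
        simp [mulBilin_gen_same, mulBilin_gen_of_ne hε h1]
    · have h1 : (g : G ⧸ H) ≠ (g' : G ⧸ H) := fun h => hg (QuotientGroup.eq.1 h)
      rw [mulBilin_gen_of_ne hε h1]
      by_cases hg' : g'⁻¹ * g'' ∈ H
      · obtain ⟨s, rfl⟩ : ∃ s : H, g'' = g' * s := ⟨⟨_, hg'⟩, by simp⟩
        rw [gen_mul]
        simp [mulBilin_gen_same, mulBilin_gen_of_ne hε h1]
      · have h2 : (g' : G ⧸ H) ≠ (g'' : G ⧸ H) := fun h => hg' (QuotientGroup.eq.1 h)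
        simp [mulBilin_gen_of_ne hε h2]
  have h1 : ∀ g f g' f', mulBilin hε (mulBilin hε (gen ε g f) (gen ε g' f')) =
      mulBilin hε (gen ε g f) ∘ₗ mulBilin hε (gen ε g' f') := fun g f g' f' =>
    hom_ext fun g'' f'' => key g f g' f' g'' f''
  have h2 : ∀ g f, (mulBilin hε).flip w ∘ₗ mulBilin hε (gen ε g f) =
      mulBilin hε (gen ε g f) ∘ₗ (mulBilin hε).flip w := fun g f =>
    hom_ext fun g' f' => LinearMap.congr_fun (h1 g f g' f') w
  have h3 : (mulBilin hε).flip w ∘ₗ (mulBilin hε).flip v =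
      (mulBilin hε).flip (mulBilin hε v w) :=
    hom_ext fun g f => LinearMap.congr_fun (h2 g f) v
  exact LinearMap.congr_fun h3 u

/-- For `f = e`, the vector `a_{g,e}` only depends on the coset `gH`. -/
theorem gen_one_eq (hε : IsCompatible γ ε) {g g' : G} (h : (g : G ⧸ H) = (g' : G ⧸ H)) :
    gen ε g 1 = gen ε g' 1 := by
  have h' : g⁻¹ * g' ∈ H := QuotientGroup.eq.1 h
  obtain ⟨t, rfl⟩ : ∃ t : H, g' = g * t := ⟨⟨_, h'⟩, by simp⟩
  rw [gen_mul]
  simp [hε.apply_one]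

open Classical in
/-- The unit element, `∑_{gH ∈ G/H} a_{g,e}`. -/
def one [Fintype G] (ε : H → F → kˣ) : Carrier ε := ∑ q : G ⧸ H, gen ε q.out 1

theorem act_one [Fintype G] (hε : IsCompatible γ ε) (x : G) : act ε x (one ε) = one ε := by
  classical
  unfold one
  rw [map_sum]
  refine Fintype.sum_equiv (MulAction.toPerm x : Equiv.Perm (G ⧸ H)) _ _ fun q => ?_
  rw [act_gen]
  refine gen_one_eq hε ?_
  rw [QuotientGroup.out_eq', MulAction.toPerm_apply]
  conv_rhs => rw [← QuotientGroup.out_eq' q]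
  rfl

theorem proj_one [Fintype G] : proj ε 1 (one ε) = one ε := by
  unfold one
  rw [map_sum]
  refine Finset.sum_congr rfl fun q _ => ?_
  rw [proj_gen, if_pos (by simp)]

theorem proj_one_ne [Fintype G] {x : G} (hx : x ≠ 1) : proj ε x (one ε) = 0 := by
  unfold one
  rw [map_sum]
  refine Finset.sum_eq_zero fun q _ => ?_
  rw [proj_gen, if_neg (by simpa using hx.symm)]

theorem one_mulBilin [Fintype G] (hε : IsCompatible γ ε) (v : Carrier ε) :
    mulBilin hε (one ε) v = v := by
  classical
  have : mulBilin hε (one ε) = LinearMap.id := hom_ext fun g f => by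
    unfold one
    rw [map_sum, LinearMap.sum_apply, Finset.sum_eq_single (g : G ⧸ H)]
    · rw [gen_one_eq hε (QuotientGroup.out_eq' (g : G ⧸ H)), mulBilin_gen_same]
      simp [γ.one_left]
    · intro q _ hq
      rw [mulBilin_gen_of_ne hε (by rwa [QuotientGroup.out_eq'])]
    · simp
  exact LinearMap.congr_fun this v

theorem mulBilin_one [Fintype G] (hε : IsCompatible γ ε) (v : Carrier ε) :
    mulBilin hε v (one ε) = v := by
  classical
  have : (mulBilin hε).flip (one ε) = LinearMap.id := hom_ext fun g f => by
    unfold one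
    rw [map_sum, LinearMap.sum_apply, Finset.sum_eq_single (g : G ⧸ H)]
    · rw [gen_one_eq hε (QuotientGroup.out_eq' (g : G ⧸ H)), LinearMap.flip_apply,
        mulBilin_gen_same]
      simp [γ.one_right]
    · intro q _ hq
      rw [LinearMap.flip_apply,
        mulBilin_gen_of_ne hε (by rw [QuotientGroup.out_eq']; exact hq.symm)]
    · simp
  exact LinearMap.congr_fun this v

variable [Fintype G]

/-- The unit `𝟙 ⟶ A(H, F, γ, ε)` in `Z(G)`. -/
def oneHom (hε : IsCompatible γ ε) : ZG.unit k G ⟶ obj ε where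
  toLin := LinearMap.toSpanSingleton k _ (one ε)
  map_act g (r : k) := by
    simp [act_one hε]
  map_proj g (r : k) := by
    by_cases hg : g = 1
    · subst hg
      simp [proj_one]
    · simp [hg, proj_one_ne hg]

/-- The multiplication `A ⊗ A ⟶ A` of `A = A(H, F, γ, ε)` in `Z(G)`. -/
def mulHom (hε : IsCompatible γ ε) : (obj ε).tensor (obj ε) ⟶ obj ε where
  toLin := TensorProduct.lift (mulBilin hε)
  map_act g v := by
    induction v using TensorProduct.induction_on with
    | zero => simp
    | add v w hv hw => simp only [map_add, hv, hw]
    | tmul x y =>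
      rw [ZG.tensor_act_tmul, TensorProduct.lift.tmul, TensorProduct.lift.tmul, mulBilin_act]
  map_proj g v := by
    induction v using TensorProduct.induction_on with
    | zero => simp
    | add v w hv hw => simp only [map_add, hv, hw]
    | tmul x y =>
      rw [ZG.tensor_proj_tmul, map_sum, TensorProduct.lift.tmul, ← mulBilin_proj]
      rfl

/-- The object `A(H, F, γ, ε)` of `Z(G)` with its multiplication and unit. -/
@[reducible] def monObj (hε : IsCompatible γ ε) : MonObj (obj ε) where
  one := oneHom hε
  mul := mulHom hε
  one_mul := ZG.hom_ext <| TensorProduct.ext' fun (r : k) x => by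
    change mulBilin hε (r • one ε) x = r • x
    rw [map_smul, LinearMap.smul_apply, one_mulBilin]
  mul_one := ZG.hom_ext <| TensorProduct.ext' fun x (r : k) => by
    change mulBilin hε x (r • one ε) = r • x
    rw [map_smul, mulBilin_one]
  mul_assoc := ZG.hom_ext <| TensorProduct.ext_threefold fun x y z => mulBilin_assoc hε x y z

end

end AlgA

/-- The algebra `A(H, F, γ, ε)` in `Z(G)`: it is spanned by `a_{g,f}`, `g ∈ G`, `f ∈ F`, modulo
`a_{gh,f} = ε_h(f) a_{g,h f h⁻¹}` for `h ∈ H`, with `a_{g,f}` of degree `g f g⁻¹`, with `G`-action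
`x (a_{g,f}) = a_{xg,f}`, and with multiplication `a_{g,f} a_{g,f'} = γ(f,f') a_{g,ff'}` and
`a_{g,f} a_{g',f'} = 0` for `gH ≠ g'H`. -/
def algA {k G : Type u} [Field k] [Group G] [Fintype G] (H : Subgroup G) (F : Subgroup H)
    [F.Normal] (γ : TwoCocycle k F) (ε : H → F → kˣ) (hε : IsCompatible γ ε) : Mon (ZG k G) where
  X := AlgA.obj ε
  mon := AlgA.monObj hε

end

/-! The algebra A(H, F, γ, ε) is recognised by the elements u_f = a_{1,f} inside it, abstracted as a
`Frame`: u_1 is an idempotent of degree 1, its translates along distinct cosets of H are orthogonal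
and add up to 1, the corner u_1 A is spanned by the u_f, and γ and ε are the structure constants of
multiplication and action on them. In characteristic zero a frame determines the algebra
(`Frame.nonempty_iso`), so every assertion becomes one about frames.

Projecting to degree 1 and averaging over G kills g(u_f) for f ≠ 1 and sends g(u_1) to a multiple of
1. Hence the invariants of degree 1 are the scalars, which gives indecomposability, and the
averaging map is up to a scalar a trace with an explicit copairing, which gives separability.
Commutativity is the third condition on ε.

A homomorphism A → M of right modules is the same thing as an invariant of degree 1 in M, so W ↦ W ⊗
A is fully faithful from vector spaces to local modules. If F = H, locality forces M to be generated
by its invariants: locality against u_1 confines M u_1 to degrees in H, multiplication by the u_f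
moves these to degree 1, and locality against the u_f makes H act trivially there. If F ≠ H, the
F-equivariant functions G → u_1 A with zero H-average form a nonzero local module without invariants
of degree 1. It receives no nonzero map from A, which cannot happen between nonzero objects of a
category equivalent to vector spaces.

Conversely, let A be commutative, separable and indecomposable. Elements of degree 1 are central,
and separability makes them von Neumann regular (`ZG.exists_eq_mul_mul`), so over an algebraically
closed field there is a nonzero idempotent p of degree 1 with p A_1 = k p. Take H to be its
stabiliser: translates of p along distinct cosets are orthogonal, and their sum is a nonzero
invariant idempotent, hence 1. Non-degeneracy of the trace makes nonzero homogeneous elements of p A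
invertible there, so p A is a sum of lines indexed by a normal subgroup F of H. Basis vectors of
these lines produce γ, ε and a frame.

For F = H the third condition can be solved for ε. Two frames in one algebra have idempotents
conjugate under G, and comparing basis vectors line by line yields the cochain c. -/

noncomputable section

namespace ZG

open scoped MonObj

variable {k G : Type u} [Field k] [Group G] [Fintype G]

/-! ## Algebras in `Z(G)` as rings -/

section Ring

variable (X : ZG k G) [MonObj X]

/-- The multiplication of an algebra in `Z(G)` as a bilinear map. -/
def mulLin : X.V →ₗ[k] X.V →ₗ[k] X.V :=
  TensorProduct.curry (show X.V ⊗[k] X.V →ₗ[k] X.V from (μ[X] : X ⊗ X ⟶ X).toLin)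

/-- The unit element of an algebra in `Z(G)`. -/
def oneElt : X.V := (η[X] : 𝟙_ (ZG k G) ⟶ X).toLin (1 : k)

theorem one_toLin (r : k) : (η[X] : 𝟙_ (ZG k G) ⟶ X).toLin r = r • oneElt X := by
  have : (η[X] : 𝟙_ (ZG k G) ⟶ X).toLin (r • (1 : k)) = r • oneElt X := map_smul _ _ _
  rwa [smul_eq_mul, mul_one] at this

theorem oneElt_mulLin (x : X.V) : mulLin X (oneElt X) x = x := by
  have := LinearMap.congr_fun (congrArg Hom.toLin (MonObj.one_mul X)) ((1 : k) ⊗ₜ[k] x)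
  exact this.trans (one_smul k x)

theorem mulLin_oneElt (x : X.V) : mulLin X x (oneElt X) = x := by
  have := LinearMap.congr_fun (congrArg Hom.toLin (MonObj.mul_one X)) (x ⊗ₜ[k] (1 : k))
  exact this.trans (one_smul k x)

theorem mulLin_assoc (x y z : X.V) :
    mulLin X (mulLin X x y) z = mulLin X x (mulLin X y z) :=
  LinearMap.congr_fun (congrArg Hom.toLin (MonObj.mul_assoc X)) ((x ⊗ₜ[k] y) ⊗ₜ[k] z)

/-- The ring structure on the vector space underlying an algebra in `Z(G)`. -/
instance ring : Ring X.V where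
  -- The additive structure, integer multiples included, is that of the vector space itself, so that
  -- the ring and the `k`-module share one additive group definitionally.
  __ := X.addCommGroup
  mul x y := mulLin X x y
  one := oneElt X
  left_distrib x y z := map_add (mulLin X x) y z
  right_distrib x y z := LinearMap.map_add₂ (mulLin X) x y z
  zero_mul x := LinearMap.map_zero₂ (mulLin X) x
  mul_zero x := map_zero (mulLin X x)
  mul_assoc := mulLin_assoc X
  one_mul := oneElt_mulLin X
  mul_one := mulLin_oneElt X
  neg_add_cancel := neg_add_cancel
  zsmul := X.addCommGroup.zsmul
  zsmul_zero' := X.addCommGroup.zsmul_zero'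
  zsmul_succ' := X.addCommGroup.zsmul_succ'
  zsmul_neg' := X.addCommGroup.zsmul_neg'

theorem mulLin_apply (x y : X.V) : mulLin X x y = x * y := rfl

theorem oneElt_eq : oneElt X = 1 := rfl

instance : IsScalarTower k X.V X.V :=
  ⟨fun r x y => LinearMap.map_smul₂ (mulLin X) r x y⟩

instance : SMulCommClass k X.V X.V :=
  ⟨fun r x y => (map_smul (mulLin X x) r y).symm⟩

variable {X}

theorem one_toLin' (r : k) : (η[X] : 𝟙_ (ZG k G) ⟶ X).toLin r = r • (1 : X.V) :=
  one_toLin X r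

@[simp]
theorem act_mul (g : G) (x y : X.V) : X.act g (x * y) = X.act g x * X.act g y :=
  ((μ[X] : X ⊗ X ⟶ X).map_act g (x ⊗ₜ[k] y)).symm

@[simp]
theorem act_one (g : G) : X.act g (1 : X.V) = 1 :=
  ((η[X] : 𝟙_ (ZG k G) ⟶ X).map_act g (1 : k)).symm

theorem hom_mem_component {X Y : ZG k G} (f : X ⟶ Y) {g : G} {x : X.V} (hx : x ∈ X.component g) :
    f.toLin x ∈ Y.component g := by
  rw [mem_component] at hx ⊢
  rw [← f.map_proj, hx]

theorem mul_mem {a b : G} {x y : X.V} (hx : x ∈ X.component a) (hy : y ∈ X.component b) :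
    x * y ∈ X.component (a * b) :=
  hom_mem_component (μ[X] : X ⊗ X ⟶ X) (tmul_mem_component X X hx hy)

theorem one_mem : (1 : X.V) ∈ X.component 1 := by
  refine hom_mem_component (η[X] : 𝟙_ (ZG k G) ⟶ X) (x := (1 : k)) ?_
  exact mem_component.2 (unit_proj_one (G := G) (1 : k))

end Ring

/-! ### Homogeneous vectors; morphisms and algebras built from linear maps -/

theorem proj_mem (X : ZG k G) (g : G) (x : X.V) : X.proj g x ∈ X.component g := ⟨x, rfl⟩

theorem proj_of_mem {X : ZG k G} {g : G} {x : X.V} (hx : x ∈ X.component g) : X.proj g x = x :=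
  mem_component.1 hx

theorem proj_of_mem_ne {X : ZG k G} {g h : G} {x : X.V} (hx : x ∈ X.component g) (hne : h ≠ g) :
    X.proj h x = 0 := by
  rw [← proj_of_mem hx, X.proj_ne _ _ hne]

@[simp]
theorem act_act (X : ZG k G) (g h : G) (x : X.V) : X.act g (X.act h x) = X.act (g * h) x := by
  rw [map_mul, Module.End.mul_apply]

@[simp]
theorem act_one_apply (X : ZG k G) (x : X.V) : X.act 1 x = x := by
  rw [map_one, Module.End.one_apply]

/-- To prove a linear identity it suffices to check homogeneous vectors. -/
theorem ext_homogeneous {X : ZG k G} {M : Type*} [AddCommGroup M] [Module k M]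
    {φ ψ : X.V →ₗ[k] M} (h : ∀ g, ∀ x ∈ X.component g, φ x = ψ x) : φ = ψ := by
  ext x
  rw [← X.sum_proj x, map_sum, map_sum]
  exact Finset.sum_congr rfl fun g _ => h g _ (X.proj_mem g x)

/-- A linear map is graded as soon as it preserves the homogeneous components. -/
theorem map_proj_of_mem {X Y : ZG k G} (φ : X.V →ₗ[k] Y.V)
    (h : ∀ g, ∀ x ∈ X.component g, φ x ∈ Y.component g) (g : G) (x : X.V) :
    φ (X.proj g x) = Y.proj g (φ x) := by
  suffices φ ∘ₗ X.proj g = Y.proj g ∘ₗ φ from LinearMap.congr_fun this x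
  refine ext_homogeneous fun a x hx => ?_
  simp only [LinearMap.comp_apply]
  by_cases hg : g = a
  · subst hg
    rw [proj_of_mem hx, proj_of_mem (h _ _ hx)]
  · rw [proj_of_mem_ne hx hg, proj_of_mem_ne (h _ _ hx) hg, map_zero]

/-- A morphism of `Z(G)` from a linear map. -/
def mkHom {X Y : ZG k G} (φ : X.V →ₗ[k] Y.V) (ha : ∀ g x, φ (X.act g x) = Y.act g (φ x))
    (hd : ∀ g, ∀ x ∈ X.component g, φ x ∈ Y.component g) : X ⟶ Y :=
  ⟨φ, ha, map_proj_of_mem φ hd⟩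

/-- A morphism out of a tensor product of `Z(G)` from a bilinear map. -/
def mkHom₂ {X Y Z : ZG k G} (b : X.V →ₗ[k] Y.V →ₗ[k] Z.V)
    (ha : ∀ g x y, b (X.act g x) (Y.act g y) = Z.act g (b x y))
    (hd : ∀ g h, ∀ x ∈ X.component g, ∀ y ∈ Y.component h, b x y ∈ Z.component (g * h)) :
    X ⊗ Y ⟶ Z where
  toLin := TensorProduct.lift b
  map_act g v := by
    change TensorProduct.lift b ((X.tensor Y).act g v) = _
    induction v using TensorProduct.induction_on with
    | zero => simp
    | add v w hv hw => simp only [map_add, hv, hw]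
    | tmul x y =>
      rw [tensor_act_tmul, TensorProduct.lift.tmul, TensorProduct.lift.tmul, ha]
  map_proj g v := by
    change TensorProduct.lift b ((X.tensor Y).proj g v) = _
    induction v using TensorProduct.induction_on with
    | zero => simp
    | add v w hv hw => simp only [map_add, hv, hw]
    | tmul x y =>
      rw [tensor_proj_tmul, map_sum, TensorProduct.lift.tmul]
      simp only [TensorProduct.lift.tmul]
      have h1 : ∀ a c, b (X.proj a x) (Y.proj c y) ∈ Z.component (a * c) := fun a c =>
        hd a c _ (X.proj_mem a x) _ (Y.proj_mem c y)
      conv_rhs => rw [← X.sum_proj x, ← Y.sum_proj y]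
      simp only [map_sum, LinearMap.sum_apply]
      rw [Finset.sum_comm]
      refine Finset.sum_congr rfl fun a _ => ?_
      -- With the first factor in degree `a`, only the component of `y` in degree `a⁻¹ * g`
      -- contributes to degree `g`.
      rw [Finset.sum_eq_single (a⁻¹ * g)]
      · exact (proj_of_mem (by simpa using h1 a (a⁻¹ * g))).symm
      · intro c _ hc
        exact proj_of_mem_ne (h1 a c) (fun h => hc (by rw [h]; simp))
      · simp

/-- The morphism from the unit object given by an invariant vector of degree `1`. -/
def unitHom (X : ZG k G) (e : X.V) (hea : ∀ g, X.act g e = e) (hed : e ∈ X.component 1) :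
    unit k G ⟶ X where
  toLin := LinearMap.toSpanSingleton k _ e
  map_act g (r : k) := by simp [hea]
  map_proj g (r : k) := by
    by_cases hg : g = 1
    · subst hg
      simp [proj_of_mem hed]
    · simp [hg, proj_of_mem_ne hed hg]

/-- An algebra in `Z(G)` from a bilinear multiplication and a unit element. -/
@[reducible] def mkMonObj (X : ZG k G) (b : X.V →ₗ[k] X.V →ₗ[k] X.V) (e : X.V)
    (ha : ∀ g x y, b (X.act g x) (X.act g y) = X.act g (b x y))
    (hd : ∀ g h, ∀ x ∈ X.component g, ∀ y ∈ X.component h, b x y ∈ X.component (g * h))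
    (hea : ∀ g, X.act g e = e) (hed : e ∈ X.component 1)
    (hone : ∀ x, b e x = x) (hone' : ∀ x, b x e = x)
    (hassoc : ∀ x y z, b (b x y) z = b x (b y z)) : MonObj X where
  one := unitHom X e hea hed
  mul := mkHom₂ b ha hd
  one_mul := ZG.hom_ext <| TensorProduct.ext' fun (r : k) x => by
    change b (r • e) x = r • x
    rw [map_smul, LinearMap.smul_apply, hone]
  mul_one := ZG.hom_ext <| TensorProduct.ext' fun x (r : k) => by
    change b x (r • e) = r • x
    rw [map_smul, hone']
  mul_assoc := ZG.hom_ext <| TensorProduct.ext_threefold fun x y z => hassoc x y z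

/-- A homomorphism of algebras in `Z(G)` from a linear map. -/
def mkMonHom {A B : Mon (ZG k G)} (φ : A.X.V →ₗ[k] B.X.V)
    (ha : ∀ g x, φ (A.X.act g x) = B.X.act g (φ x))
    (hd : ∀ g, ∀ x ∈ A.X.component g, φ x ∈ B.X.component g)
    (hone : φ 1 = 1) (hmul : ∀ x y, φ (x * y) = φ x * φ y) : A ⟶ B where
  hom := mkHom φ ha hd
  isMonHom_hom :=
    { one_hom := ZG.hom_ext <| LinearMap.ext_ring (by
        change φ ((η[A.X] : 𝟙_ (ZG k G) ⟶ A.X).toLin (1 : k)) =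
          (η[B.X] : 𝟙_ (ZG k G) ⟶ B.X).toLin (1 : k)
        rw [one_toLin', one_toLin', one_smul, one_smul, hone])
      mul_hom := ZG.hom_ext <| TensorProduct.ext' fun x y => hmul x y }

theorem monHom_one {A B : Mon (ZG k G)} (f : A ⟶ B) : f.hom.toLin (1 : A.X.V) = 1 := by
  have := LinearMap.congr_fun (congrArg Hom.toLin (IsMonHom.one_hom f.hom)) (1 : k)
  exact this

theorem monHom_mul {A B : Mon (ZG k G)} (f : A ⟶ B) (x y : A.X.V) :
    f.hom.toLin (x * y) = f.hom.toLin x * f.hom.toLin y :=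
  LinearMap.congr_fun (congrArg Hom.toLin (IsMonHom.mul_hom f.hom)) (x ⊗ₜ[k] y)

/-- A bijective homomorphism of algebras is an isomorphism. -/
theorem mon_iso_of_bijective {A B : Mon (ZG k G)} (f : A ⟶ B)
    (hf : Function.Bijective f.hom.toLin) : Nonempty (A ≅ B) := by
  let e := LinearEquiv.ofBijective f.hom.toLin hf
  let i : A.X ≅ B.X := mkIso e f.hom.map_act f.hom.map_proj
  have hi : i.hom = f.hom := rfl
  have : IsMonHom i.hom := hi ▸ f.isMonHom_hom
  exact ⟨Mon.mkIso' i⟩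

theorem isZero_iff {X : ZG k G} : IsZero X ↔ Subsingleton X.V := by
  constructor
  · intro h
    have : (𝟙 X : X ⟶ X) = 0 := h.eq_of_src _ _
    refine ⟨fun x y => ?_⟩
    have h1 : ∀ x : X.V, x = 0 := fun x => LinearMap.congr_fun (congrArg Hom.toLin this) x
    rw [h1 x, h1 y]
  · intro h
    refine ⟨fun Y => ⟨⟨⟨0⟩, fun f => ?_⟩⟩, fun Y => ⟨⟨⟨0⟩, fun f => ?_⟩⟩⟩
    · refine hom_ext (LinearMap.ext fun x => ?_)
      rw [Subsingleton.elim x 0, map_zero, map_zero]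
    · exact hom_ext (LinearMap.ext fun x => Subsingleton.elim _ _)

/-- Commutativity of an algebra in `Z(G)` in terms of elements. -/
theorem isCommMonObj_iff {X : ZG k G} [MonObj X] :
    IsCommMonObj X ↔ ∀ g, ∀ x ∈ X.component g, ∀ y, X.act g y * x = x * y := by
  constructor
  · intro h g x hx y
    have := LinearMap.congr_fun (congrArg Hom.toLin (IsCommMonObj.mul_comm X)) (x ⊗ₜ[k] y)
    rw [comp_toLin, LinearMap.comp_apply, braiding_hom_toLin] at this
    erw [braidLin_tmul_of_mem X X hx] at this
    exact this
  · intro h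
    refine ⟨ZG.hom_ext <| TensorProduct.ext <| ext_homogeneous fun g x hx =>
      LinearMap.ext fun y => ?_⟩
    change (μ[X] : X ⊗ X ⟶ X).toLin (braidLin X X (x ⊗ₜ[k] y)) = x * y
    rw [braidLin_tmul_of_mem X X hx]
    exact h g x hx y

end ZG

end

noncomputable section

/-! ## Frames: an intrinsic description of the algebras `A(H, F, γ, ε)` -/

/-- A frame of type `(H, F, γ, ε)` in an algebra `A` of `Z(G)`: elements `u f` that behave like the
elements `a_{1,f}` of `A(H, F, γ, ε)`. -/
structure Frame {k G : Type u} [Field k] [Group G] [Fintype G] (A : Mon (ZG k G))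
    {H : Subgroup G} {F : Subgroup H} [F.Normal] (γ : TwoCocycle k F) (ε : H → F → kˣ) where
  /-- the element of degree `f` -/
  u : F → A.X.V
  u_mem : ∀ f : F, u f ∈ A.X.component ((f : H) : G)
  u_mul : ∀ f f' : F, u f * u f' = ((γ f f' : kˣ) : k) • u (f * f')
  act_u : ∀ (h : H) (f : F),
    A.X.act (h : G) (u f) = ((ε h f : kˣ) : k) • u (MulAut.conjNormal h f)
  orth : ∀ g : G, g ∉ H → u 1 * A.X.act g (u 1) = 0
  -- Summing over G instead of G/H avoids coset representatives. When ε is compatible, H fixes `u 1`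
  -- and each coset contributes |H| equal terms.
  sum_act : ∑ g, A.X.act g (u 1) = (Nat.card H : k) • (1 : A.X.V)
  u_one_ne : u 1 ≠ 0
  span : ∀ x, u 1 * x ∈ Submodule.span k (Set.range u)

theorem Subgroup.card_filter_mem {G : Type*} [Group G] [Fintype G] (H : Subgroup G)
    [DecidablePred (· ∈ H)] : (Finset.univ.filter (· ∈ H)).card = Nat.card H := by
  rw [Nat.card_eq_fintype_card, Fintype.card_subtype]

/-- Sums over G of terms supported on one coset stand in for sums over G/H; this supplies the
resulting factor |H|. -/
theorem Subgroup.sum_ite_mem {G M : Type*} [Group G] [Fintype G] [AddCommMonoid M]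
    (H : Subgroup G) [DecidablePred (· ∈ H)] (g : G) (m : M) :
    ∑ x, (if g⁻¹ * x ∈ H then m else 0) = Nat.card H • m := by
  rw [← Equiv.sum_comp (Equiv.mulLeft g)]
  simp only [Equiv.coe_mulLeft, inv_mul_cancel_left]
  rw [← Finset.sum_filter, Finset.sum_const, H.card_filter_mem]

namespace AlgA

variable {k G : Type u} [Field k] [Group G] {H : Subgroup G} {F : Subgroup H} [F.Normal]
  {γ : TwoCocycle k F} {ε : H → F → kˣ}

/-- The relations do not collapse the space: the functional equal to 1 on the `a_{g,1}` with g ∈ H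
and 0 on the other generators respects them, because ε_h(1) = 1. -/
theorem gen_one_ne_zero (hε : IsCompatible γ ε) : gen ε (1 : G) 1 ≠ 0 := by
  classical
  intro h
  let φ : Carrier ε →ₗ[k] k := lift (fun g f => if g ∈ H ∧ f = 1 then 1 else 0) fun g h f => by
    have h1 : MulAut.conjNormal h f = 1 ↔ f = 1 := by simp
    have h2 : g * (h : G) ∈ H ↔ g ∈ H := H.mul_mem_cancel_right h.2
    simp only [h1, h2]
    by_cases hf : f = 1
    · subst hf
      simp [hε.apply_one]
    · simp [hf]
  have h0 : φ (gen ε (1 : G) 1) = 1 := by simp [φ, H.one_mem]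
  rw [h, map_zero] at h0
  exact zero_ne_one h0

theorem one_mulBilin_mem_span (hε : IsCompatible γ ε) (x : Carrier ε) :
    mulBilin hε (gen ε (1 : G) 1) x ∈ Submodule.span k (Set.range (gen ε (1 : G))) := by
  rw [← Submodule.ker_mkQ (Submodule.span k (Set.range (gen ε (1 : G)))), LinearMap.mem_ker]
  -- Modulo the span, membership becomes the vanishing of a linear map, which can be tested on
  -- generators.
  suffices (Submodule.mkQ (Submodule.span k (Set.range (gen ε (1 : G))))) ∘ₗ
      mulBilin hε (gen ε (1 : G) 1) = 0 from LinearMap.congr_fun this x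
  refine hom_ext fun g f => ?_
  rw [LinearMap.comp_apply, LinearMap.zero_apply, ← LinearMap.mem_ker, Submodule.ker_mkQ]
  by_cases hg : g ∈ H
  · have := mulBilin_gen_coset hε (1 : G) ⟨g, hg⟩ 1 f
    rw [one_mul] at this
    rw [this]
    exact Submodule.smul_mem _ _ (Submodule.subset_span ⟨_, rfl⟩)
  · rw [mulBilin_gen_of_ne hε]
    · exact Submodule.zero_mem _
    · rw [ne_eq, QuotientGroup.eq]
      simpa using hg

/-- Both sides act alike by multiplication: `a_{x,1}` fixes `a_{g,f}` if x ∈ gH and kills it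
otherwise, so the sum multiplies every generator by |H|. Applying this to the unit gives the
identity. -/
theorem sum_gen_one [Fintype G] (hε : IsCompatible γ ε) :
    ∑ g, gen ε g 1 = (Nat.card H : k) • one ε := by
  classical
  have key : mulBilin hε (∑ g, gen ε g 1) = (Nat.card H : k) • LinearMap.id :=
    hom_ext fun g f => by
      rw [map_sum, LinearMap.sum_apply, LinearMap.smul_apply, LinearMap.id_apply,
        Nat.cast_smul_eq_nsmul, ← H.sum_ite_mem g]
      refine Finset.sum_congr rfl fun x _ => ?_
      split_ifs with hx
      · rw [← gen_one_eq hε (QuotientGroup.eq.2 hx), mulBilin_gen_same]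
        simp [γ.one_left]
      · refine mulBilin_gen_of_ne hε (fun h => hx ?_) _ _
        exact QuotientGroup.eq.1 h.symm
  rw [← mulBilin_one hε (∑ g, gen ε g 1), key]
  rfl

end AlgA

/-! ### Calculus with frames, and recognition of A(H, F, γ, ε) by its frame -/

namespace Frame

variable {k G : Type u} [Field k] [Group G] [Fintype G]
variable {H : Subgroup G} {F : Subgroup H} [F.Normal] {γ : TwoCocycle k F} {ε : H → F → kˣ}

/-- The frame of `A(H, F, γ, ε)` given by the elements `a_{1,f}`. -/
def ofAlgA (hε : IsCompatible γ ε) : Frame (algA H F γ ε hε) γ ε where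
  u f := AlgA.gen ε (1 : G) f
  u_mem f := by
    have := AlgA.proj_gen_self (ε := ε) (1 : G) f
    rw [one_mul, inv_one, mul_one] at this
    exact ZG.mem_component.2 this
  u_mul f f' := AlgA.mulBilin_gen_same hε 1 f f'
  act_u h f := by
    refine (AlgA.act_gen (ε := ε) (h : G) 1 f).trans ?_
    have := AlgA.gen_mul ε 1 h f
    rwa [mul_one, ← one_mul (h : G)]
  orth g hg := by
    refine (congrArg (AlgA.mulBilin hε (AlgA.gen ε (1 : G) 1))
      (AlgA.act_gen (ε := ε) g 1 1)).trans ?_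
    refine AlgA.mulBilin_gen_of_ne hε ?_ _ _
    rw [ne_eq, QuotientGroup.eq]
    simpa using hg
  sum_act := by
    refine Eq.trans (Finset.sum_congr rfl fun g _ => ?_) (AlgA.sum_gen_one hε) |>.trans ?_
    · refine (AlgA.act_gen (ε := ε) g 1 1).trans ?_
      rw [mul_one]
    · congr 1
      exact (one_smul k (AlgA.one ε)).symm
  u_one_ne := AlgA.gen_one_ne_zero hε
  span := AlgA.one_mulBilin_mem_span hε

/-- Transport of a frame along an isomorphism of algebras. -/
def map {A B : Mon (ZG k G)} (𝔣 : Frame A γ ε) (i : A ≅ B) : Frame B γ ε where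
  u f := i.hom.hom.toLin (𝔣.u f)
  u_mem f := ZG.hom_mem_component _ (𝔣.u_mem f)
  u_mul f f' := by rw [← ZG.monHom_mul, 𝔣.u_mul, map_smul]
  act_u h f := by rw [← i.hom.hom.map_act, 𝔣.act_u, map_smul]
  orth g hg := by rw [← i.hom.hom.map_act, ← ZG.monHom_mul, 𝔣.orth g hg, map_zero]
  sum_act := by
    simp_rw [← i.hom.hom.map_act]
    rw [← map_sum, 𝔣.sum_act, map_smul, ZG.monHom_one]
  u_one_ne h := 𝔣.u_one_ne (by
    have : i.inv.hom.toLin (i.hom.hom.toLin (𝔣.u 1)) = 𝔣.u 1 :=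
      LinearMap.congr_fun (congrArg (fun f => f.hom.toLin) i.hom_inv_id) (𝔣.u 1)
    rw [← this, h, map_zero])
  span x := by
    have : i.hom.hom.toLin (i.inv.hom.toLin x) = x :=
      LinearMap.congr_fun (congrArg (fun f => f.hom.toLin) i.inv_hom_id) x
    rw [← this, ← ZG.monHom_mul]
    have h := Submodule.mem_map_of_mem (f := i.hom.hom.toLin) (𝔣.span (i.inv.hom.toLin x))
    rwa [Submodule.map_span, ← Set.range_comp] at h

variable {A : Mon (ZG k G)} (𝔣 : Frame A γ ε)

/-- The element corresponding to `a_{g,f}`. -/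
def gen (g : G) (f : F) : A.X.V := A.X.act g (𝔣.u f)

theorem gen_one (f : F) : 𝔣.gen 1 f = 𝔣.u f := ZG.act_one_apply _ _

@[simp]
theorem act_gen (x g : G) (f : F) : A.X.act x (𝔣.gen g f) = 𝔣.gen (x * g) f :=
  ZG.act_act _ _ _ _

theorem gen_mem (g : G) (f : F) : 𝔣.gen g f ∈ A.X.component (g * f * g⁻¹) :=
  A.X.act_mem_component (𝔣.u_mem f)

theorem gen_mul_coset (g : G) (h : H) (f : F) :
    𝔣.gen (g * h) f = ((ε h f : kˣ) : k) • 𝔣.gen g (MulAut.conjNormal h f) := by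
  rw [gen, ← ZG.act_act, 𝔣.act_u, map_smul, gen]

theorem gen_mul_gen (g : G) (f f' : F) :
    𝔣.gen g f * 𝔣.gen g f' = ((γ f f' : kˣ) : k) • 𝔣.gen g (f * f') := by
  rw [gen, gen, ← ZG.act_mul, 𝔣.u_mul, map_smul, gen]

theorem u_one_mul (f : F) : 𝔣.u 1 * 𝔣.u f = 𝔣.u f := by
  rw [𝔣.u_mul, γ.one_left, Units.val_one, one_smul, one_mul]

theorem u_mul_one (f : F) : 𝔣.u f * 𝔣.u 1 = 𝔣.u f := by
  rw [𝔣.u_mul, γ.one_right, Units.val_one, one_smul, mul_one]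

theorem gen_one_mul (g : G) (f : F) : 𝔣.gen g 1 * 𝔣.gen g f = 𝔣.gen g f := by
  rw [gen, gen, ← ZG.act_mul, u_one_mul]

theorem gen_mul_one (g : G) (f : F) : 𝔣.gen g f * 𝔣.gen g 1 = 𝔣.gen g f := by
  rw [gen, gen, ← ZG.act_mul, u_mul_one]

theorem gen_one_orth {g g' : G} (h : g⁻¹ * g' ∉ H) : 𝔣.gen g 1 * 𝔣.gen g' 1 = 0 := by
  have : A.X.act g (𝔣.u 1 * A.X.act (g⁻¹ * g') (𝔣.u 1)) = 0 := by rw [𝔣.orth _ h, map_zero]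
  rw [ZG.act_mul, ZG.act_act, mul_inv_cancel_left] at this
  exact this

theorem gen_orth {g g' : G} (h : g⁻¹ * g' ∉ H) (f f' : F) : 𝔣.gen g f * 𝔣.gen g' f' = 0 := by
  rw [← 𝔣.gen_mul_one g f, ← 𝔣.gen_one_mul g' f', mul_assoc, ← mul_assoc (𝔣.gen g 1),
    𝔣.gen_one_orth h, zero_mul, mul_zero]

/-- Within the corner cut out by `u 1` each `u f` is invertible up to a scalar, with inverse a
multiple of `u f⁻¹`. -/
theorem u_ne_zero (f : F) : 𝔣.u f ≠ 0 := fun h => by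
  have := 𝔣.u_mul f f⁻¹
  rw [h, zero_mul, mul_inv_cancel] at this
  exact smul_ne_zero (Units.ne_zero _) 𝔣.u_one_ne this.symm

/-- The `u f` lie in pairwise distinct degrees, so a projection isolates a single coefficient. -/
theorem proj_of_mem_span {x : A.X.V} (hx : x ∈ Submodule.span k (Set.range 𝔣.u)) (f : F) :
    ∃ c : k, A.X.proj ((f : H) : G) x = c • 𝔣.u f := by
  have := Fintype.ofFinite F
  obtain ⟨c, rfl⟩ := (Submodule.mem_span_range_iff_exists_fun k).1 hx
  refine ⟨c f, ?_⟩
  rw [map_sum, Finset.sum_eq_single f]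
  · rw [map_smul, ZG.proj_of_mem (𝔣.u_mem f)]
  · intro f' _ hf
    rw [map_smul, ZG.proj_of_mem_ne (𝔣.u_mem f'), smul_zero]
    exact fun h => hf (Subtype.ext (Subtype.ext h)).symm
  · simp

theorem proj_of_mem_span_ne {x : A.X.V} (hx : x ∈ Submodule.span k (Set.range 𝔣.u)) {a : G}
    (ha : ∀ f : F, ((f : H) : G) ≠ a) : A.X.proj a x = 0 := by
  have := Fintype.ofFinite F
  obtain ⟨c, rfl⟩ := (Submodule.mem_span_range_iff_exists_fun k).1 hx
  rw [map_sum]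
  refine Finset.sum_eq_zero fun f _ => ?_
  rw [map_smul, ZG.proj_of_mem_ne (𝔣.u_mem f) (ha f).symm, smul_zero]

theorem u_one_mul_mem {a : G} {x : A.X.V} (hx : x ∈ A.X.component a) :
    𝔣.u 1 * x ∈ A.X.component a := by
  have := ZG.mul_mem (𝔣.u_mem 1) hx
  simpa using this

theorem exists_u_one_mul (f : F) {x : A.X.V} (hx : x ∈ A.X.component ((f : H) : G)) :
    ∃ c : k, 𝔣.u 1 * x = c • 𝔣.u f := by
  obtain ⟨c, hc⟩ := 𝔣.proj_of_mem_span (𝔣.span x) f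
  exact ⟨c, by rw [← hc, ZG.proj_of_mem (𝔣.u_one_mul_mem hx)]⟩

theorem u_one_mul_eq_zero {a : G} (ha : ∀ f : F, ((f : H) : G) ≠ a) {x : A.X.V}
    (hx : x ∈ A.X.component a) : 𝔣.u 1 * x = 0 := by
  rw [← ZG.proj_of_mem (𝔣.u_one_mul_mem hx), 𝔣.proj_of_mem_span_ne (𝔣.span x) ha]

section CharZero

variable [CharZero k]

theorem card_ne_zero (H : Subgroup G) : (Nat.card H : k) ≠ 0 :=
  Nat.cast_ne_zero.2 Nat.card_pos.ne'

theorem one_eq_sum : (1 : A.X.V) = (Nat.card H : k)⁻¹ • ∑ g, 𝔣.gen g 1 := by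
  rw [show ∑ g, 𝔣.gen g 1 = _ from 𝔣.sum_act, smul_smul, inv_mul_cancel₀ (card_ne_zero H),
    one_smul]

/-- Writing 1 as |H|⁻¹ ∑ g(u 1), the product g(u 1) x is the g-translate of u 1 * g⁻¹x, which the
frame places in the span of the `u f`. -/
theorem span_gen : Submodule.span k (Set.range fun p : G × F => 𝔣.gen p.1 p.2) = ⊤ := by
  rw [eq_top_iff]
  intro x _
  rw [← one_mul x, 𝔣.one_eq_sum, smul_mul_assoc, Finset.sum_mul]
  refine Submodule.smul_mem _ _ (Submodule.sum_mem _ fun g _ => ?_)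
  have h1 : 𝔣.gen g 1 * x = A.X.act g (𝔣.u 1 * A.X.act g⁻¹ x) := by
    rw [ZG.act_mul, ZG.act_act, mul_inv_cancel, ZG.act_one_apply, gen]
  rw [h1]
  have h := Submodule.mem_map_of_mem (f := A.X.act g) (𝔣.span (A.X.act g⁻¹ x))
  rw [Submodule.map_span, ← Set.range_comp] at h
  refine Submodule.span_mono ?_ h
  rintro _ ⟨f, rfl⟩
  exact ⟨(g, f), rfl⟩

theorem hom_ext {M : Type*} [AddCommGroup M] [Module k M] {φ ψ : A.X.V →ₗ[k] M}
    (h : ∀ g f, φ (𝔣.gen g f) = ψ (𝔣.gen g f)) : φ = ψ :=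
  LinearMap.ext_on_range 𝔣.span_gen fun p => h p.1 p.2

/-- The algebras with a frame are isomorphic to `A(H, F, γ, ε)`. -/
theorem nonempty_iso (𝔣 : Frame A γ ε) (hε : IsCompatible γ ε) :
    Nonempty (algA H F γ ε hε ≅ A) := by
  let φ : AlgA.Carrier ε →ₗ[k] A.X.V := AlgA.lift 𝔣.gen 𝔣.gen_mul_coset
  have hφ : ∀ g f, φ (AlgA.gen ε g f) = 𝔣.gen g f := AlgA.lift_gen _ _
  have hmul : ∀ x y, φ (AlgA.mulBilin hε x y) = φ x * φ y := fun x y => by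
    suffices (AlgA.mulBilin hε).compr₂ φ = (ZG.mulLin A.X).compl₁₂ φ φ from
      LinearMap.congr_fun (LinearMap.congr_fun this x) y
    refine AlgA.hom_ext fun g f => AlgA.hom_ext fun g' f' => ?_
    simp only [LinearMap.compr₂_apply, LinearMap.compl₁₂_apply, hφ, ZG.mulLin_apply]
    by_cases hg : g⁻¹ * g' ∈ H
    · obtain ⟨t, rfl⟩ : ∃ t : H, g' = g * t := ⟨⟨_, hg⟩, by simp⟩
      rw [AlgA.gen_mul, map_smul, AlgA.mulBilin_gen_same, 𝔣.gen_mul_coset, mul_smul_comm,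
        𝔣.gen_mul_gen, map_smul, map_smul, hφ]
    · rw [𝔣.gen_orth hg, AlgA.mulBilin_gen, AlgA.genMul_of_notMem hg, map_zero]
  have hact : ∀ g x, φ (AlgA.act ε g x) = A.X.act g (φ x) := fun g x => by
    suffices φ ∘ₗ AlgA.act ε g = A.X.act g ∘ₗ φ from LinearMap.congr_fun this x
    refine AlgA.hom_ext fun g f => ?_
    simp only [LinearMap.comp_apply, hφ, AlgA.act_gen, 𝔣.act_gen]
  have hproj : ∀ g x, φ (AlgA.proj ε g x) = A.X.proj g (φ x) := fun g x => by
    suffices φ ∘ₗ AlgA.proj ε g = A.X.proj g ∘ₗ φ from LinearMap.congr_fun this x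
    refine AlgA.hom_ext fun g' f => ?_
    simp only [LinearMap.comp_apply, hφ]
    by_cases hg : g' * f * g'⁻¹ = g
    · subst hg
      rw [AlgA.proj_gen_self, hφ, ZG.proj_of_mem (𝔣.gen_mem _ _)]
    · rw [AlgA.proj_gen_ne hg, map_zero, ZG.proj_of_mem_ne (𝔣.gen_mem _ _) (Ne.symm hg)]
  have hone : φ (AlgA.one ε) = 1 := by
    have := congrArg φ (AlgA.sum_gen_one hε)
    rw [map_smul, map_sum] at this
    rw [𝔣.one_eq_sum, eq_inv_smul_iff₀ (card_ne_zero H), ← this]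
    exact Finset.sum_congr rfl fun g _ => hφ g 1
  let Φ : algA H F γ ε hε ⟶ A := ZG.mkMonHom (A := algA H F γ ε hε) (B := A) φ hact
    (fun g x hx => by
      have h : AlgA.proj ε g x = x := ZG.proj_of_mem hx
      exact ZG.mem_component.2 ((hproj g x).symm.trans (congrArg φ h)))
    ((congrArg φ (one_smul k (AlgA.one ε))).trans hone) hmul
  refine ZG.mon_iso_of_bijective Φ ⟨?_, ?_⟩
  · rw [injective_iff_map_eq_zero]
    intro v hv
    by_contra hv0
    let 𝔤 := Frame.ofAlgA hε
    have hΦ : ∀ g x, A.X.act g (Φ.hom.toLin x) =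
        Φ.hom.toLin ((algA H F γ ε hε).X.act g x) := fun g x => (hact g x).symm
    -- The translates of `𝔤.u 1` add up to a nonzero multiple of 1, so one of them does not
    -- annihilate `v`. Translating back yields a nonzero kernel vector `w` in the corner of `𝔤.u 1`.
    obtain ⟨g, hg⟩ : ∃ g, 𝔤.gen g 1 * v ≠ 0 := by
      by_contra! h
      refine hv0 ?_
      rw [← one_mul v, 𝔤.one_eq_sum, smul_mul_assoc, Finset.sum_mul,
        Finset.sum_eq_zero fun g _ => h g, smul_zero]
    let w := 𝔤.u 1 * (algA H F γ ε hε).X.act g⁻¹ v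
    have hw0 : w ≠ 0 := fun h => hg <| by
      have := congrArg ((algA H F γ ε hε).X.act g) h
      rwa [ZG.act_mul, ZG.act_act, mul_inv_cancel, ZG.act_one_apply, map_zero] at this
    have hφw : Φ.hom.toLin w = 0 := by
      rw [ZG.monHom_mul, ← hΦ, hv, map_zero, mul_zero]
    refine hw0 ?_
    -- Each component of `w` is a multiple of some `𝔤.u f`, whose image `𝔣.u f` is nonzero. All
    -- components therefore vanish, and no linear independence of the generators is needed.
    rw [← (algA H F γ ε hε).X.sum_proj w]
    refine Finset.sum_eq_zero fun a _ => ?_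
    by_cases ha : ∃ f : F, ((f : H) : G) = a
    · obtain ⟨f, rfl⟩ := ha
      obtain ⟨c, hc⟩ := 𝔤.proj_of_mem_span (𝔤.span _) f
      rw [hc]
      have h1 := congrArg Φ.hom.toLin hc
      rw [Φ.hom.map_proj, hφw, map_zero, map_smul] at h1
      have h2 : Φ.hom.toLin (𝔤.u f) = 𝔣.u f := (hφ 1 f).trans (𝔣.gen_one f)
      rw [h2, eq_comm, smul_eq_zero_iff_left (𝔣.u_ne_zero f)] at h1
      rw [h1, zero_smul]
    · push Not at ha
      exact 𝔤.proj_of_mem_span_ne (𝔤.span _) ha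
  · rw [← LinearMap.range_eq_top, eq_top_iff, ← 𝔣.span_gen, Submodule.span_le]
    rintro _ ⟨p, rfl⟩
    exact ⟨AlgA.gen ε p.1 p.2, hφ _ _⟩

end CharZero

end Frame

end

/-! ### Averaging over G; criteria for separability and indecomposability -/

noncomputable section

namespace ZG

open scoped MonObj

variable {k G : Type u} [Field k] [Group G] [Fintype G]

/-- The projection of `X` onto the invariants of degree `1`. -/
def avg (X : ZG k G) : X.V →ₗ[k] X.V :=
  (Fintype.card G : k)⁻¹ • ∑ g, X.act g ∘ₗ X.proj 1

theorem avg_apply (X : ZG k G) (x : X.V) :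
    X.avg x = (Fintype.card G : k)⁻¹ • ∑ g, X.act g (X.proj 1 x) := by
  simp [avg, LinearMap.sum_apply]

theorem act_avg (X : ZG k G) (h : G) (x : X.V) : X.act h (X.avg x) = X.avg x := by
  rw [avg_apply, map_smul, map_sum]
  simp only [act_act]
  congr 1
  exact Equiv.sum_comp (Equiv.mulLeft h) (fun g => X.act g (X.proj 1 x))

theorem avg_mem (X : ZG k G) (x : X.V) : X.avg x ∈ X.component 1 := by
  rw [avg_apply]
  refine Submodule.smul_mem _ _ (Submodule.sum_mem _ fun g _ => ?_)
  have := X.act_mem_component (f := g) (X.proj_mem 1 x)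
  simpa using this

theorem avg_of_invariant [CharZero k] {X : ZG k G} {x : X.V} (hd : x ∈ X.component 1)
    (ha : ∀ g, X.act g x = x) : X.avg x = x := by
  rw [avg_apply, proj_of_mem hd]
  simp only [ha, Finset.sum_const, Finset.card_univ]
  rw [← Nat.cast_smul_eq_nsmul k, smul_smul,
    inv_mul_cancel₀ (Nat.cast_ne_zero.2 Fintype.card_ne_zero), one_smul]

theorem avg_act (X : ZG k G) (h : G) (x : X.V) : X.avg (X.act h x) = X.avg x := by
  rw [avg_apply, avg_apply]
  congr 1
  have : X.proj 1 (X.act h x) = X.act h (X.proj 1 x) := by rw [X.act_proj]; simp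
  rw [this]
  simp only [act_act]
  exact Equiv.sum_comp (Equiv.mulRight h) (fun g => X.act g (X.proj 1 x))

theorem avg_of_mem_ne {X : ZG k G} {g : G} {x : X.V} (hx : x ∈ X.component g) (hg : g ≠ 1) :
    X.avg x = 0 := by
  rw [avg_apply, proj_of_mem_ne hx hg.symm]
  simp

theorem avg_natural {X Y : ZG k G} (f : X ⟶ Y) (x : X.V) :
    f.toLin (X.avg x) = Y.avg (f.toLin x) := by
  simp only [avg_apply, map_smul, map_sum, f.map_act, f.map_proj]

/-- The map `p ⊗ q ↦ t(xp) q`. -/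
def contractLeft (X : ZG k G) [MonObj X] (t : X.V →ₗ[k] k) (x : X.V) : X.V ⊗[k] X.V →ₗ[k] X.V :=
  TensorProduct.lift ((LinearMap.lsmul k X.V).comp (t ∘ₗ mulLin X x))

theorem contractLeft_tmul {X : ZG k G} [MonObj X] (t : X.V →ₗ[k] k) (x p q : X.V) :
    X.contractLeft t x (p ⊗ₜ q) = t (x * p) • q := rfl

theorem contractLeft_add {X : ZG k G} [MonObj X] (t : X.V →ₗ[k] k) (x y : X.V) :
    X.contractLeft t (x + y) = X.contractLeft t x + X.contractLeft t y :=
  TensorProduct.ext' fun p q => by simp [contractLeft_tmul, add_mul, add_smul]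

theorem contractLeft_smul {X : ZG k G} [MonObj X] (t : X.V →ₗ[k] k) (c : k) (x : X.V) :
    X.contractLeft t (c • x) = c • X.contractLeft t x :=
  TensorProduct.ext' fun p q => by simp [contractLeft_tmul, smul_mul_assoc, mul_smul]

/-- The map `p ⊗ q ↦ t(qx) p`. -/
def contractRight (X : ZG k G) [MonObj X] (t : X.V →ₗ[k] k) (x : X.V) : X.V ⊗[k] X.V →ₗ[k] X.V :=
  TensorProduct.lift ((LinearMap.lsmul k X.V).comp (t ∘ₗ (mulLin X).flip x)).flip

theorem contractRight_tmul {X : ZG k G} [MonObj X] (t : X.V →ₗ[k] k) (x p q : X.V) :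
    X.contractRight t x (p ⊗ₜ q) = t (q * x) • p := rfl

theorem contractRight_add {X : ZG k G} [MonObj X] (t : X.V →ₗ[k] k) (x y : X.V) :
    X.contractRight t (x + y) = X.contractRight t x + X.contractRight t y :=
  TensorProduct.ext' fun p q => by simp [contractRight_tmul, mul_add, add_smul]

theorem contractRight_smul {X : ZG k G} [MonObj X] (t : X.V →ₗ[k] k) (c : k) (x : X.V) :
    X.contractRight t (c • x) = c • X.contractRight t x :=
  TensorProduct.ext' fun p q => by simp [contractRight_tmul, mul_smul_comm, mul_smul]

/-- The morphism to the unit object given by an invariant functional of degree `1`. -/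
def counitHom (X : ZG k G) (t : X.V →ₗ[k] k) (ha : ∀ g x, t (X.act g x) = t x)
    (hd : ∀ g ≠ 1, ∀ x ∈ X.component g, t x = 0) : X ⟶ unit k G where
  toLin := t
  map_act := ha
  map_proj g x := by
    by_cases hg : g = 1
    · subst hg
      rw [unit_proj_one]
      conv_rhs => rw [← X.sum_proj x, map_sum]
      rw [Finset.sum_eq_single 1]
      · intro g _ hg
        exact hd g hg _ (X.proj_mem g x)
      · simp
    · rw [unit_proj_ne hg, hd g hg _ (X.proj_mem g x)]

/-- Evaluated on elements, the two zigzag composites of the diagrammatic definition are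
`contractLeft` and `contractRight` applied to the copairing. -/
theorem isSeparableAlgebra_of {X : ZG k G} [MonObj X] (t : X.V →ₗ[k] k)
    (κ : X.V ⊗[k] X.V) (hta : ∀ g x, t (X.act g x) = t x)
    (htd : ∀ g ≠ 1, ∀ x ∈ X.component g, t x = 0)
    (hκa : ∀ g, (X.tensor X).act g κ = κ) (hκd : κ ∈ (X.tensor X).component 1)
    (h1 : ∀ x, X.contractLeft t x κ = x) (h2 : ∀ x, X.contractRight t x κ = x)
    (h3 : TensorProduct.lift (mulLin X) κ = 1) : IsSeparableAlgebra X := by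
  let m : X.V ⊗[k] X.V →ₗ[k] X.V := (μ[X] : X ⊗ X ⟶ X).toLin
  have hm : TensorProduct.lift (mulLin X) = m := TensorProduct.ext' fun p q => rfl
  refine ⟨counitHom X t hta htd, unitHom (X.tensor X) κ hκa hκd, ?_, ?_, ?_⟩
  · refine ZG.hom_ext (LinearMap.ext fun x => ?_)
    refine Eq.trans ?_ (h1 x)
    change TensorProduct.lid k X.V (TensorProduct.map (t ∘ₗ m)
      LinearMap.id ((TensorProduct.assoc k X.V X.V X.V).symm (x ⊗ₜ[k] ((1 : k) • κ)))) = _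
    rw [one_smul]
    suffices (TensorProduct.lid k X.V).toLinearMap ∘ₗ TensorProduct.map
        (t ∘ₗ m) LinearMap.id ∘ₗ
        (TensorProduct.assoc k X.V X.V X.V).symm.toLinearMap ∘ₗ
        TensorProduct.mk k X.V (X.V ⊗[k] X.V) x = X.contractLeft t x from
      LinearMap.congr_fun this κ
    exact TensorProduct.ext' fun p q => rfl
  · refine ZG.hom_ext (LinearMap.ext fun x => ?_)
    refine Eq.trans ?_ (h2 x)
    change TensorProduct.rid k X.V (TensorProduct.map LinearMap.id (t ∘ₗ m)
      ((TensorProduct.assoc k X.V X.V X.V) (((1 : k) • κ) ⊗ₜ[k] x))) = _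
    rw [one_smul]
    suffices (TensorProduct.rid k X.V).toLinearMap ∘ₗ TensorProduct.map LinearMap.id
        (t ∘ₗ m) ∘ₗ
        (TensorProduct.assoc k X.V X.V X.V).toLinearMap ∘ₗ
        (TensorProduct.mk k (X.V ⊗[k] X.V) X.V).flip x = X.contractRight t x from
      LinearMap.congr_fun this κ
    exact TensorProduct.ext' fun p q => rfl
  · refine ZG.hom_ext (LinearMap.ext_ring ?_)
    change m ((1 : k) • κ) = oneElt X
    rw [one_smul, ← hm, h3, oneElt_eq]

/-- The direct product of two objects. -/
@[reducible] def prod (X Y : ZG k G) : ZG k G where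
  V := X.V × Y.V
  act := X.act.prod Y.act
  proj g := (X.proj g).prodMap (Y.proj g)
  proj_self g v := by simp [X.proj_self, Y.proj_self]
  proj_ne g h hgh v := by simp [X.proj_ne g h hgh, Y.proj_ne g h hgh]
  sum_proj v := by
    refine Prod.ext ?_ ?_
    · simp [Prod.fst_sum, X.sum_proj]
    · simp [Prod.snd_sum, Y.sum_proj]
  act_proj f g v := by simp [X.act_proj, Y.act_proj]

theorem mem_prod_component {X Y : ZG k G} {g : G} {v : X.V × Y.V} :
    v ∈ (X.prod Y).component g ↔ v.1 ∈ X.component g ∧ v.2 ∈ Y.component g := by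
  rw [mem_component (X := X), mem_component (X := Y)]
  exact (mem_component (X := X.prod Y)).trans Prod.ext_iff

/-- The direct product of two algebras. -/
@[reducible] def monProd (A B : Mon (ZG k G)) : Mon (ZG k G) where
  X := A.X.prod B.X
  mon := mkMonObj (A.X.prod B.X)
    (LinearMap.mk₂ k (fun x y => (x.1 * y.1, x.2 * y.2))
      (fun x y z => by simp [add_mul]) (fun c x y => by simp [smul_mul_assoc])
      (fun x y z => by simp [mul_add]) (fun c x y => by simp [mul_smul_comm]))
    (1, 1) (fun g x y => by simp)
    (fun g h x hx y hy => by
      rw [mem_prod_component] at hx hy ⊢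
      exact ⟨mul_mem hx.1 hy.1, mul_mem hx.2 hy.2⟩)
    (fun g => by simp) (mem_prod_component.2 ⟨one_mem, one_mem⟩)
    (fun x => by simp) (fun x => by simp) (fun x y z => by simp [mul_assoc])

/-- An algebra whose only invariants of degree `1` are the scalars is indecomposable. -/
theorem isIndecomposableAlgebra_of {A : Mon (ZG k G)} (hne : (1 : A.X.V) ≠ 0)
    (h : ∀ x ∈ A.X.component 1, (∀ g, A.X.act g x = x) → ∃ c : k, x = c • 1) :
    IsIndecomposableAlgebra A := by
  refine ⟨fun hz => hne ((isZero_iff.1 hz).elim _ _), fun B₁ B₂ p₁ p₂ ⟨hl⟩ => ?_⟩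
  let π₁ : monProd B₁ B₂ ⟶ B₁ := mkMonHom (A := monProd B₁ B₂) (LinearMap.fst k B₁.X.V B₂.X.V)
    (fun _ _ => rfl) (fun g x hx => (mem_prod_component.1 hx).1)
    (congrArg Prod.fst (one_smul k ((1, 1) : B₁.X.V × B₂.X.V))) (fun _ _ => rfl)
  let π₂ : monProd B₁ B₂ ⟶ B₂ := mkMonHom (A := monProd B₁ B₂) (LinearMap.snd k B₁.X.V B₂.X.V)
    (fun _ _ => rfl) (fun g x hx => (mem_prod_component.1 hx).2)
    (congrArg Prod.snd (one_smul k ((1, 1) : B₁.X.V × B₂.X.V))) (fun _ _ => rfl)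
  let l : monProd B₁ B₂ ⟶ A := hl.lift (BinaryFan.mk π₁ π₂)
  have hl₁ : l ≫ p₁ = π₁ := hl.fac (BinaryFan.mk π₁ π₂) ⟨WalkingPair.left⟩
  have hl₂ : l ≫ p₂ = π₂ := hl.fac (BinaryFan.mk π₁ π₂) ⟨WalkingPair.right⟩
  have e₁ : ∀ x, p₁.hom.toLin (l.hom.toLin x) = π₁.hom.toLin x := fun x =>
    LinearMap.congr_fun (congrArg (fun f => f.hom.toLin) hl₁) x
  have e₂ : ∀ x, p₂.hom.toLin (l.hom.toLin x) = π₂.hom.toLin x := fun x =>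
    LinearMap.congr_fun (congrArg (fun f => f.hom.toLin) hl₂) x
  -- The idempotent (1, 0) is invariant of degree 1, so its image in `A` is a scalar c. Its two
  -- projections give 1 = c in B₁ and 0 = c in B₂, so one factor is zero.
  let w : B₁.X.V × B₂.X.V := (1, 0)
  have hw : w ∈ (B₁.X.prod B₂.X).component 1 :=
    mem_prod_component.2 ⟨one_mem, Submodule.zero_mem _⟩
  obtain ⟨c, hc⟩ := h (l.hom.toLin w) (hom_mem_component l.hom hw) fun g => by
    rw [← l.hom.map_act]
    congr 1
    exact Prod.ext (act_one g) (map_zero (B₂.X.act g))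
  have h₁ : (1 : B₁.X.V) = c • 1 := by
    have := e₁ w
    rw [hc, map_smul, monHom_one] at this
    exact this.symm
  have h₂ : (0 : B₂.X.V) = c • 1 := by
    have := e₂ w
    rw [hc, map_smul, monHom_one] at this
    exact this.symm
  by_cases hc0 : c = 0
  · left
    rw [hc0, zero_smul] at h₁
    exact isZero_iff.2 (subsingleton_of_zero_eq_one h₁.symm)
  · right
    have := (smul_eq_zero_iff_right hc0).1 h₂.symm
    exact isZero_iff.2 (subsingleton_of_zero_eq_one this.symm)

end ZG

/-- Used to see that the coefficients γ(f, f⁻¹)⁻¹ of the copairing absorb the factors ε that appear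
when the coset representative changes. -/
theorem IsCompatible.apply_mul_apply_inv {k H : Type*} [Field k] [Group H] {F : Subgroup H}
    [F.Normal] {γ : TwoCocycle k F} {ε : H → F → kˣ} (hε : IsCompatible γ ε) (h : H) (f : F) :
    γ f f⁻¹ = ε h f * ε h f⁻¹ * γ (MulAut.conjNormal h f) (MulAut.conjNormal h f)⁻¹ := by
  have := hε.act_mul h f f⁻¹
  rwa [mul_inv_cancel, hε.apply_one, mul_one, map_inv] at this

theorem TwoCocycle.inv_symm {k F : Type*} [Field k] [Group F] (γ : TwoCocycle k F)
    (f : F) : γ f⁻¹ f = γ f f⁻¹ := by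
  have := γ.cocycle f f⁻¹ f
  simpa [γ.one_left, γ.one_right] using this.symm

/-! ### A framed algebra is commutative, separable and indecomposable -/

namespace Frame

variable {k G : Type u} [Field k] [Group G] [Fintype G]
variable {H : Subgroup G} {F : Subgroup H} [F.Normal] {γ : TwoCocycle k F} {ε : H → F → kˣ}
variable {A : Mon (ZG k G)} (𝔣 : Frame A γ ε)

/-- This is braided commutativity on spanning vectors. Within one coset it reduces to the condition
`IsCompatible.comm`; for different cosets both products vanish. -/
theorem gen_conj_mul_gen (hε : IsCompatible γ ε) (g g' : G) (f f' : F) :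
    𝔣.gen (g * f * g⁻¹ * g') f' * 𝔣.gen g f = 𝔣.gen g f * 𝔣.gen g' f' := by
  by_cases hg : g⁻¹ * g' ∈ H
  · obtain ⟨t, rfl⟩ : ∃ t : H, g' = g * t := ⟨⟨_, hg⟩, by simp⟩
    have h1 : g * f * g⁻¹ * (g * t) = g * ((f : H) : G) * t := by group
    rw [h1, gen_mul_coset, gen_mul_coset, gen_mul_coset, smul_mul_assoc, smul_mul_assoc,
      mul_smul_comm, gen_mul_gen, gen_mul_gen, hε.comm f (MulAut.conjNormal t f'), Units.val_mul,
      mul_smul]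
    congr 4
    ext
    simp
  · rw [gen_orth _ hg, gen_orth]
    intro h
    refine hg ?_
    have h2 : (g * f * g⁻¹ * g')⁻¹ * g = (((f : H) : G) * (g⁻¹ * g'))⁻¹ := by group
    rw [h2, inv_mem_iff, H.mul_mem_cancel_left (f : H).2] at h
    exact h

theorem avg_gen_one (g : G) :
    A.X.avg (𝔣.gen g 1) = ((Fintype.card G : k)⁻¹ * (Nat.card H : k)) • (1 : A.X.V) := by
  rw [gen, ZG.avg_act, ZG.avg_apply, ZG.proj_of_mem (by simpa using 𝔣.u_mem 1), 𝔣.sum_act,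
    smul_smul]

theorem avg_gen_ne (g : G) {f : F} (hf : f ≠ 1) : A.X.avg (𝔣.gen g f) = 0 := by
  refine ZG.avg_of_mem_ne (𝔣.gen_mem g f) ?_
  simpa using hf

theorem one_ne_zero (𝔣 : Frame A γ ε) : (1 : A.X.V) ≠ 0 := fun h => 𝔣.u_one_ne <| by
  rw [← mul_one (𝔣.u 1), h, mul_zero]

/-- The part of the copairing supported on the coset `gH`. -/
def casimirBlock [Fintype F] (g : G) : A.X.V ⊗[k] A.X.V :=
  -- The coefficient is chosen so that each summand multiplies to `𝔣.gen g 1`.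
  ∑ f : F, (((γ f f⁻¹)⁻¹ : kˣ) : k) • (𝔣.gen g f ⊗ₜ[k] 𝔣.gen g f⁻¹)

theorem act_casimirBlock [Fintype F] (x g : G) :
    (A.X.tensor A.X).act x (𝔣.casimirBlock g) = 𝔣.casimirBlock (x * g) := by
  rw [casimirBlock, map_sum]
  refine Finset.sum_congr rfl fun f _ => ?_
  rw [map_smul, ZG.tensor_act_tmul, act_gen, act_gen]

theorem casimirBlock_mem [Fintype F] (g : G) :
    𝔣.casimirBlock g ∈ (A.X.tensor A.X).component 1 := by
  refine Submodule.sum_mem _ fun f _ => Submodule.smul_mem _ _ ?_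
  have := ZG.tmul_mem_component A.X A.X (𝔣.gen_mem g f) (𝔣.gen_mem g f⁻¹)
  simpa using this

theorem casimirBlock_mul_coset [Fintype F] (hε : IsCompatible γ ε) (g : G) (h : H) :
    𝔣.casimirBlock (g * h) = 𝔣.casimirBlock g := by
  unfold casimirBlock
  refine Fintype.sum_equiv (MulAut.conjNormal h : MulAut F).toEquiv _ _ fun f => ?_
  rw [gen_mul_coset, gen_mul_coset, TensorProduct.smul_tmul_smul, smul_smul, ← Units.val_mul,
    ← Units.val_mul, hε.apply_mul_apply_inv h f, map_inv]
  simp only [MulEquiv.toEquiv_eq_coe, EquivLike.coe_coe]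
  congr 2
  rw [mul_inv_rev, inv_mul_cancel_right]

theorem casimirBlock_eq_of_mem [Fintype F] (hε : IsCompatible γ ε) {g g' : G}
    (h : g⁻¹ * g' ∈ H) : 𝔣.casimirBlock g' = 𝔣.casimirBlock g := by
  obtain ⟨t, rfl⟩ : ∃ t : H, g' = g * t := ⟨⟨_, h⟩, by simp⟩
  exact 𝔣.casimirBlock_mul_coset hε g t

variable [CharZero k]

/-- Commutativity in a form that is bilinear in `x` and `y`, without a homogeneity assumption, so
that it can be tested on generators. -/
theorem sum_act_mul_proj (𝔣 : Frame A γ ε) (hε : IsCompatible γ ε) (x y : A.X.V) :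
    ∑ a, A.X.act a y * A.X.proj a x = x * y := by
  suffices ∑ a, (ZG.mulLin A.X).flip.compl₁₂ (A.X.proj a) (A.X.act a) = ZG.mulLin A.X by
    simpa [LinearMap.sum_apply, ZG.mulLin_apply] using
      LinearMap.congr_fun (LinearMap.congr_fun this x) y
  refine 𝔣.hom_ext fun g f => 𝔣.hom_ext fun g' f' => ?_
  simp only [LinearMap.sum_apply, LinearMap.compl₁₂_apply, LinearMap.flip_apply,
    ZG.mulLin_apply, act_gen]
  rw [Finset.sum_eq_single (g * f * g⁻¹)]
  · rw [ZG.proj_of_mem (𝔣.gen_mem g f), gen_conj_mul_gen _ hε]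
  · intro a _ ha
    rw [ZG.proj_of_mem_ne (𝔣.gen_mem g f) ha, mul_zero]
  · simp

theorem isCommMonObj (𝔣 : Frame A γ ε) (hε : IsCompatible γ ε) : IsCommMonObj A.X := by
  rw [ZG.isCommMonObj_iff]
  intro g x hx y
  rw [← 𝔣.sum_act_mul_proj hε x y, Finset.sum_eq_single g]
  · rw [ZG.proj_of_mem hx]
  · intro a _ ha
    rw [ZG.proj_of_mem_ne hx ha, mul_zero]
  · simp

/-- Averaging kills `gen g f` for f ≠ 1 for degree reasons and sends `gen g 1` to a multiple of 1,
so its range lies in the scalars. This yields both the counit and indecomposability. -/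
theorem exists_trace (𝔣 : Frame A γ ε) :
    ∃ T : A.X.V →ₗ[k] k, ∀ x, A.X.avg x = T x • (1 : A.X.V) := by
  obtain ⟨θ, hθ⟩ := LinearMap.exists_leftInverse_of_injective
    (LinearMap.toSpanSingleton k A.X.V 1) (LinearMap.ker_toSpanSingleton k 𝔣.one_ne_zero)
  have hθ1 : θ 1 = 1 := by simpa using LinearMap.congr_fun hθ (1 : k)
  refine ⟨θ ∘ₗ A.X.avg, fun x => ?_⟩
  suffices A.X.avg = (LinearMap.toSpanSingleton k A.X.V 1) ∘ₗ (θ ∘ₗ A.X.avg) from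
    LinearMap.congr_fun this x
  refine 𝔣.hom_ext fun g f => ?_
  simp only [LinearMap.comp_apply, LinearMap.toSpanSingleton_apply]
  by_cases hf : f = 1
  · subst hf
    rw [avg_gen_one, map_smul, hθ1, smul_eq_mul, mul_one]
  · rw [𝔣.avg_gen_ne g hf]
    simp

/-- The copairing. -/
def casimir [Fintype F] : A.X.V ⊗[k] A.X.V :=
  -- Division by |H| compensates for summing over G rather than G/H. Division by |F| makes the
  -- product of the copairing equal to 1, since the |F| terms of a block all multiply to the same
  -- `gen g 1`.
  ((Nat.card H : k) * (Nat.card F : k))⁻¹ • ∑ g, 𝔣.casimirBlock g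

theorem card_subgroup_ne_zero (F : Subgroup H) : (Nat.card F : k) ≠ 0 :=
  Nat.cast_ne_zero.2 Nat.card_pos.ne'

/-- The pairing and the copairing are inverse to each other. -/
theorem exists_counit [Fintype F] (𝔣 : Frame A γ ε) (hε : IsCompatible γ ε) :
    ∃ t : A.X.V →ₗ[k] k, ∃ d : k, d ≠ 0 ∧ (∀ x, A.X.avg x = (d * t x) • (1 : A.X.V)) ∧
      (∀ x, A.X.contractLeft t x 𝔣.casimir = x) ∧
      ∀ x, A.X.contractRight t x 𝔣.casimir = x := by
  classical
  obtain ⟨T, hT⟩ := 𝔣.exists_trace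
  have hG : (Fintype.card G : k) ≠ 0 := Nat.cast_ne_zero.2 Fintype.card_ne_zero
  have hH : (Nat.card H : k) ≠ 0 := card_ne_zero H
  have hF : (Nat.card F : k) ≠ 0 := card_subgroup_ne_zero F
  -- `T` takes the value |H|/|G| on `gen g 1`; dividing by `d` makes this |F|, which matches the
  -- normalisation of `casimir`.
  set d : k := (Nat.card H : k) * (Fintype.card G : k)⁻¹ * (Nat.card F : k)⁻¹ with hd
  have hd0 : d ≠ 0 := mul_ne_zero (mul_ne_zero hH (inv_ne_zero hG)) (inv_ne_zero hF)
  let t : A.X.V →ₗ[k] k := d⁻¹ • T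
  have ht1 : ∀ g, t (𝔣.gen g 1) = Nat.card F := fun g => by
    have h := hT (𝔣.gen g 1)
    rw [avg_gen_one] at h
    have := smul_left_injective k 𝔣.one_ne_zero h
    simp only [t, LinearMap.smul_apply, ← this, hd, smul_eq_mul]
    field_simp
  have ht : ∀ g (f : F), f ≠ 1 → t (𝔣.gen g f) = 0 := fun g f hf => by
    have h := hT (𝔣.gen g f)
    rw [avg_gen_ne _ g hf, eq_comm, smul_eq_zero_iff_left 𝔣.one_ne_zero] at h
    simp [t, h]
  -- Contraction against a vector supported on gH only sees the blocks of the |H| elements of gH,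
  -- and these blocks are all equal.
  have hsum : ∀ (g : G) (x : A.X.V) (m : A.X.V ⊗[k] A.X.V →ₗ[k] A.X.V),
      (∀ g', g⁻¹ * g' ∉ H → m (𝔣.casimirBlock g') = 0) →
      m (𝔣.casimirBlock g) = (Nat.card F : k) • x → m 𝔣.casimir = x := fun g x m h0 h1 => by
    rw [casimir, map_smul, map_sum, inv_smul_eq_iff₀ (mul_ne_zero hH hF), mul_smul,
      Nat.cast_smul_eq_nsmul k (Nat.card H), ← h1, ← H.sum_ite_mem g]
    refine Finset.sum_congr rfl fun g' _ => ?_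
    split_ifs with hg
    · rw [𝔣.casimirBlock_eq_of_mem hε hg]
    · exact h0 g' hg
  refine ⟨t, d, hd0, fun x => by simp [t, hT, hd0], ?_, ?_⟩
  · intro x
    have hx : x ∈ Submodule.span k (Set.range fun p : G × F => 𝔣.gen p.1 p.2) :=
      𝔣.span_gen ▸ Submodule.mem_top
    induction hx using Submodule.span_induction with
    | zero =>
      have := A.X.contractLeft_smul t 0 0
      rw [zero_smul, zero_smul] at this
      rw [this, LinearMap.zero_apply]
    | add x y _ _ hx hy => rw [ZG.contractLeft_add, LinearMap.add_apply, hx, hy]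
    | smul c x _ hx => rw [ZG.contractLeft_smul, LinearMap.smul_apply, hx]
    | mem x hx =>
      obtain ⟨⟨g, f⟩, rfl⟩ := hx
      refine hsum g _ _ (fun g' hg => ?_) ?_
      · rw [casimirBlock, map_sum]
        refine Finset.sum_eq_zero fun f' _ => ?_
        rw [map_smul, ZG.contractLeft_tmul, gen_orth _ hg, map_zero, zero_smul, smul_zero]
      · rw [casimirBlock, map_sum, Finset.sum_eq_single f⁻¹]
        · rw [map_smul, ZG.contractLeft_tmul, gen_mul_gen, mul_inv_cancel, map_smul, ht1,
            inv_inv, γ.inv_symm, smul_eq_mul, smul_smul, ← mul_assoc, Units.inv_mul, one_mul]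
        · intro f' _ hf
          rw [map_smul, ZG.contractLeft_tmul, gen_mul_gen, map_smul, ht, smul_zero, zero_smul,
            smul_zero]
          exact fun h => hf (eq_inv_of_mul_eq_one_right h)
        · simp
  · intro x
    have hx : x ∈ Submodule.span k (Set.range fun p : G × F => 𝔣.gen p.1 p.2) :=
      𝔣.span_gen ▸ Submodule.mem_top
    induction hx using Submodule.span_induction with
    | zero =>
      have := A.X.contractRight_smul t 0 0
      rw [zero_smul, zero_smul] at this
      rw [this, LinearMap.zero_apply]
    | add x y _ _ hx hy => rw [ZG.contractRight_add, LinearMap.add_apply, hx, hy]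
    | smul c x _ hx => rw [ZG.contractRight_smul, LinearMap.smul_apply, hx]
    | mem x hx =>
      obtain ⟨⟨g, f⟩, rfl⟩ := hx
      refine hsum g _ _ (fun g' hg => ?_) ?_
      · rw [casimirBlock, map_sum]
        refine Finset.sum_eq_zero fun f' _ => ?_
        rw [map_smul, ZG.contractRight_tmul, gen_orth, map_zero, zero_smul, smul_zero]
        rwa [← H.inv_mem_iff, mul_inv_rev, inv_inv]
      · rw [casimirBlock, map_sum, Finset.sum_eq_single f]
        · rw [map_smul, ZG.contractRight_tmul, gen_mul_gen, inv_mul_cancel, map_smul, ht1,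
            γ.inv_symm, smul_eq_mul, smul_smul, ← mul_assoc, Units.inv_mul, one_mul]
        · intro f' _ hf
          rw [map_smul, ZG.contractRight_tmul, gen_mul_gen, map_smul, ht, smul_zero, zero_smul,
            smul_zero]
          exact fun h => hf (inv_mul_eq_one.1 h)
        · simp

theorem isSeparableAlgebra (𝔣 : Frame A γ ε) (hε : IsCompatible γ ε) :
    IsSeparableAlgebra A.X := by
  have := Fintype.ofFinite F
  obtain ⟨t, d, hd, ht, h1, h2⟩ := 𝔣.exists_counit hε
  -- Invariance and degree of `t` are read off from those of the averaging map, which is `d * t`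
  -- times the unit.
  have hinj : ∀ {a b : k}, (d * a) • (1 : A.X.V) = (d * b) • 1 → a = b := fun h =>
    mul_left_cancel₀ hd (smul_left_injective k 𝔣.one_ne_zero h)
  refine ZG.isSeparableAlgebra_of t 𝔣.casimir (fun g x => ?_) (fun g hg x hx => ?_)
    (fun g => ?_) ?_ h1 h2 ?_
  · refine hinj ?_
    rw [← ht, ← ht, ZG.avg_act]
  · refine hinj ?_
    rw [← ht, ZG.avg_of_mem_ne hx hg, mul_zero, zero_smul]
  · rw [casimir, map_smul, map_sum]
    congr 1
    refine Eq.trans (Finset.sum_congr rfl fun x _ => 𝔣.act_casimirBlock g x) ?_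
    exact Equiv.sum_comp (Equiv.mulLeft g) 𝔣.casimirBlock
  · exact Submodule.smul_mem _ _ (Submodule.sum_mem _ fun g _ => 𝔣.casimirBlock_mem g)
  · have hb : ∀ g, TensorProduct.lift (ZG.mulLin A.X) (𝔣.casimirBlock g) =
        (Nat.card F : k) • 𝔣.gen g 1 := fun g => by
      rw [casimirBlock, map_sum, Nat.card_eq_fintype_card, Nat.cast_smul_eq_nsmul,
        ← Finset.card_univ, ← Finset.sum_const]
      refine Finset.sum_congr rfl fun f _ => ?_
      rw [map_smul, TensorProduct.lift.tmul, ZG.mulLin_apply, gen_mul_gen, mul_inv_cancel,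
        smul_smul, Units.inv_mul, one_smul]
    rw [casimir, map_smul, map_sum, Finset.sum_congr rfl fun g _ => hb g, ← Finset.smul_sum,
      𝔣.one_eq_sum, smul_smul]
    congr 1
    have := card_ne_zero (k := k) H
    have := card_subgroup_ne_zero (k := k) F
    field_simp

theorem isCommSepIndec (𝔣 : Frame A γ ε) (hε : IsCompatible γ ε) : IsCommSepIndec A where
  comm := 𝔣.isCommMonObj hε
  separable := 𝔣.isSeparableAlgebra hε
  indecomposable := by
    obtain ⟨T, hT⟩ := 𝔣.exists_trace
    exact ZG.isIndecomposableAlgebra_of 𝔣.one_ne_zero fun x hd ha =>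
      ⟨T x, by rw [← hT, ZG.avg_of_invariant hd ha]⟩

end Frame

end

noncomputable section

theorem ZG.mul_proj_of_mem_one {k G : Type u} [Field k] [Group G] [Fintype G] {X : ZG k G}
    [MonObj X] {e : X.V} (he : e ∈ X.component 1) (g : G) (x : X.V) :
    e * X.proj g x = X.proj g (e * x) :=
  ZG.map_proj_of_mem (mulLin X e) (fun a y hy => by
    have := mul_mem he hy
    rwa [one_mul] at this) g x

/-! ## Modules over algebras in `Z(G)` -/

namespace RightModule

open scoped MonObj

variable {k G : Type u} [Field k] [Group G] [Fintype G] {A : Mon (ZG k G)}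

/-- The action of a right module as a bilinear map. -/
def rsmul (M : RightModule A) : M.X.V →ₗ[k] A.X.V →ₗ[k] M.X.V :=
  TensorProduct.curry (show M.X.V ⊗[k] A.X.V →ₗ[k] M.X.V from M.act.toLin)

@[simp]
theorem rsmul_one (M : RightModule A) (m : M.X.V) : M.rsmul m 1 = m := by
  have := LinearMap.congr_fun (congrArg ZG.Hom.toLin M.act_one) (m ⊗ₜ[k] (1 : k))
  exact this.trans (one_smul k m)

theorem rsmul_rsmul (M : RightModule A) (m : M.X.V) (a b : A.X.V) :
    M.rsmul (M.rsmul m a) b = M.rsmul m (a * b) :=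
  LinearMap.congr_fun (congrArg ZG.Hom.toLin M.act_act) ((m ⊗ₜ[k] a) ⊗ₜ[k] b)

theorem act_rsmul (M : RightModule A) (g : G) (m : M.X.V) (a : A.X.V) :
    M.X.act g (M.rsmul m a) = M.rsmul (M.X.act g m) (A.X.act g a) :=
  (M.act.map_act g (m ⊗ₜ[k] a)).symm

theorem rsmul_mem (M : RightModule A) {g h : G} {m : M.X.V} {a : A.X.V}
    (hm : m ∈ M.X.component g) (ha : a ∈ A.X.component h) : M.rsmul m a ∈ M.X.component (g * h) :=
  ZG.hom_mem_component M.act (ZG.tmul_mem_component M.X A.X hm ha)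

theorem hom_rsmul {M N : RightModule A} (f : M ⟶ N) (m : M.X.V) (a : A.X.V) :
    f.hom.toLin (M.rsmul m a) = N.rsmul (f.hom.toLin m) a :=
  (LinearMap.congr_fun (congrArg ZG.Hom.toLin (Hom.comm f)) (m ⊗ₜ[k] a)).symm

/-- A right module in `Z(G)` from a bilinear map. -/
@[reducible] def mk' (X : ZG k G) (b : X.V →ₗ[k] A.X.V →ₗ[k] X.V)
    (ha : ∀ g x y, b (X.act g x) (A.X.act g y) = X.act g (b x y))
    (hd : ∀ g h, ∀ x ∈ X.component g, ∀ y ∈ A.X.component h, b x y ∈ X.component (g * h))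
    (hone : ∀ x, b x 1 = x) (hmul : ∀ x y z, b (b x y) z = b x (y * z)) : RightModule A where
  X := X
  act := ZG.mkHom₂ b ha hd
  act_one := ZG.hom_ext <| TensorProduct.ext' fun x (r : k) => by
    change b x ((η[A.X] : 𝟙_ (ZG k G) ⟶ A.X).toLin r) = r • x
    rw [ZG.one_toLin', map_smul, hone]
  act_act := ZG.hom_ext <| TensorProduct.ext_threefold hmul

/-- A homomorphism of right modules from a linear map. -/
def mkHom {M N : RightModule A} (φ : M.X.V →ₗ[k] N.X.V)
    (ha : ∀ g x, φ (M.X.act g x) = N.X.act g (φ x))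
    (hd : ∀ g, ∀ x ∈ M.X.component g, φ x ∈ N.X.component g)
    (hs : ∀ m a, φ (M.rsmul m a) = N.rsmul (φ m) a) : M ⟶ N :=
  (⟨ZG.mkHom φ ha hd, ZG.hom_ext <| TensorProduct.ext' fun m a => (hs m a).symm⟩ : Hom M N)

/-- A bijective homomorphism of modules is an isomorphism. -/
theorem iso_of_bijective {M N : RightModule A} (f : M ⟶ N)
    (hf : Function.Bijective f.hom.toLin) : Nonempty (M ≅ N) := by
  let e := LinearEquiv.ofBijective f.hom.toLin hf
  have he : ∀ x, e.symm (f.hom.toLin x) = x := e.symm_apply_apply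
  have he' : ∀ x, f.hom.toLin (e.symm x) = x := e.apply_symm_apply
  refine ⟨⟨f, mkHom e.symm.toLinearMap (fun g x => ?_) (fun g x hx => ?_) (fun m a => ?_), ?_, ?_⟩⟩
  · apply hf.1
    rw [f.hom.map_act]
    exact (he' _).trans (congrArg _ (he' x).symm)
  · rw [ZG.mem_component] at hx ⊢
    apply hf.1
    rw [f.hom.map_proj]
    exact (congrArg _ (he' x)).trans (hx.trans (he' x).symm)
  · apply hf.1
    rw [hom_rsmul]
    refine (he' _).trans ?_
    congr 1
    exact congrArg _ (he' m).symm
  · exact hom_ext (ZG.hom_ext (LinearMap.ext he))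
  · exact hom_ext (ZG.hom_ext (LinearMap.ext he'))

/-- Locality of a module in terms of elements. -/
theorem isLocal_iff {M : RightModule A} : isLocal A M ↔
    ∀ x y, ∀ m ∈ M.X.component x, ∀ a ∈ A.X.component y,
      M.rsmul (M.X.act (x * y * x⁻¹) m) (A.X.act x a) = M.rsmul m a := by
  have key : ∀ x y, ∀ m ∈ M.X.component x, ∀ a ∈ A.X.component y,
      ((β_ M.X A.X).hom ≫ (β_ A.X M.X).hom ≫ M.act).toLin (m ⊗ₜ[k] a) =
        M.rsmul (M.X.act (x * y * x⁻¹) m) (A.X.act x a) := fun x y m hm a ha => by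
    change M.act.toLin (ZG.braidLin A.X M.X (ZG.braidLin M.X A.X (m ⊗ₜ[k] a))) = _
    rw [ZG.braidLin_tmul_of_mem _ _ hm, ZG.braidLin_tmul_of_mem _ _ (A.X.act_mem_component ha)]
    rfl
  constructor
  · intro h x y m hm a ha
    rw [← key x y m hm a ha, h]
    rfl
  · intro h
    refine ZG.hom_ext (TensorProduct.ext (ZG.ext_homogeneous fun x m hm =>
      ZG.ext_homogeneous fun y a ha => ?_))
    exact (key x y m hm a ha).trans (h x y m hm a ha)

end RightModule

/-- An algebra as a right module over itself. -/
@[reducible] def RightModule.regular {k G : Type u} [Field k] [Group G] [Fintype G]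
    (A : Mon (ZG k G)) : RightModule A :=
  RightModule.mk' A.X (ZG.mulLin A.X) (fun g x y => (ZG.act_mul g x y).symm)
    (fun _ _ _ hx _ hy => ZG.mul_mem hx hy) mul_one mul_assoc

/-- Commutativity used twice undoes the two braidings. -/
theorem RightModule.regular_isLocal {k G : Type u} [Field k] [Group G] [Fintype G]
    {A : Mon (ZG k G)} (hA : ∀ g, ∀ x ∈ A.X.component g, ∀ y, A.X.act g y * x = x * y) :
    RightModule.isLocal A (RightModule.regular A) := by
  rw [RightModule.isLocal_iff]
  intro x y m hm a ha
  change A.X.act (x * y * x⁻¹) m * A.X.act x a = m * a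
  rw [hA _ _ (A.X.act_mem_component ha), hA _ _ hm]

/-- The property of vector spaces that detects non-trivialising algebras. Nonvanishing is phrased
through identity morphisms so that it transports along an equivalence. -/
theorem FGModuleCat.exists_hom_ne_zero {k : Type u} [Field k] {V W : FGModuleCat.{u} k}
    (hV : (𝟙 V : V ⟶ V) ≠ 0) (hW : (𝟙 W : W ⟶ W) ≠ 0) : ∃ f : V ⟶ W, f ≠ 0 := by
  have hv : ∀ V : FGModuleCat.{u} k, (𝟙 V : V ⟶ V) ≠ 0 → ∃ v : V, v ≠ 0 := fun V hV => by
    by_contra! h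
    exact hV (FGModuleCat.hom_ext (LinearMap.ext h))
  obtain ⟨v, hv0⟩ := hv V hV
  obtain ⟨w, hw0⟩ := hv W hW
  obtain ⟨θ, hθ⟩ := LinearMap.exists_leftInverse_of_injective
    (LinearMap.toSpanSingleton k V v) (LinearMap.ker_toSpanSingleton k hv0)
  have hθ1 : θ v = 1 := by simpa using LinearMap.congr_fun hθ (1 : k)
  let f : V ⟶ W := FGModuleCat.ofHom ((LinearMap.toSpanSingleton k W w) ∘ₗ θ)
  refine ⟨f, fun h => hw0 ?_⟩
  have h1 : LinearMap.toSpanSingleton k W w (θ v) = 0 :=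
    LinearMap.congr_fun (congrArg (fun f : V ⟶ W => f.hom.hom) h) v
  rwa [hθ1, LinearMap.toSpanSingleton_apply, one_smul] at h1

/-! ### Necessity of F = H: a local module without invariants -/

namespace Frame

variable {k G : Type u} [Field k] [Group G] [Fintype G]
variable {H : Subgroup G} {F : Subgroup H} [F.Normal] {γ : TwoCocycle k F} {ε : H → F → kˣ}
variable {A : Mon (ZG k G)} (𝔣 : Frame A γ ε)

theorem act_u_one (hε : IsCompatible γ ε) (h : H) : A.X.act (h : G) (𝔣.u 1) = 𝔣.u 1 := by
  rw [𝔣.act_u, hε.apply_one, map_one, Units.val_one, one_smul]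

/-- The functions `Φ : G → u₁ A` with `f (Φ (g f)) = Φ g` for `f ∈ F` and
`∑_{h ∈ H} h (Φ (g h)) = 0`. -/
def twistedSubmodule : Submodule k (G → A.X.V) where
  -- The first two conditions give F-equivariant functions. Those equivariant under all of H form a
  -- copy of `A`, through a ↦ (g ↦ u 1 * g⁻¹a), and in characteristic zero the vanishing of the
  -- H-average cuts out a complement.
  carrier := {Φ | (∀ g, 𝔣.u 1 * Φ g = Φ g) ∧
    (∀ (g : G) (f : F), A.X.act ((f : H) : G) (Φ (g * f)) = Φ g) ∧
    ∀ g : G, ∑ᶠ h : H, A.X.act (h : G) (Φ (g * h)) = 0}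
  add_mem' {Φ Ψ} hΦ hΨ := by
    refine ⟨fun g => ?_, fun g f => ?_, fun g => ?_⟩
    · rw [Pi.add_apply, mul_add, hΦ.1, hΨ.1]
    · rw [Pi.add_apply, map_add, hΦ.2.1, hΨ.2.1, Pi.add_apply]
    · simp only [Pi.add_apply, map_add]
      rw [finsum_add_distrib (Set.toFinite _) (Set.toFinite _), hΦ.2.2, hΨ.2.2, add_zero]
  zero_mem' := by simp
  smul_mem' c Φ hΦ := by
    refine ⟨fun g => ?_, fun g f => ?_, fun g => ?_⟩
    · rw [Pi.smul_apply, mul_smul_comm, hΦ.1]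
    · rw [Pi.smul_apply, map_smul, hΦ.2.1, Pi.smul_apply]
    · simp only [Pi.smul_apply, map_smul]
      rw [← smul_finsum, hΦ.2.2, smul_zero]

/-- The translation action on `twistedSubmodule`. -/
def twistedAct (x : G) : 𝔣.twistedSubmodule →ₗ[k] 𝔣.twistedSubmodule :=
  (LinearMap.funLeft k A.X.V (fun g => x⁻¹ * g)).restrict fun Φ hΦ =>
    ⟨fun g => hΦ.1 _, fun g f => by
        simp only [LinearMap.funLeft_apply, ← mul_assoc]
        exact hΦ.2.1 _ _, fun g => by
        simp only [LinearMap.funLeft_apply, ← mul_assoc]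
        exact hΦ.2.2 _⟩

/-- The grading of `twistedSubmodule`. -/
def twistedProj (x : G) : 𝔣.twistedSubmodule →ₗ[k] 𝔣.twistedSubmodule :=
  (LinearMap.pi fun g => A.X.proj (g⁻¹ * x * g) ∘ₗ LinearMap.proj g :
    (G → A.X.V) →ₗ[k] (G → A.X.V)).restrict fun Φ hΦ => by
    have key : ∀ g h : G, A.X.act h (A.X.proj ((g * h)⁻¹ * x * (g * h)) (Φ (g * h))) =
        A.X.proj (g⁻¹ * x * g) (A.X.act h (Φ (g * h))) := fun g h => by
      rw [A.X.act_proj]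
      congr 2
      group
    refine ⟨fun g => ?_, fun g f => ?_, fun g => ?_⟩
    · simp only [LinearMap.pi_apply, LinearMap.comp_apply, LinearMap.proj_apply]
      rw [ZG.mul_proj_of_mem_one (by simpa using 𝔣.u_mem 1), hΦ.1]
    · simp only [LinearMap.pi_apply, LinearMap.comp_apply, LinearMap.proj_apply]
      rw [key, hΦ.2.1]
    · simp only [LinearMap.pi_apply, LinearMap.comp_apply, LinearMap.proj_apply, key]
      have := congrArg (A.X.proj (g⁻¹ * x * g)) (hΦ.2.2 g)
      rw [map_finsum _ (Set.toFinite _), map_zero] at this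
      exact this

/-- The object of `Z(G)` underlying the module of functions `twistedSubmodule`. -/
@[reducible] def twistedObj : ZG k G where
  V := 𝔣.twistedSubmodule
  act :=
    { toFun := 𝔣.twistedAct
      map_one' := by
        ext Φ g
        simp [twistedAct, LinearMap.funLeft_apply]
      map_mul' x y := by
        ext Φ g
        change Φ.1 ((x * y)⁻¹ * g) = Φ.1 (y⁻¹ * (x⁻¹ * g))
        rw [mul_inv_rev, mul_assoc] }
  proj := 𝔣.twistedProj
  proj_self x Φ := Subtype.ext <| funext fun g => A.X.proj_self _ _
  proj_ne x y hxy Φ := Subtype.ext <| funext fun g => A.X.proj_ne _ _ (by simpa using hxy) _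
  sum_proj Φ := Subtype.ext <| funext fun g => by
    rw [AddSubmonoidClass.coe_finsetSum, Finset.sum_apply]
    refine Eq.trans ?_ (A.X.sum_proj (Φ.1 g))
    exact Fintype.sum_equiv (MulAut.conj g⁻¹).toEquiv _ _ fun x => by
      change A.X.proj (g⁻¹ * x * g) (Φ.1 g) = A.X.proj (g⁻¹ * x * g⁻¹⁻¹) (Φ.1 g)
      rw [inv_inv]
  act_proj x y Φ := Subtype.ext <| funext fun g => by
    change A.X.proj ((x⁻¹ * g)⁻¹ * y * (x⁻¹ * g)) (Φ.1 (x⁻¹ * g)) =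
      A.X.proj (g⁻¹ * (x * y * x⁻¹) * g) (Φ.1 (x⁻¹ * g))
    congr 2
    group

theorem mem_twistedObj_component {x : G} {Φ : 𝔣.twistedSubmodule} :
    Φ ∈ 𝔣.twistedObj.component x ↔ ∀ g, Φ.1 g ∈ A.X.component (g⁻¹ * x * g) := by
  refine (ZG.mem_component (X := 𝔣.twistedObj)).trans ?_
  simp only [ZG.mem_component]
  exact Subtype.ext_iff.trans funext_iff

/-- The right multiplication on `twistedSubmodule`. -/
def twistedMul : 𝔣.twistedSubmodule →ₗ[k] A.X.V →ₗ[k] 𝔣.twistedSubmodule :=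
  LinearMap.mk₂ k (fun Φ a => ⟨fun g => Φ.1 g * A.X.act g⁻¹ a, fun g => by
      rw [← mul_assoc, Φ.2.1], fun g f => by
      rw [ZG.act_mul, Φ.2.2.1, ZG.act_act]
      simp, fun g => by
      have := congrArg ((ZG.mulLin A.X).flip (A.X.act g⁻¹ a)) (Φ.2.2.2 g)
      rw [map_finsum _ (Set.toFinite _), map_zero] at this
      refine Eq.trans (finsum_congr fun h => ?_) this
      rw [ZG.act_mul, ZG.act_act, LinearMap.flip_apply, ZG.mulLin_apply]
      simp⟩)
    (fun Φ Ψ a => Subtype.ext <| funext fun g => add_mul _ _ _)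
    (fun c Φ a => Subtype.ext <| funext fun g => smul_mul_assoc _ _ _)
    (fun Φ a b => Subtype.ext <| funext fun g => by simp [mul_add])
    (fun c Φ a => Subtype.ext <| funext fun g => by simp [mul_smul_comm])

/-- The right module `twistedSubmodule`. -/
@[reducible] def twistedModule : RightModule A :=
  RightModule.mk' 𝔣.twistedObj 𝔣.twistedMul
    (fun x Φ a => Subtype.ext <| funext fun g => by
      change Φ.1 (x⁻¹ * g) * A.X.act g⁻¹ (A.X.act x a) = Φ.1 (x⁻¹ * g) * A.X.act (x⁻¹ * g)⁻¹ a
      rw [ZG.act_act, mul_inv_rev, inv_inv])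
    (fun x y Φ hΦ a ha => by
      rw [mem_twistedObj_component] at hΦ ⊢
      intro g
      have := ZG.mul_mem (hΦ g) (A.X.act_mem_component (f := g⁻¹) ha)
      have h : g⁻¹ * (x * y) * g = g⁻¹ * x * g * (g⁻¹ * y * g⁻¹⁻¹) := by group
      rw [h]
      exact this)
    (fun Φ => Subtype.ext <| funext fun g => by simp [twistedMul])
    (fun Φ a b => Subtype.ext <| funext fun g => by simp [twistedMul, mul_assoc])

/-- The double braiding shifts the argument of Φ by the degree of the translated vector `b`. If this
degree lies in F, the F-equivariance of Φ undoes the shift; otherwise u 1 * b = 0, and both sides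
vanish because Φ takes values in the corner. -/
theorem twistedModule_isLocal (hA : ∀ g, ∀ x ∈ A.X.component g, ∀ y, A.X.act g y * x = x * y) :
    RightModule.isLocal A 𝔣.twistedModule := by
  rw [RightModule.isLocal_iff]
  intro x y Φ hΦ a ha
  rw [mem_twistedObj_component] at hΦ
  refine Subtype.ext <| funext fun g => ?_
  change Φ.1 ((x * y * x⁻¹)⁻¹ * g) * A.X.act g⁻¹ (A.X.act x a) = Φ.1 g * A.X.act g⁻¹ a
  rw [← hA _ _ (hΦ g), ZG.act_act, ZG.act_act, mul_inv_cancel_right]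
  set b := A.X.act (g⁻¹ * x) a with hb
  have hbd : b ∈ A.X.component (g⁻¹ * (x * y * x⁻¹) * g) := by
    have := A.X.act_mem_component (f := g⁻¹ * x) ha
    convert this using 1
    group
  have hu : ∀ z, z * 𝔣.u 1 = 𝔣.u 1 * z := fun z => by
    have := hA 1 _ (by simpa using 𝔣.u_mem 1) z
    rwa [ZG.act_one_apply] at this
  by_cases hf : ∃ f : F, ((f : H) : G) = g⁻¹ * (x * y * x⁻¹) * g
  · obtain ⟨f, hf⟩ := hf
    rw [← hA _ _ hbd, ← hf]
    have h1 := Φ.2.2.1 (g * ((f : H) : G)⁻¹) f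
    rw [inv_mul_cancel_right] at h1
    rw [h1, hf]
    congr 2
    group
  · push Not at hf
    have h0 := 𝔣.u_one_mul_eq_zero hf hbd
    rw [← Φ.2.1 g, ← Φ.2.1, ← mul_assoc b, hu b, h0, zero_mul, ← hu, mul_assoc, h0, mul_zero]

/-- A nonzero element of the twisted module, when `h ∉ F`. -/
theorem exists_twisted_ne_zero (hε : IsCompatible γ ε) (hF : F ≠ ⊤) :
    ∃ Φ : 𝔣.twistedSubmodule, Φ ≠ 0 := by
  classical
  obtain ⟨h₀, hh₀⟩ : ∃ h : H, h ∉ F := by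
    by_contra! h
    exact hF (eq_top_iff.2 fun x _ => h x)
  let F' : Subgroup G := F.map H.subtype
  have hF'H : ∀ x ∈ F', x ∈ H := by
    rintro _ ⟨x, -, rfl⟩
    exact x.2
  have hfF' : ∀ f : F, ((f : H) : G) ∈ F' := fun f => ⟨f, f.2, rfl⟩
  let i : G → k := fun g => if g ∈ F' then 1 else 0
  have hi : ∀ g (f : F), i (g * f) = i g := fun g f => by
    simp only [i, F'.mul_mem_cancel_right (hfF' f)]
  have := Fintype.ofFinite H
  have hsum : ∀ g : G, ∑ h : H, i (g * h) = if g ∈ H then ∑ h : H, i h else 0 := fun g => by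
    split_ifs with hg
    · exact Equiv.sum_comp (Equiv.mulLeft (⟨g, hg⟩ : H)) (fun h : H => i h)
    · refine Finset.sum_eq_zero fun h _ => if_neg fun hgh => hg ?_
      exact (H.mul_mem_cancel_right h.2).1 (hF'H _ hgh)
  -- The indicator of F minus that of the coset h₀F, times `u 1`: since h₀ ∈ H the two H-sums
  -- cancel, and since h₀ ∉ F the value at 1 is `u 1`.
  refine ⟨⟨fun g => (i g - i ((h₀ : G)⁻¹ * g)) • 𝔣.u 1, fun g => ?_, fun g f => ?_, fun g => ?_⟩,
    fun h => ?_⟩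
  · rw [mul_smul_comm, u_one_mul]
  · rw [map_smul, 𝔣.act_u_one hε, hi, ← mul_assoc, hi]
  · rw [finsum_eq_sum_of_fintype]
    simp only [map_smul, 𝔣.act_u_one hε, ← Finset.sum_smul, Finset.sum_sub_distrib, ← mul_assoc,
      hsum, H.mul_mem_cancel_left (H.inv_mem h₀.2), sub_self, zero_smul]
  · have h1 : (i 1 - i ((h₀ : G)⁻¹ * 1)) • 𝔣.u 1 = 0 := congrFun (congrArg Subtype.val h) 1
    have h2 : (h₀ : G)⁻¹ ∉ F' := by
      rw [F'.inv_mem_iff]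
      rintro ⟨x, hx, hxh⟩
      exact hh₀ (by rwa [← Subtype.ext hxh])
    simp [i, F'.one_mem, h2, 𝔣.u_one_ne] at h1

/-- An invariant function is constant. A value of degree 1 in the corner is c • u 1, which H fixes,
so the vanishing of the H-sum reads |H| c = 0. -/
theorem twisted_invariant_eq_zero [CharZero k] (hε : IsCompatible γ ε) {Φ : 𝔣.twistedObj.V}
    (hd : Φ ∈ 𝔣.twistedObj.component 1) (ha : ∀ g, 𝔣.twistedObj.act g Φ = Φ) : Φ = 0 := by
  have h1 : ∀ g, Φ.1 g = Φ.1 1 := fun g => by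
    have := congrFun (congrArg Subtype.val (ha g)) g
    rw [← this]
    change Φ.1 (g⁻¹ * g) = _
    rw [inv_mul_cancel]
  rw [mem_twistedObj_component] at hd
  obtain ⟨c, hc⟩ := 𝔣.exists_u_one_mul 1 (x := Φ.1 1) (by simpa using hd 1)
  rw [Φ.2.1] at hc
  have h2 := Φ.2.2.2 1
  have := Fintype.ofFinite H
  simp only [h1, hc, map_smul, 𝔣.act_u_one hε] at h2
  rw [finsum_eq_sum_of_fintype, Finset.sum_const, Finset.card_univ, ← Nat.cast_smul_eq_nsmul k,
    ← Nat.card_eq_fintype_card, smul_eq_zero_iff_right (card_ne_zero H)] at h2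
  exact Subtype.ext <| funext fun g => by rw [h1, hc, h2]; rfl

/-- A homomorphism out of the regular module is determined by the image of 1, an invariant of degree
1. For F ≠ H the twisted module is nonzero and has no such nonzero invariant, whereas an equivalence
with vector spaces would produce a nonzero map. -/
theorem eq_top_of_isTrivialising [CharZero k] (𝔣 : Frame A γ ε) (hε : IsCompatible γ ε)
    (hA : IsTrivialising k A) : F = ⊤ := by
  by_contra hF
  obtain ⟨E, hadd, hlin⟩ := hA.local_equiv_vect
  obtain ⟨Φ, hΦ⟩ := 𝔣.exists_twisted_ne_zero hε hF
  have hcomm := ZG.isCommMonObj_iff.1 hA.comm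
  let R : LocalModule A := ⟨RightModule.regular A, RightModule.regular_isLocal hcomm⟩
  let M : LocalModule A := ⟨𝔣.twistedModule, 𝔣.twistedModule_isLocal hcomm⟩
  have hne : ∀ X : LocalModule A, (𝟙 X : X ⟶ X) ≠ 0 →
      (𝟙 (E.functor.obj X) : E.functor.obj X ⟶ _) ≠ 0 := fun X hX h => hX <| by
    apply E.functor.map_injective
    rw [E.functor.map_id, h, E.functor.map_zero]
  obtain ⟨f, hf⟩ := FGModuleCat.exists_hom_ne_zero
    (hne R fun h => 𝔣.one_ne_zero
      (LinearMap.congr_fun (congrArg (fun f => f.hom.hom.toLin) h) (1 : A.X.V)))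
    (hne M fun h => hΦ (LinearMap.congr_fun (congrArg (fun f => f.hom.hom.toLin) h) Φ))
  obtain ⟨f, rfl⟩ := E.functor.map_surjective f
  refine hf ?_
  suffices f = 0 by rw [this, E.functor.map_zero]
  have h1 : f.hom.hom.toLin (1 : A.X.V) = 0 :=
    𝔣.twisted_invariant_eq_zero hε (ZG.hom_mem_component f.hom.hom ZG.one_mem) fun g => by
      have := f.hom.hom.map_act g (1 : A.X.V)
      rw [ZG.act_one] at this
      exact this.symm
  refine ObjectProperty.hom_ext _ (RightModule.hom_ext (ZG.hom_ext (LinearMap.ext fun a => ?_)))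
  have h2 := RightModule.hom_rsmul f.hom (1 : A.X.V) a
  rw [h1, map_zero, LinearMap.zero_apply] at h2
  refine Eq.trans (congrArg f.hom.hom.toLin ?_) h2
  exact (one_mul a).symm

end Frame

end

/-! ### Free modules and the functor from vector spaces to local modules -/

noncomputable section

namespace ZG

variable {k G : Type u} [Field k] [Group G] [Fintype G]

section

variable (W : Type u) [AddCommGroup W] [Module k W] [FiniteDimensional k W]

/-- The tensor product of a vector space with an object of `Z(G)`. -/
@[reducible] def copower (X : ZG k G) : ZG k G where
  V := W ⊗[k] X.V
  act :=
    { toFun := fun g => (X.act g).lTensor W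
      map_one' := by rw [map_one]; exact LinearMap.lTensor_id W X.V
      map_mul' := fun g h => by rw [map_mul]; exact LinearMap.lTensor_mul W _ _ }
  proj g := (X.proj g).lTensor W
  proj_self g v := by
    rw [← LinearMap.lTensor_comp_apply]
    congr 2
    exact LinearMap.ext (X.proj_self g)
  proj_ne g h hgh v := by
    rw [← LinearMap.lTensor_comp_apply, show X.proj g ∘ₗ X.proj h = 0 from
      LinearMap.ext (X.proj_ne g h hgh), LinearMap.lTensor_zero, LinearMap.zero_apply]
  sum_proj v := by
    have h : ∑ g, X.proj g = LinearMap.id :=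
      LinearMap.ext fun x => by rw [LinearMap.sum_apply, X.sum_proj, LinearMap.id_apply]
    induction v using TensorProduct.induction_on with
    | zero => simp
    | add v w hv hw => simp only [map_add, Finset.sum_add_distrib, hv, hw]
    | tmul w x =>
      simp only [LinearMap.lTensor_tmul]
      rw [← TensorProduct.tmul_sum, X.sum_proj]
  act_proj f g v := by
    change (X.act f).lTensor W ((X.proj g).lTensor W v) =
      (X.proj (f * g * f⁻¹)).lTensor W ((X.act f).lTensor W v)
    rw [← LinearMap.lTensor_comp_apply, ← LinearMap.lTensor_comp_apply]
    congr 2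
    exact LinearMap.ext (X.act_proj f g)

variable {W}

theorem copower_act_tmul (X : ZG k G) (g : G) (w : W) (x : X.V) :
    (copower W X).act g (w ⊗ₜ[k] x) = w ⊗ₜ[k] X.act g x := rfl

theorem tmul_mem_copower {X : ZG k G} {g : G} (w : W) {x : X.V} (hx : x ∈ X.component g) :
    w ⊗ₜ[k] x ∈ (copower W X).component g := by
  refine (mem_component (X := copower W X)).2 ?_
  change w ⊗ₜ[k] X.proj g x = _
  rw [proj_of_mem hx]

theorem copower_induction {X : ZG k G} {g : G} {P : W ⊗[k] X.V → Prop} {z : W ⊗[k] X.V}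
    (hz : z ∈ (copower W X).component g) (zero : P 0) (hadd : ∀ x y, P x → P y → P (x + y))
    (tmul : ∀ w, ∀ x ∈ X.component g, P (w ⊗ₜ[k] x)) : P z := by
  obtain ⟨y, rfl⟩ := hz
  induction y using TensorProduct.induction_on with
  | zero => rwa [map_zero]
  | add v w hv hw => rw [map_add]; exact hadd _ _ hv hw
  | tmul w x => exact tmul w _ (X.proj_mem g x)

theorem copower_avg (X : ZG k G) (z : W ⊗[k] X.V) :
    (copower W X).avg z = X.avg.lTensor W z := by
  suffices (copower W X).avg = X.avg.lTensor W from LinearMap.congr_fun this z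
  refine TensorProduct.ext' fun w x => ?_
  rw [LinearMap.lTensor_tmul, avg_apply, avg_apply, TensorProduct.tmul_smul,
    TensorProduct.tmul_sum]
  rfl

end

end ZG

namespace RightModule

variable {k G : Type u} [Field k] [Group G] [Fintype G] (A : Mon (ZG k G))

section

variable (W : Type u) [AddCommGroup W] [Module k W]

/-- The right multiplication on `W ⊗ A`. -/
def freeMul : W ⊗[k] A.X.V →ₗ[k] A.X.V →ₗ[k] W ⊗[k] A.X.V :=
  ((LinearMap.lTensorHom W).comp (ZG.mulLin A.X).flip).flip

theorem freeMul_tmul (w : W) (a b : A.X.V) : freeMul A W (w ⊗ₜ[k] a) b = w ⊗ₜ[k] (a * b) := rfl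

variable [FiniteDimensional k W]

/-- The free right module `W ⊗ A` on a vector space `W`. -/
@[reducible] def free : RightModule A :=
  mk' (ZG.copower W A.X) (freeMul A W)
    (fun g x y => by
      induction x using TensorProduct.induction_on with
      | zero => simp
      | add v w hv hw => simp only [map_add, LinearMap.add_apply, hv, hw]
      | tmul w x =>
        rw [ZG.copower_act_tmul, freeMul_tmul, freeMul_tmul, ZG.copower_act_tmul, ZG.act_mul])
    (fun g h x hx y hy => by
      refine ZG.copower_induction
        (P := fun x => freeMul A W x y ∈ (ZG.copower W A.X).component (g * h))
        hx ?_ (fun u v hu hv => ?_) fun w x hx => ?_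
      · simp only [map_zero, LinearMap.zero_apply]
        exact Submodule.zero_mem _
      · simp only [map_add, LinearMap.add_apply]
        exact Submodule.add_mem _ hu hv
      · exact ZG.tmul_mem_copower w (ZG.mul_mem hx hy))
    (fun x => by
      induction x using TensorProduct.induction_on with
      | zero => simp
      | add v w hv hw => simp only [map_add, LinearMap.add_apply, hv, hw]
      | tmul w x => rw [freeMul_tmul, mul_one])
    (fun x y z => by
      induction x using TensorProduct.induction_on with
      | zero => simp
      | add v w hv hw => simp only [map_add, LinearMap.add_apply, hv, hw]
      | tmul w x => rw [freeMul_tmul, freeMul_tmul, freeMul_tmul, mul_assoc])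

variable {A}

theorem free_isLocal (hA : ∀ g, ∀ x ∈ A.X.component g, ∀ y, A.X.act g y * x = x * y) :
    isLocal A (free A W) := by
  rw [isLocal_iff]
  intro x y m hm a ha
  refine ZG.copower_induction (P := fun m => (free A W).rsmul
    ((free A W).X.act (x * y * x⁻¹) m) (A.X.act x a) = (free A W).rsmul m a) hm ?_
    (fun u v hu hv => ?_) fun w m hm => ?_
  · simp
  · rw [map_add, map_add, map_add, LinearMap.add_apply, LinearMap.add_apply, hu, hv]
  · exact congrArg (fun z => w ⊗ₜ[k] z) ((isLocal_iff.1 (regular_isLocal hA)) x y m hm a ha)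

variable {W}

/-- The homomorphism of free modules induced by a linear map. -/
def freeMap {W' : Type u} [AddCommGroup W'] [Module k W'] [FiniteDimensional k W']
    (f : W →ₗ[k] W') : free A W ⟶ free A W' :=
  mkHom (M := free A W) (N := free A W') (f.rTensor A.X.V)
    (fun g x => by
      induction x using TensorProduct.induction_on with
      | zero => simp
      | add v w hv hw => simp only [map_add, hv, hw]
      | tmul w x => rfl)
    (fun g x hx => by
      refine ZG.copower_induction
        (P := fun x => f.rTensor A.X.V x ∈ (ZG.copower W' A.X).component g)
        hx ?_ (fun u v hu hv => ?_) fun w x hx => ?_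
      · simp only [map_zero]
        exact Submodule.zero_mem _
      · simp only [map_add]
        exact Submodule.add_mem _ hu hv
      · exact ZG.tmul_mem_copower (f w) hx)
    (fun x y => by
      induction x using TensorProduct.induction_on with
      | zero => simp
      | add v w hv hw => simp only [map_add, LinearMap.add_apply, hv, hw]
      | tmul w x => rfl)

end

/-- The functor `W ↦ W ⊗ A`. -/
def freeFunctor (hA : ∀ g, ∀ x ∈ A.X.component g, ∀ y, A.X.act g y * x = x * y) :
    FGModuleCat.{u} k ⥤ LocalModule A where
  obj W := ⟨free A W, free_isLocal W hA⟩
  map f := ObjectProperty.homMk (freeMap f.hom.hom)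
  map_id _ := ObjectProperty.hom_ext _ <| hom_ext <| ZG.hom_ext <|
    TensorProduct.ext' fun _ _ => rfl
  map_comp _ _ := ObjectProperty.hom_ext _ <| hom_ext <| ZG.hom_ext <|
    TensorProduct.ext' fun _ _ => rfl

variable {A} (hA : ∀ g, ∀ x ∈ A.X.component g, ∀ y, A.X.act g y * x = x * y)

instance : (freeFunctor A hA).Additive where
  map_add := ObjectProperty.hom_ext _ <| hom_ext <| ZG.hom_ext <|
    TensorProduct.ext' fun _ _ => TensorProduct.add_tmul _ _ _

instance : (freeFunctor A hA).Linear k where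
  map_smul _ _ := ObjectProperty.hom_ext _ <| hom_ext <| ZG.hom_ext <|
    TensorProduct.ext' fun _ _ => rfl

variable {T : A.X.V →ₗ[k] k}

/-- The functional `T` retracts the unit, so id ⊗ T recovers f(v) from f(v) ⊗ 1. -/
theorem freeFunctor_faithful (hT1 : T 1 = 1) : (freeFunctor A hA).Faithful where
  map_injective {V W f g} h := by
    refine FGModuleCat.hom_ext (LinearMap.ext fun v => ?_)
    have h1 : f.hom.hom v ⊗ₜ[k] (1 : A.X.V) = g.hom.hom v ⊗ₜ[k] (1 : A.X.V) :=
      LinearMap.congr_fun (congrArg (fun f => f.hom.hom.toLin) h) (v ⊗ₜ[k] (1 : A.X.V))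
    have h2 := congrArg (fun z => TensorProduct.rid k W (T.lTensor W z)) h1
    simpa [hT1] using h2

/-- A homomorphism of free modules is determined on the vectors v ⊗ 1. These are invariant of degree
1, and the corresponding invariants of the target are W ⊗ 1, because averaging on `A` has values in
the scalars. -/
theorem freeFunctor_full [CharZero k] (hT : ∀ x, A.X.avg x = T x • (1 : A.X.V)) :
    (freeFunctor A hA).Full where
  map_surjective {V W} φ := by
    let θ : V ⊗[k] A.X.V →ₗ[k] W ⊗[k] A.X.V := φ.hom.hom.toLin
    let f : V →ₗ[k] W := (TensorProduct.rid k W).toLinearMap ∘ₗ T.lTensor W ∘ₗ θ ∘ₗ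
      (TensorProduct.mk k V A.X.V).flip 1
    have hinv : ∀ z : W ⊗[k] A.X.V, A.X.avg.lTensor W z =
        TensorProduct.rid k W (T.lTensor W z) ⊗ₜ[k] (1 : A.X.V) := fun z => by
      induction z using TensorProduct.induction_on with
      | zero => simp
      | add v w hv hw => simp only [map_add, TensorProduct.add_tmul, hv, hw]
      | tmul w x =>
        rw [LinearMap.lTensor_tmul, LinearMap.lTensor_tmul, hT, TensorProduct.rid_tmul,
          TensorProduct.smul_tmul]
    have h1 : ∀ v, θ (v ⊗ₜ[k] 1) = f v ⊗ₜ[k] 1 := fun v => by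
      have hd : (v ⊗ₜ[k] (1 : A.X.V)) ∈ (ZG.copower V A.X).component 1 :=
        ZG.tmul_mem_copower v ZG.one_mem
      have ha : ∀ g, (ZG.copower V A.X).act g (v ⊗ₜ[k] (1 : A.X.V)) = v ⊗ₜ[k] 1 := fun g => by
        rw [ZG.copower_act_tmul, ZG.act_one]
      have h2 := ZG.avg_natural φ.hom.hom (v ⊗ₜ[k] (1 : A.X.V))
      erw [ZG.avg_of_invariant hd ha] at h2
      refine h2.trans ((ZG.copower_avg A.X _).trans (hinv _))
    refine ⟨FGModuleCat.ofHom f, ?_⟩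
    refine ObjectProperty.hom_ext _ <| hom_ext <| ZG.hom_ext <| TensorProduct.ext' fun v a => ?_
    have h3 := hom_rsmul φ.hom (v ⊗ₜ[k] (1 : A.X.V)) a
    have h4 : θ (v ⊗ₜ[k] (1 * a)) = (free A W).rsmul (θ (v ⊗ₜ[k] 1)) a := h3
    rw [h1, one_mul] at h4
    refine Eq.trans ?_ h4.symm
    change f v ⊗ₜ[k] a = f v ⊗ₜ[k] (1 * a)
    rw [one_mul]

/-- The invariants of degree `1` of a module. -/
def invariants (M : RightModule A) : Submodule k M.X.V where
  carrier := {m | m ∈ M.X.component 1 ∧ ∀ g, M.X.act g m = m}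
  add_mem' hx hy := ⟨Submodule.add_mem _ hx.1 hy.1, fun g => by rw [map_add, hx.2, hy.2]⟩
  zero_mem' := ⟨Submodule.zero_mem _, fun g => map_zero _⟩
  smul_mem' c x hx := ⟨Submodule.smul_mem _ _ hx.1, fun g => by rw [map_smul, hx.2]⟩

/-- The canonical homomorphism from the free module on the invariants. -/
def freeInvariants (M : RightModule A) : free A M.invariants ⟶ M :=
  mkHom (M := free A M.invariants) (TensorProduct.lift (M.rsmul ∘ₗ M.invariants.subtype))
    (fun g x => by
      induction x using TensorProduct.induction_on with
      | zero => simp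
      | add v w hv hw => simp only [map_add, hv, hw]
      | tmul w x =>
        rw [ZG.copower_act_tmul, TensorProduct.lift.tmul, TensorProduct.lift.tmul]
        simp only [LinearMap.comp_apply, Submodule.subtype_apply]
        rw [act_rsmul, w.2.2])
    (fun g x hx => by
      refine ZG.copower_induction
        (P := fun x => TensorProduct.lift (M.rsmul ∘ₗ M.invariants.subtype) x ∈ M.X.component g)
        hx ?_ (fun u v hu hv => ?_) fun w x hx => ?_
      · simp only [map_zero]
        exact Submodule.zero_mem _
      · simp only [map_add]
        exact Submodule.add_mem _ hu hv
      · have := M.rsmul_mem w.2.1 hx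
        rwa [one_mul] at this)
    (fun x y => by
      induction x using TensorProduct.induction_on with
      | zero => simp
      | add v w hv hw => simp only [map_add, LinearMap.add_apply, hv, hw]
      | tmul w x => exact (M.rsmul_rsmul _ _ _).symm)

theorem freeInvariants_tmul (M : RightModule A) (n : M.invariants) (a : A.X.V) :
    M.freeInvariants.hom.toLin (n ⊗ₜ[k] a) = M.rsmul n a := rfl

end RightModule

end

/-! ### Sufficiency of F = H: local modules are free on their invariants -/

noncomputable section

namespace Frame

variable {k G : Type u} [Field k] [Group G] [Fintype G]
variable {H : Subgroup G} {F : Subgroup H} [F.Normal] {γ : TwoCocycle k F} {ε : H → F → kˣ}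
variable {A : Mon (ZG k G)}

/-- For `m` of degree 1, locality against `u h` says (h m) u_h = m u_h, and `u h` is invertible in
the corner. -/
theorem rsmul_u_one_of_isLocal (𝔣 : Frame A γ ε) (hε : IsCompatible γ ε) {M : RightModule A}
    (hM : RightModule.isLocal A M) {h : H} (hh : h ∈ F) {m : M.X.V}
    (hm : m ∈ M.X.component 1) (hu : M.rsmul m (𝔣.u 1) = m) : M.X.act (h : G) m = m := by
  have h1 := RightModule.isLocal_iff.1 hM 1 h m hm _ (𝔣.u_mem ⟨h, hh⟩)
  rw [one_mul, inv_one, mul_one, ZG.act_one_apply] at h1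
  have h2 := congrArg (fun z => M.rsmul z (𝔣.u (⟨h, hh⟩ : F)⁻¹)) h1
  simp only [M.rsmul_rsmul, 𝔣.u_mul, mul_inv_cancel, map_smul] at h2
  have h3 := smul_right_injective _ (Units.ne_zero _) h2
  rw [hu] at h3
  have h4 := congrArg (M.X.act (h : G)) hu
  rw [M.act_rsmul, 𝔣.act_u_one hε] at h4
  exact h4.symm.trans h3

variable [CharZero k]

/-- Holds without locality. With copairing ∑ p ⊗ q, the map m ↦ ∑ avg(m p) ⊗ q is a left inverse up
to the scalar d: on n a it gives d ∑ n ⊗ t(a p) q, and the zigzag identity turns this into d (n ⊗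
a). -/
theorem freeInvariants_injective (𝔣 : Frame A γ ε) (hε : IsCompatible γ ε) (M : RightModule A) :
    Function.Injective M.freeInvariants.hom.toLin := by
  have := Fintype.ofFinite F
  obtain ⟨t, d, hd, ht, hl, -⟩ := 𝔣.exists_counit hε
  let avgN : M.X.V →ₗ[k] M.invariants :=
    M.X.avg.codRestrict M.invariants fun m => ⟨M.X.avg_mem m, fun g => M.X.act_avg g m⟩
  let R : M.X.V →ₗ[k] M.invariants ⊗[k] A.X.V := LinearMap.applyₗ 𝔣.casimir ∘ₗ
    LinearMap.rTensorHom A.X.V ∘ₗ M.rsmul.compr₂ avgN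
  let φ : M.invariants ⊗[k] A.X.V →ₗ[k] M.X.V := M.freeInvariants.hom.toLin
  have havg : ∀ (n : M.invariants) (a : A.X.V),
      avgN (M.rsmul n a) = (d * t a) • n := fun n a => Subtype.ext <| by
    have h := ZG.avg_natural M.freeInvariants.hom (n ⊗ₜ[k] a)
    have h1 : (ZG.copower M.invariants A.X).avg (n ⊗ₜ[k] a) = n ⊗ₜ[k] A.X.avg a :=
      ZG.copower_avg A.X _
    refine (h.symm.trans (congrArg φ h1)).trans ?_
    refine (M.freeInvariants_tmul n _).trans ?_
    rw [ht, map_smul, M.rsmul_one]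
    rfl
  have hR : R ∘ₗ φ = d • LinearMap.id := TensorProduct.ext' fun n a => by
    have h2 : R (M.rsmul n a) = (avgN ∘ₗ M.rsmul (M.rsmul n a)).rTensor A.X.V 𝔣.casimir := rfl
    have h3 : (avgN ∘ₗ M.rsmul (M.rsmul n a)).rTensor A.X.V =
        d • ((TensorProduct.mk k M.invariants A.X.V n) ∘ₗ A.X.contractLeft t a) :=
      TensorProduct.ext' fun p q => by
        rw [LinearMap.rTensor_tmul, LinearMap.comp_apply, M.rsmul_rsmul, havg,
          LinearMap.smul_apply, LinearMap.comp_apply, ZG.contractLeft_tmul, map_smul, smul_smul,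
          TensorProduct.mk_apply, TensorProduct.smul_tmul']
    refine h2.trans ?_
    rw [h3, LinearMap.smul_apply, LinearMap.comp_apply, hl]
    rfl
  intro x y hxy
  have h4 : ∀ z, R (φ z) = d • z := fun z => LinearMap.congr_fun hR z
  have h5 : d • (x : M.invariants ⊗[k] A.X.V) = d • y := by
    rw [← h4, ← h4]
    exact congrArg R hxy
  exact smul_right_injective _ hd h5

theorem freeInvariants_surjective (𝔣 : Frame A γ ε) (hε : IsCompatible γ ε) (hF : F = ⊤)
    {M : RightModule A} (hM : RightModule.isLocal A M) :
    Function.Surjective M.freeInvariants.hom.toLin := by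
  classical
  rw [← LinearMap.range_eq_top, eq_top_iff]
  set I : Submodule k M.X.V := LinearMap.range M.freeInvariants.hom.toLin with hI
  have hIr : ∀ m ∈ I, ∀ a, M.rsmul m a ∈ I := by
    rintro _ ⟨z, rfl⟩ a
    exact ⟨_, RightModule.hom_rsmul M.freeInvariants z a⟩
  have hIa : ∀ m ∈ I, ∀ g, M.X.act g m ∈ I := by
    rintro _ ⟨z, rfl⟩ g
    exact ⟨_, M.freeInvariants.hom.map_act g z⟩
  have hFH : ∀ h : H, h ∈ F := fun h => hF ▸ Subgroup.mem_top h
  have hH : (Nat.card H : k) ≠ 0 := card_ne_zero H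
  -- Such an `m` is fixed by F = H. Its orbit sum `n` over G is invariant, and multiplication by `u
  -- 1` kills the terms outside H and leaves |H| copies of `m`.
  have stepA : ∀ m ∈ M.X.component 1, M.rsmul m (𝔣.u 1) = m → m ∈ I := fun m hm hu => by
    have hinv : ∀ h : H, M.X.act (h : G) m = m := fun h =>
      𝔣.rsmul_u_one_of_isLocal hε hM (hFH h) hm hu
    let n : M.X.V := ∑ g, M.X.act g m
    have hn : n ∈ M.invariants := by
      refine ⟨Submodule.sum_mem _ fun g _ => ?_, fun g => ?_⟩
      · have := M.X.act_mem_component (f := g) hm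
        simpa using this
      · simp only [n, map_sum, ZG.act_act]
        exact Equiv.sum_comp (Equiv.mulLeft g) (fun g => M.X.act g m)
    have hnu : M.rsmul n (𝔣.u 1) = Nat.card H • m := by
      rw [← H.sum_ite_mem 1]
      simp only [n, map_sum, LinearMap.sum_apply, inv_one, one_mul]
      refine Finset.sum_congr rfl fun g _ => ?_
      split_ifs with hg
      · rw [hinv ⟨g, hg⟩, hu]
      · have h1 := congrArg (M.X.act g) hu
        rw [M.act_rsmul] at h1
        have h2 := 𝔣.gen_one_orth (g := g) (g' := 1) (by simpa using hg)
        rw [gen_one] at h2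
        rw [← h1, M.rsmul_rsmul]
        exact (congrArg _ h2).trans (map_zero _)
    have : m = (Nat.card H : k)⁻¹ • M.rsmul n (𝔣.u 1) := by
      rw [hnu, ← Nat.cast_smul_eq_nsmul k, smul_smul, inv_mul_cancel₀ hH, one_smul]
    rw [this]
    exact Submodule.smul_mem _ _ ⟨(⟨n, hn⟩ : M.invariants) ⊗ₜ[k] 𝔣.u 1, rfl⟩
  -- For x ∈ H = F, multiplication by u_x⁻¹ reduces to degree 1. For x ∉ H, locality against `u 1`
  -- gives m u_1 = m x(u_1) u_1, which is 0 by orthogonality.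
  have stepB : ∀ x, ∀ m ∈ M.X.component x, M.rsmul m (𝔣.u 1) ∈ I := fun x m hm => by
    by_cases hx : x ∈ H
    · let f : F := ⟨⟨x, hx⟩, hFH _⟩
      have h1 : M.rsmul m (𝔣.u f⁻¹) ∈ I := by
        refine stepA _ ?_ ?_
        · have := M.rsmul_mem hm (𝔣.u_mem f⁻¹)
          simpa [f] using this
        · rw [M.rsmul_rsmul, u_mul_one]
      have h2 := hIr _ h1 (𝔣.u f)
      rw [M.rsmul_rsmul, 𝔣.u_mul, inv_mul_cancel, map_smul] at h2
      exact (Submodule.smul_mem_iff _ (Units.ne_zero _)).1 h2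
    · have h1 := RightModule.isLocal_iff.1 hM x 1 m hm _ (by simpa using 𝔣.u_mem 1)
      rw [mul_one, mul_inv_cancel, ZG.act_one_apply] at h1
      have h2 := congrArg (fun z => M.rsmul z (𝔣.u 1)) h1
      simp only [M.rsmul_rsmul, u_one_mul] at h2
      have h3 := 𝔣.gen_one_orth (g := x) (g' := 1) (by simpa using hx)
      rw [gen_one] at h3
      rw [← h2]
      have h4 : M.rsmul m (A.X.act x (𝔣.u 1) * 𝔣.u 1) = 0 := (congrArg _ h3).trans (map_zero _)
      rw [h4]
      exact I.zero_mem
  have stepB' : ∀ m, M.rsmul m (𝔣.u 1) ∈ I := fun m => by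
    rw [← M.X.sum_proj m, map_sum, LinearMap.sum_apply]
    exact Submodule.sum_mem _ fun x _ => stepB x _ (M.X.proj_mem x m)
  intro m _
  rw [← M.rsmul_one m, 𝔣.one_eq_sum, map_smul, map_sum]
  refine Submodule.smul_mem _ _ (Submodule.sum_mem _ fun g _ => ?_)
  have := hIa _ (stepB' (M.X.act g⁻¹ m)) g
  rwa [M.act_rsmul, ZG.act_act, mul_inv_cancel, ZG.act_one_apply] at this

/-- The algebras with a frame are trivialising when `F = H`. -/
theorem isTrivialising (𝔣 : Frame A γ ε) (hε : IsCompatible γ ε) (hF : F = ⊤) :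
    IsTrivialising k A where
  toIsCommSepIndec := 𝔣.isCommSepIndec hε
  local_equiv_vect := by
    have hA := ZG.isCommMonObj_iff.1 (𝔣.isCommMonObj hε)
    obtain ⟨T, hT⟩ := 𝔣.exists_trace
    have hT1 : T 1 = 1 := by
      have := hT 1
      rw [ZG.avg_of_invariant ZG.one_mem ZG.act_one] at this
      refine smul_left_injective k 𝔣.one_ne_zero ?_
      simpa using this.symm
    have := RightModule.freeFunctor_faithful hA hT1
    have := RightModule.freeFunctor_full hA hT
    have : (RightModule.freeFunctor A hA).EssSurj := ⟨fun M => by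
      obtain ⟨i⟩ := RightModule.iso_of_bijective M.obj.freeInvariants
        ⟨𝔣.freeInvariants_injective hε M.obj, 𝔣.freeInvariants_surjective hε hF M.property⟩
      exact ⟨FGModuleCat.of k M.obj.invariants, ⟨ObjectProperty.isoMk _ i⟩⟩⟩
    have : (RightModule.freeFunctor A hA).IsEquivalence := {}
    let E := (RightModule.freeFunctor A hA).asEquivalence
    have : E.functor.Additive := inferInstanceAs (RightModule.freeFunctor A hA).Additive
    have : E.functor.Linear k := inferInstanceAs ((RightModule.freeFunctor A hA).Linear k)
    exact ⟨E.symm, E.inverse_additive, inferInstanceAs (E.inverse.Linear k)⟩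

end Frame

end

noncomputable section

namespace ZG

open scoped MonObj

variable {k G : Type u} [Field k] [Group G] [Fintype G]

/-! ## The structure of commutative separable indecomposable algebras -/

/-- The translation of separability back to elements. Only the zigzags, the product of the copairing
and the degree of `t` are recorded; invariance is not needed below. -/
theorem exists_of_isSeparableAlgebra {X : ZG k G} [MonObj X] (h : IsSeparableAlgebra X) :
    ∃ (t : X.V →ₗ[k] k) (κ : X.V ⊗[k] X.V), (∀ g ≠ 1, ∀ x ∈ X.component g, t x = 0) ∧
      (∀ x, X.contractLeft t x κ = x) ∧ (∀ x, X.contractRight t x κ = x) ∧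
      TensorProduct.lift (mulLin X) κ = 1 := by
  obtain ⟨e, c, h1, h2, h3⟩ := h
  let m : X.V ⊗[k] X.V →ₗ[k] X.V := (μ[X] : X ⊗ X ⟶ X).toLin
  have hm : TensorProduct.lift (mulLin X) = m := TensorProduct.ext' fun p q => rfl
  let t : X.V →ₗ[k] k := e.toLin
  let κ : X.V ⊗[k] X.V := c.toLin (1 : k)
  refine ⟨t, κ, fun g hg x hx => ?_, fun x => ?_, fun x => ?_, ?_⟩
  · have := e.map_proj g x
    rw [proj_of_mem hx] at this
    exact this.trans (unit_proj_ne hg _)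
  · have h4 : TensorProduct.lid k X.V (TensorProduct.map (t ∘ₗ m) LinearMap.id
        ((TensorProduct.assoc k X.V X.V X.V).symm (x ⊗ₜ[k] κ))) = x :=
      LinearMap.congr_fun (congrArg Hom.toLin h1) x
    refine Eq.trans ?_ h4
    suffices (TensorProduct.lid k X.V).toLinearMap ∘ₗ TensorProduct.map
        (t ∘ₗ m) LinearMap.id ∘ₗ (TensorProduct.assoc k X.V X.V X.V).symm.toLinearMap ∘ₗ
        TensorProduct.mk k X.V (X.V ⊗[k] X.V) x = X.contractLeft t x from
      (LinearMap.congr_fun this κ).symm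
    exact TensorProduct.ext' fun p q => rfl
  · have h4 : TensorProduct.rid k X.V (TensorProduct.map LinearMap.id (t ∘ₗ m)
        ((TensorProduct.assoc k X.V X.V X.V) (κ ⊗ₜ[k] x))) = x :=
      LinearMap.congr_fun (congrArg Hom.toLin h2) x
    refine Eq.trans ?_ h4
    suffices (TensorProduct.rid k X.V).toLinearMap ∘ₗ TensorProduct.map LinearMap.id
        (t ∘ₗ m) ∘ₗ (TensorProduct.assoc k X.V X.V X.V).toLinearMap ∘ₗ
        (TensorProduct.mk k (X.V ⊗[k] X.V) X.V).flip x = X.contractRight t x from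
      (LinearMap.congr_fun this κ).symm
    exact TensorProduct.ext' fun p q => rfl
  · rw [hm]
    exact LinearMap.congr_fun (congrArg Hom.toLin h3) (1 : k)

/-! ### The Casimir element, von Neumann regularity and primitive idempotents -/

section Regular

variable {X : ZG k G} [MonObj X]

/-- For κ = ∑ p ⊗ q this is ∑ a p ⊗ q = ∑ p ⊗ q a: expand a p by one zigzag, exchange the sums, and
contract by the other. -/
theorem casimir_comm {t : X.V →ₗ[k] k} {κ : X.V ⊗[k] X.V} (hl : ∀ x, X.contractLeft t x κ = x)
    (hr : ∀ x, X.contractRight t x κ = x) (a : X.V) :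
    (mulLin X a).rTensor X.V κ = ((mulLin X).flip a).lTensor X.V κ := by
  obtain ⟨S, hS⟩ := TensorProduct.exists_finset κ
  have hl' : ∀ x, ∑ i ∈ S, t (x * i.1) • i.2 = x := fun x => by
    conv_rhs => rw [← hl x, hS, map_sum]
    rfl
  have hr' : ∀ x, ∑ i ∈ S, t (i.2 * x) • i.1 = x := fun x => by
    conv_rhs => rw [← hr x, hS, map_sum]
    rfl
  rw [hS, map_sum, map_sum]
  simp only [LinearMap.rTensor_tmul, LinearMap.lTensor_tmul, LinearMap.flip_apply, mulLin_apply]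
  calc ∑ i ∈ S, (a * i.1) ⊗ₜ[k] i.2
      = ∑ i ∈ S, ∑ j ∈ S, j.1 ⊗ₜ[k] (t (j.2 * a * i.1) • i.2) := by
        refine Finset.sum_congr rfl fun i _ => ?_
        conv_lhs => rw [← hr' (a * i.1)]
        rw [TensorProduct.sum_tmul]
        refine Finset.sum_congr rfl fun j _ => ?_
        rw [TensorProduct.smul_tmul, mul_assoc]
    _ = _ := by
        rw [Finset.sum_comm]
        refine Finset.sum_congr rfl fun j _ => ?_
        rw [← TensorProduct.tmul_sum, hl']

/-- The central elements of degree `1` of a separable algebra are von Neumann regular. -/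
theorem exists_eq_mul_mul (hX : IsSeparableAlgebra X) {n : X.V} (hn : n ∈ X.component 1)
    (hc : ∀ x, n * x = x * n) : ∃ b ∈ X.component 1, n = n * n * b := by
  obtain ⟨t, κ, -, hl, hr, hκ⟩ := exists_of_isSeparableAlgebra hX
  -- A linear section of multiplication by `n` on its range, extended to all of `X`; it satisfies n
  -- s(n x) = n x and need not respect the grading.
  obtain ⟨r, hr'⟩ := LinearMap.exists_rightInverse_of_surjective (mulLin X n).rangeRestrict
    (LinearMap.range_rangeRestrict _)
  obtain ⟨s, hs⟩ := LinearMap.exists_extend r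
  have hns : ∀ x, n * s (n * x) = n * x := fun x => by
    have h1 : s (n * x) = r ⟨n * x, ⟨x, rfl⟩⟩ :=
      LinearMap.congr_fun hs (⟨n * x, ⟨x, rfl⟩⟩ : LinearMap.range (mulLin X n))
    have h2 := congrArg Subtype.val (LinearMap.congr_fun hr' ⟨n * x, ⟨x, rfl⟩⟩)
    rw [h1]
    exact h2
  -- Applying p ⊗ q ↦ p n s(q) to the two sides of the Casimir identity for `n` gives n² b₀ on one
  -- side and n on the other.
  let L : X.V ⊗[k] X.V →ₗ[k] X.V := TensorProduct.lift ((mulLin X).compl₂ (mulLin X n ∘ₗ s))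
  let b₀ : X.V := TensorProduct.lift ((mulLin X).compl₂ s) κ
  have h1 : L ((mulLin X n).rTensor X.V κ) = n * n * b₀ := by
    suffices L ∘ₗ (mulLin X n).rTensor X.V =
        mulLin X (n * n) ∘ₗ TensorProduct.lift ((mulLin X).compl₂ s) from
      LinearMap.congr_fun this κ
    refine TensorProduct.ext' fun p q => ?_
    change n * p * (n * s q) = n * n * (p * s q)
    rw [mul_assoc, ← mul_assoc p, ← hc p]
    simp only [mul_assoc]
  have h2 : L (((mulLin X).flip n).lTensor X.V κ) = n := by
    have : L ∘ₗ ((mulLin X).flip n).lTensor X.V = mulLin X n ∘ₗ TensorProduct.lift (mulLin X) := by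
      refine TensorProduct.ext' fun p q => ?_
      change p * (n * s (q * n)) = n * (p * q)
      rw [← hc q, hns, ← mul_assoc, ← hc p, mul_assoc]
    refine (LinearMap.congr_fun this κ).trans ?_
    rw [LinearMap.comp_apply, hκ, mulLin_apply, mul_one]
  rw [casimir_comm hl hr, h2] at h1
  -- As n and n² have degree 1, the degree 1 part of `b₀` serves equally well.
  refine ⟨X.proj 1 b₀, X.proj_mem _ _, ?_⟩
  have hnn : n * n ∈ X.component 1 := by simpa using mul_mem hn hn
  rw [mul_proj_of_mem_one hnn, ← h1, proj_of_mem hn]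

/-- A commutative separable algebra has a primitive idempotent in degree `1`. -/
theorem exists_primitive_idempotent [IsAlgClosed k] (hX : IsSeparableAlgebra X)
    (hc : ∀ e ∈ X.component 1, ∀ x, e * x = x * e) (h1 : (1 : X.V) ≠ 0) :
    ∃ p ∈ X.component 1, p ≠ 0 ∧ p * p = p ∧ ∀ a ∈ X.component 1, ∃ c : k, p * a = c • p := by
  -- Among nonzero idempotents of degree 1, `p` is taken with p A_1 of minimal dimension.
  let D : X.V → Submodule k X.V := fun p => (X.component 1).map (mulLin X p)
  obtain ⟨p, ⟨hp, hp0, hpp⟩, hmin⟩ := (measure fun p => Module.finrank k (D p)).wf.has_min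
    {p | p ∈ X.component 1 ∧ p ≠ 0 ∧ p * p = p} ⟨1, one_mem, h1, mul_one 1⟩
  refine ⟨p, hp, hp0, hpp, fun a ha => ?_⟩
  have hmem : ∀ {x y : X.V}, x ∈ X.component 1 → y ∈ X.component 1 → x * y ∈ X.component 1 :=
    fun hx hy => by simpa using mul_mem hx hy
  have hpD : p ∈ D p := ⟨p, hp, hpp⟩
  have : Nontrivial (D p) := ⟨⟨p, hpD⟩, 0, fun h => hp0 (congrArg Subtype.val h)⟩
  let φ : Module.End k (D p) := (mulLin X a).restrict (p := D p) (q := D p) (by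
    rintro _ ⟨x, hx, rfl⟩
    refine ⟨a * x, hmem ha hx, ?_⟩
    simp only [mulLin_apply]
    rw [← mul_assoc, ← mul_assoc, hc p hp])
  obtain ⟨c, hcφ⟩ := Module.End.exists_eigenvalue φ
  obtain ⟨⟨v, hv⟩, hvφ⟩ := hcφ.exists_hasEigenvector
  have hv0 : v ≠ 0 := fun h => hvφ.2 (Subtype.ext h)
  have hav : a * v = c • v := congrArg Subtype.val hvφ.apply_eq_smul
  have hpv : p * v = v := by
    obtain ⟨x, -, rfl⟩ := hv
    rw [mulLin_apply, ← mul_assoc, hpp]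
  refine ⟨c, ?_⟩
  -- As c is an eigenvalue of `a` on p A_1, `n` kills the nonzero eigenvector `v`. Regularity makes
  -- q = n b an idempotent below `p` with q n = n. If q = 0 then n = 0 and p a = c p; otherwise
  -- minimality gives q = p, although q kills v = p v.
  let n := p * (a - c • 1)
  have hn : n ∈ X.component 1 := hmem hp (Submodule.sub_mem _ ha (Submodule.smul_mem _ _ one_mem))
  obtain ⟨b, hb, hnb⟩ := exists_eq_mul_mul hX hn (hc n hn)
  have hpn : p * n = n := by rw [← mul_assoc, hpp]
  let q := n * b
  have hq : q ∈ X.component 1 := hmem hn hb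
  have hqn : q * n = n := by
    change n * b * n = n
    rw [mul_assoc, ← hc n hn b, ← mul_assoc, ← hnb]
  have hqq : q * q = q := by
    change q * (n * b) = n * b
    rw [← mul_assoc, hqn]
  have hpq : p * q = q := by rw [← mul_assoc, hpn]
  by_cases hq0 : q = 0
  · have hn0 : n = 0 := by rw [← hqn, hq0, zero_mul]
    have : p * a - c • p = 0 := by
      rw [← hn0]
      change _ = p * (a - c • 1)
      rw [mul_sub, mul_smul_comm, mul_one]
    exact sub_eq_zero.1 this
  · exfalso
    have hle : D q ≤ D p := by
      rintro _ ⟨x, hx, rfl⟩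
      exact ⟨q * x, hmem hq hx, by rw [mulLin_apply, mulLin_apply, ← mul_assoc, hpq]⟩
    have hDD : D q = D p := Submodule.eq_of_le_of_finrank_le hle
      (not_lt.1 (hmin q ⟨hq, hq0, hqq⟩))
    obtain ⟨x, -, hx⟩ : p ∈ D q := hDD ▸ hpD
    have hqp : q = p := by
      rw [← hpq, hc p hp, ← hx, mulLin_apply, ← mul_assoc, hqq]
    refine hv0 ?_
    rw [← hpv, ← hqp]
    change n * b * v = 0
    rw [hc n hn b, mul_assoc]
    have : n * v = 0 := by
      change p * (a - c • 1) * v = 0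
      rw [mul_assoc, sub_mul, hav, smul_mul_assoc, one_mul, sub_self, mul_zero]
    rw [this, mul_zero]

end Regular

/-! ### Splitting an algebra along an invariant central idempotent -/

section Corner

variable {X : ZG k G} [MonObj X] {e : X.V}

/-- The subspace `e A` cut out by an idempotent `e`. -/
def cornerSubmodule (e : X.V) : Submodule k X.V where
  carrier := {x | e * x = x}
  add_mem' hx hy := (mul_add _ _ _).trans (congrArg₂ _ hx hy)
  zero_mem' := mul_zero e
  smul_mem' _ _ hx := (mul_smul_comm _ _ _).trans (congrArg _ hx)

/-- The object `e A` of `Z(G)`. -/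
@[reducible] def cornerObj (he : e ∈ X.component 1) (ha : ∀ g, X.act g e = e) : ZG k G where
  V := cornerSubmodule e
  act :=
    { toFun := fun g => (X.act g).restrict fun x (hx : e * x = x) => by
        change e * X.act g x = X.act g x
        conv_lhs => rw [← ha g, ← act_mul, hx]
      map_one' := LinearMap.ext fun x => Subtype.ext (act_one_apply _ _)
      map_mul' := fun g h => LinearMap.ext fun x => Subtype.ext (act_act _ _ _ _).symm }
  proj g := (X.proj g).restrict fun x (hx : e * x = x) => by
    change e * X.proj g x = X.proj g x
    rw [mul_proj_of_mem_one he, hx]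
  proj_self g v := Subtype.ext (X.proj_self _ _)
  proj_ne g h hgh v := Subtype.ext (X.proj_ne _ _ hgh _)
  sum_proj v := Subtype.ext <| by
    rw [AddSubmonoidClass.coe_finsetSum]
    exact X.sum_proj _
  act_proj f g v := Subtype.ext (X.act_proj _ _ _)

theorem mem_cornerObj (he : e ∈ X.component 1) (ha : ∀ g, X.act g e = e) {g : G}
    {x : cornerSubmodule e} :
    x ∈ (cornerObj he ha).component g ↔ (x : X.V) ∈ X.component g :=
  (mem_component (X := cornerObj he ha)).trans (Subtype.ext_iff.trans mem_component.symm)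

variable {A : Mon (ZG k G)} {e : A.X.V}

/-- The algebra `e A`. -/
def corner (he : e ∈ A.X.component 1) (ha : ∀ g, A.X.act g e = e)
    (hee : e * e = e) (hc : ∀ x, e * x = x * e) : Mon (ZG k G) where
  X := cornerObj he ha
  mon := mkMonObj (cornerObj he ha)
    (LinearMap.mk₂ k (fun x y => ⟨x.1 * y.1, by
        change e * (x.1 * y.1) = _
        rw [← mul_assoc, x.2]⟩)
      (fun x y z => Subtype.ext (add_mul _ _ _)) (fun c x y => Subtype.ext (smul_mul_assoc _ _ _))
      (fun x y z => Subtype.ext (mul_add _ _ _)) (fun c x y => Subtype.ext (mul_smul_comm _ _ _)))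
    ⟨e, hee⟩ (fun g x y => Subtype.ext (act_mul g x.1 y.1).symm)
    (fun g h x hx y hy => by
      rw [mem_cornerObj] at hx hy ⊢
      exact mul_mem hx hy)
    (fun g => Subtype.ext (ha g)) ((mem_cornerObj he ha).2 he)
    (fun x => Subtype.ext x.2) (fun x => Subtype.ext ((hc _).symm.trans x.2))
    (fun x y z => Subtype.ext (mul_assoc _ _ _))

theorem corner_one (he : e ∈ A.X.component 1) (ha : ∀ g, A.X.act g e = e)
    (hee : e * e = e) (hc : ∀ x, e * x = x * e) :
    (1 : (corner he ha hee hc).X.V) = (⟨e, hee⟩ : cornerSubmodule e) :=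
  one_smul k (⟨e, hee⟩ : cornerSubmodule e)

/-- The projection `A ⟶ e A`. -/
def toCorner (he : e ∈ A.X.component 1) (ha : ∀ g, A.X.act g e = e)
    (hee : e * e = e) (hc : ∀ x, e * x = x * e) : A ⟶ corner he ha hee hc :=
  mkMonHom (B := corner he ha hee hc)
    ((mulLin A.X e).codRestrict (cornerSubmodule e) fun x => by
      change e * (e * x) = e * x
      rw [← mul_assoc, hee])
    (fun g x => Subtype.ext <| by
      change e * A.X.act g x = A.X.act g (e * x)
      rw [act_mul, ha])
    (fun g x hx => (mem_cornerObj he ha).2 <| by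
      have := mul_mem he hx
      rwa [one_mul] at this)
    ((Subtype.ext (mul_one e)).trans (corner_one he ha hee hc).symm)
    (fun x y => Subtype.ext <| by
      change e * (x * y) = (e * x) * (e * y)
      rw [mul_assoc e x, ← mul_assoc x, ← hc x, ← mul_assoc, ← mul_assoc, ← mul_assoc, hee])

/-- The projections to e A and (1 - e) A exhibit `A` as their product, so one of the two corners is
zero. -/
theorem eq_zero_or_eq_one_of_isIndecomposable (hA : IsIndecomposableAlgebra A)
    (he : e ∈ A.X.component 1) (ha : ∀ g, A.X.act g e = e) (hee : e * e = e)
    (hc : ∀ x, e * x = x * e) : e = 0 ∨ e = 1 := by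
  have he' : 1 - e ∈ A.X.component 1 := Submodule.sub_mem _ one_mem he
  have ha' : ∀ g, A.X.act g (1 - e) = 1 - e := fun g => by rw [map_sub, act_one, ha]
  have hee' : (1 - e) * (1 - e) = 1 - e := by
    rw [mul_sub, mul_one, sub_mul, hee, one_mul, sub_self, sub_zero]
  have hc' : ∀ x, (1 - e) * x = x * (1 - e) := fun x => by
    rw [mul_sub, sub_mul, hc, one_mul, mul_one]
  have hz : e * (1 - e) = 0 := by rw [mul_sub, mul_one, hee, sub_self]
  have hz' : (1 - e) * e = 0 := by rw [sub_mul, one_mul, hee, sub_self]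
  have hx : ∀ x : cornerSubmodule e, (1 - e) * x.1 = 0 := fun x => by
    rw [← x.2, ← mul_assoc, hz', zero_mul]
  have hx' : ∀ x : cornerSubmodule (1 - e), e * x.1 = 0 := fun x => by
    rw [← x.2, ← mul_assoc, hz, zero_mul]
  let B₁ := corner he ha hee hc
  let B₂ := corner he' ha' hee' hc'
  have lim : IsLimit (BinaryFan.mk (toCorner he ha hee hc) (toCorner he' ha' hee' hc')) := by
    refine BinaryFan.IsLimit.mk _ (fun {T} f g => ?_) (fun {T} f g => ?_) (fun {T} f g => ?_)
      (fun {T} f g m hf hg => ?_)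
    · let f' : T.X.V →ₗ[k] cornerSubmodule e := f.hom.toLin
      let g' : T.X.V →ₗ[k] cornerSubmodule (1 - e) := g.hom.toLin
      refine mkMonHom ((cornerSubmodule e).subtype ∘ₗ f' + (cornerSubmodule (1 - e)).subtype ∘ₗ g')
        (fun x t => ?_) (fun x t ht => ?_) ?_ (fun s t => ?_)
      · have h1 := congrArg Subtype.val (f.hom.map_act x t)
        have h2 := congrArg Subtype.val (g.hom.map_act x t)
        exact (congrArg₂ (· + ·) h1 h2).trans (map_add (A.X.act x) _ _).symm
      · exact Submodule.add_mem _ ((mem_cornerObj he ha).1 (hom_mem_component f.hom ht))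
          ((mem_cornerObj he' ha').1 (hom_mem_component g.hom ht))
      · have h1 := congrArg Subtype.val ((monHom_one f).trans (corner_one he ha hee hc))
        have h2 := congrArg Subtype.val ((monHom_one g).trans (corner_one he' ha' hee' hc'))
        exact (congrArg₂ (· + ·) h1 h2).trans (add_sub_cancel _ _)
      · have h1 : (f' (s * t)).1 = (f' s).1 * (f' t).1 := congrArg Subtype.val (monHom_mul f s t)
        have h2 : (g' (s * t)).1 = (g' s).1 * (g' t).1 := congrArg Subtype.val (monHom_mul g s t)
        change (f' (s * t)).1 + (g' (s * t)).1 =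
          ((f' s).1 + (g' s).1) * ((f' t).1 + (g' t).1)
        have h3 : (f' s).1 * (g' t).1 = 0 := by
          rw [← (f' s).2, hc, mul_assoc, hx', mul_zero]
        have h4 : (g' s).1 * (f' t).1 = 0 := by
          rw [← (f' t).2, ← mul_assoc, ← hc, hx', zero_mul]
        rw [h1, h2, mul_add, add_mul, add_mul, h3, h4, add_zero, zero_add]
    · refine Mon.Hom.ext (hom_ext (LinearMap.ext fun t => Subtype.ext ?_))
      let f' : T.X.V →ₗ[k] cornerSubmodule e := f.hom.toLin
      let g' : T.X.V →ₗ[k] cornerSubmodule (1 - e) := g.hom.toLin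
      change e * ((f' t).1 + (g' t).1) = (f' t).1
      rw [mul_add, hx', add_zero, (f' t).2]
    · refine Mon.Hom.ext (hom_ext (LinearMap.ext fun t => Subtype.ext ?_))
      let f' : T.X.V →ₗ[k] cornerSubmodule e := f.hom.toLin
      let g' : T.X.V →ₗ[k] cornerSubmodule (1 - e) := g.hom.toLin
      change (1 - e) * ((f' t).1 + (g' t).1) = (g' t).1
      rw [mul_add, hx, zero_add, (g' t).2]
    · refine Mon.Hom.ext (hom_ext (LinearMap.ext fun t => ?_))
      rw [← hf, ← hg]
      let m' : T.X.V →ₗ[k] A.X.V := m.hom.toLin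
      change m' t = e * m' t + (1 - e) * m' t
      rw [← add_mul, add_sub_cancel, one_mul]
  rcases hA.2 _ _ _ _ ⟨lim⟩ with h | h
  · left
    have h1 : Subsingleton (cornerSubmodule e) := isZero_iff.1 h
    exact congrArg Subtype.val (h1.elim ⟨e, hee⟩ 0)
  · right
    have h1 : Subsingleton (cornerSubmodule (1 - e)) := isZero_iff.1 h
    exact (sub_eq_zero.1 (congrArg Subtype.val (h1.elim ⟨1 - e, hee'⟩ 0))).symm

end Corner

end ZG

end

/-! ### Constructing a frame in a commutative separable indecomposable algebra -/

noncomputable section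

namespace Frame

variable {k G : Type u} [Field k] [Group G] [Fintype G]

/-- Primitive idempotents that are not orthogonal coincide: their nonzero product is a multiple of
each, and idempotency forces both scalars to be 1. -/
theorem eq_of_primitive {R : Type*} [Ring R] [Module k R] [IsScalarTower k R R]
    [SMulCommClass k R R] {e e' : R} (he : e * e = e) (he' : e' * e' = e') {c c' : k}
    (h : e * e' = c • e) (h' : e * e' = c' • e') (h0 : e * e' ≠ 0) : e = e' := by
  have hc : (c - 1) • (e * e') = 0 := by
    rw [sub_smul, one_smul, sub_eq_zero, ← smul_mul_assoc, ← h, mul_assoc, he']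
  have hc' : (c' - 1) • (e * e') = 0 := by
    rw [sub_smul, one_smul, sub_eq_zero, ← mul_smul_comm, ← h', ← mul_assoc, he]
  rw [smul_eq_zero_iff_left h0, sub_eq_zero] at hc hc'
  rw [hc, one_smul] at h
  rw [hc', one_smul] at h'
  exact h.symm.trans h'

/-- Every commutative separable indecomposable algebra has a frame. -/
theorem exists_of_isCommSepIndec [IsAlgClosed k] [CharZero k] {A : Mon (ZG k G)}
    (hA : IsCommSepIndec A) :
    ∃ (H : Subgroup G) (F : Subgroup H) (_ : F.Normal) (γ : TwoCocycle k F) (ε : H → F → kˣ),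
      IsCompatible γ ε ∧ Nonempty (Frame A γ ε) := by
  classical
  have hcomm := ZG.isCommMonObj_iff.1 hA.comm
  have hcen : ∀ e ∈ A.X.component 1, ∀ x, e * x = x * e := fun e he x => by
    have := hcomm 1 e he x
    rw [ZG.act_one_apply] at this
    exact this.symm
  have h1 : (1 : A.X.V) ≠ 0 := fun h => hA.indecomposable.1
    (ZG.isZero_iff.2 (subsingleton_of_zero_eq_one h.symm))
  obtain ⟨p, hp, hp0, hpp, hprim⟩ := ZG.exists_primitive_idempotent hA.separable hcen h1
  have hpc := hcen p hp
  have hactp : ∀ g, A.X.act g p ∈ A.X.component 1 := fun g => by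
    have := A.X.act_mem_component (f := g) hp
    simpa using this
  have hactpp : ∀ g, A.X.act g p * A.X.act g p = A.X.act g p := fun g => by
    rw [← ZG.act_mul, hpp]
  -- the stabiliser of the primitive idempotent
  let H : Subgroup G :=
    { carrier := {g | A.X.act g p = p}
      one_mem' := ZG.act_one_apply _ _
      mul_mem' := fun {g h} (hg : _ = _) (hh : _ = _) => by
        change A.X.act (g * h) p = p
        rw [← ZG.act_act, hh, hg]
      inv_mem' := fun {g} (hg : _ = _) => by
        change A.X.act g⁻¹ p = p
        conv_lhs => rw [← hg]
        rw [ZG.act_act, inv_mul_cancel, ZG.act_one_apply] }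
  have hHp : ∀ g ∈ H, A.X.act g p = p := fun g hg => hg
  have horth : ∀ g ∉ H, p * A.X.act g p = 0 := fun g hg => by
    by_contra hne
    obtain ⟨c, hc⟩ := hprim _ (hactp g)
    obtain ⟨c', hc'⟩ := hprim _ (hactp g⁻¹)
    have h2 := congrArg (A.X.act g) hc'
    rw [ZG.act_mul, ZG.act_act, mul_inv_cancel, ZG.act_one_apply, map_smul, ← hpc] at h2
    exact hg (eq_of_primitive hpp (hactpp g) hc h2 hne).symm
  have horth' : ∀ g g', g⁻¹ * g' ∉ H → A.X.act g p * A.X.act g' p = 0 := fun g g' hg => by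
    have := congrArg (A.X.act g) (horth _ hg)
    rwa [ZG.act_mul, ZG.act_act, mul_inv_cancel_left, map_zero] at this
  have hH0 : (Nat.card H : k) ≠ 0 := card_ne_zero H
  let S : A.X.V := ∑ g, A.X.act g p
  have hS : ∀ g, A.X.act g p * S = (Nat.card H : k) • A.X.act g p := fun g => by
    rw [Nat.cast_smul_eq_nsmul, ← H.sum_ite_mem g, Finset.mul_sum]
    refine Finset.sum_congr rfl fun x _ => ?_
    split_ifs with hx
    · rw [show A.X.act x p = A.X.act g p by
        rw [← mul_inv_cancel_left g x, ← ZG.act_act, hHp _ hx], hactpp]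
    · exact horth' g x hx
  -- S/|H| is an invariant idempotent, so indecomposability makes it 0 or 1. The value 0 is excluded
  -- because p S = |H| p.
  have hsum : S = (Nat.card H : k) • 1 := by
    have hs : (Nat.card H : k)⁻¹ • S = 0 ∨ (Nat.card H : k)⁻¹ • S = 1 := by
      have hmem : (Nat.card H : k)⁻¹ • S ∈ A.X.component 1 :=
        Submodule.smul_mem _ _ (Submodule.sum_mem _ fun g _ => hactp g)
      refine ZG.eq_zero_or_eq_one_of_isIndecomposable hA.indecomposable hmem (fun g => ?_) ?_
        (hcen _ hmem)
      · rw [map_smul, map_sum]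
        congr 1
        simp only [ZG.act_act]
        exact Equiv.sum_comp (Equiv.mulLeft g) (fun g => A.X.act g p)
      · rw [smul_mul_assoc, mul_smul_comm]
        congr 1
        change (Nat.card H : k)⁻¹ • ((∑ g, A.X.act g p) * S) = S
        rw [Finset.sum_mul, Finset.sum_congr rfl fun g _ => hS g, ← Finset.smul_sum, smul_smul,
          inv_mul_cancel₀ hH0, one_smul]
    rcases hs with hs | hs
    · exfalso
      have h2 := hS 1
      rw [smul_eq_zero_iff_right (inv_ne_zero hH0)] at hs
      rw [hs, mul_zero, ZG.act_one_apply, eq_comm] at h2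
      exact smul_ne_zero hH0 hp0 h2
    · rw [← hs, smul_smul, mul_inv_cancel₀ hH0, one_smul]
  -- the homogeneous components of `p A`
  have hsupp : ∀ a ∉ H, ∀ x ∈ A.X.component a, p * x = 0 := fun a ha x hx => by
    -- Commutativity reads a(p) x = x p = p x; multiplying by `p` makes the left side vanish when a
    -- ∉ H.
    have h2 := hcomm a x hx p
    rw [← hpc] at h2
    rw [← hpp, mul_assoc, ← h2, ← mul_assoc, horth a ha, zero_mul]
  have hmem : ∀ {a b x y}, x ∈ A.X.component a → y ∈ A.X.component b → a * b = 1 →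
      x * y ∈ A.X.component 1 := fun hx hy hab => hab ▸ ZG.mul_mem hx hy
  -- Non-degeneracy gives y₀ with t(x y₀) ≠ 0. Since `t` vanishes off degree 1, y₀ may be replaced
  -- by its component of degree a⁻¹, and then x y₀ lies in p A_1 = k p.
  have hinv : ∀ a, ∀ x ∈ A.X.component a, p * x = x → x ≠ 0 →
      ∃ y ∈ A.X.component a⁻¹, p * y = y ∧ x * y = p ∧ y * x = p := fun a x hx hpx hx0 => by
    obtain ⟨t, κ, ht, hl, -, -⟩ := ZG.exists_of_isSeparableAlgebra hA.separable
    obtain ⟨y₀, hy₀⟩ : ∃ y, t (x * y) ≠ 0 := by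
      by_contra! h
      refine hx0 ?_
      rw [← hl x, show A.X.contractLeft t x = 0 from TensorProduct.ext' fun q r => by
        rw [ZG.contractLeft_tmul, h, zero_smul, LinearMap.zero_apply], LinearMap.zero_apply]
    have hy₁ : t (x * A.X.proj a⁻¹ y₀) ≠ 0 := by
      rw [← A.X.sum_proj y₀, Finset.mul_sum, map_sum, Finset.sum_eq_single a⁻¹] at hy₀
      · exact hy₀
      · intro b _ hb
        refine ht (a * b) (fun h => hb (eq_inv_of_mul_eq_one_right h)) _
          (ZG.mul_mem hx (A.X.proj_mem _ _))
      · simp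
    let y₁ := A.X.proj a⁻¹ y₀
    let y₂ := p * y₁
    have hy₂ : y₂ ∈ A.X.component a⁻¹ := by
      have := ZG.mul_mem hp (A.X.proj_mem a⁻¹ y₀)
      rwa [one_mul] at this
    have hxy : x * y₂ = x * y₁ := by rw [← mul_assoc, ← hpc, hpx]
    obtain ⟨c, hc⟩ := hprim (x * y₂) (hmem hx hy₂ (mul_inv_cancel a))
    rw [← mul_assoc, hpx] at hc
    have hpy₂ : p * y₂ = y₂ := by rw [← mul_assoc, hpp]
    obtain ⟨c', hc'⟩ := hprim (y₂ * x) (hmem hy₂ hx (inv_mul_cancel a))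
    rw [← mul_assoc, hpy₂] at hc'
    have hc0 : c ≠ 0 := fun h => hy₁ (by rw [← hxy, hc, h, zero_smul, map_zero])
    -- The left and right scalars agree by computing x y₂ x in two ways.
    have hcc : c = c' := by
      have h2 : x * y₂ * x = c • x := by rw [hc, smul_mul_assoc, hpx]
      rw [mul_assoc, hc', mul_smul_comm, ← hpc, hpx] at h2
      exact (smul_left_injective k hx0 h2).symm
    refine ⟨c⁻¹ • y₂, Submodule.smul_mem _ _ hy₂, ?_, ?_, ?_⟩
    · rw [mul_smul_comm, hpy₂]
    · rw [mul_smul_comm, hc, smul_smul, inv_mul_cancel₀ hc0, one_smul]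
    · rw [smul_mul_assoc, hc', ← hcc, smul_smul, inv_mul_cancel₀ hc0, one_smul]
  -- If y inverts x, then z = (z y) x and z y lies in k p.
  have hline : ∀ a, ∀ x ∈ A.X.component a, p * x = x → x ≠ 0 →
      ∀ z ∈ A.X.component a, p * z = z → ∃ c : k, z = c • x := fun a x hx hpx hx0 z hz hpz => by
    obtain ⟨y, hy, -, -, hyx⟩ := hinv a x hx hpx hx0
    obtain ⟨c, hc⟩ := hprim (z * y) (hmem hz hy (mul_inv_cancel a))
    refine ⟨c, ?_⟩
    rw [← mul_assoc, hpz] at hc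
    rw [← hpx, ← smul_mul_assoc, ← hc, mul_assoc, hyx, ← hpc, hpz]
  have hmul0 : ∀ a, ∀ x ∈ A.X.component a, p * x = x → x ≠ 0 → ∀ z, p * z = z → z ≠ 0 →
      x * z ≠ 0 := fun a x hx hpx hx0 z hpz hz0 h => by
    obtain ⟨y, -, -, -, hyx⟩ := hinv a x hx hpx hx0
    refine hz0 ?_
    rw [← hpz, ← hyx, mul_assoc, h, mul_zero]
  have hunit : ∀ a, ∀ x ∈ A.X.component a, p * x = x → x ≠ 0 →
      ∀ z ∈ A.X.component a, p * z = z → z ≠ 0 → ∃ c : kˣ, z = (c : k) • x :=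
    fun a x hx hpx hx0 z hz hpz hz0 => by
      obtain ⟨c, hc⟩ := hline a x hx hpx hx0 z hz hpz
      have hc0 : c ≠ 0 := fun h => hz0 (by rw [hc, h, zero_smul])
      exact ⟨Units.mk0 c hc0, hc⟩
  have hpact : ∀ (h : H) x, p * x = x → p * A.X.act (h : G) x = A.X.act (h : G) x :=
    fun h x hx => by
      conv_rhs => rw [← hx, ZG.act_mul, hHp _ h.2]
  have hact0 : ∀ (g : G) x, x ≠ 0 → A.X.act g x ≠ 0 := fun g x hx h => hx <| by
    have := congrArg (A.X.act g⁻¹) h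
    rwa [ZG.act_act, inv_mul_cancel, ZG.act_one_apply, map_zero] at this
  let F : Subgroup H :=
    { carrier := {f | ∃ x ∈ A.X.component (f : G), p * x = x ∧ x ≠ 0}
      one_mem' := ⟨p, hp, hpp, hp0⟩
      mul_mem' := by
        rintro f f' ⟨x, hx, hpx, hx0⟩ ⟨x', hx', hpx', hx0'⟩
        exact ⟨x * x', ZG.mul_mem hx hx', by rw [← mul_assoc, hpx],
          hmul0 _ x hx hpx hx0 x' hpx' hx0'⟩
      inv_mem' := by
        rintro f ⟨x, hx, hpx, hx0⟩
        obtain ⟨y, hy, hpy, hxy, -⟩ := hinv _ x hx hpx hx0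
        refine ⟨y, hy, hpy, fun h => hp0 ?_⟩
        rw [← hxy, h, mul_zero] }
  have hFn : F.Normal := ⟨by
    rintro f ⟨x, hx, hpx, hx0⟩ h
    exact ⟨A.X.act (h : G) x, A.X.act_mem_component hx, hpact h x hpx, hact0 _ _ hx0⟩⟩
  have hF : ∀ f : F, ∃ x ∈ A.X.component ((f : H) : G), p * x = x ∧ x ≠ 0 := fun f => f.2
  choose v hv hpv hv0 using hF
  -- The choice u 1 = p normalises the cocycle; the other basis vectors are arbitrary.
  let u : F → A.X.V := fun f => if f = 1 then p else v f
  have hu1 : u 1 = p := if_pos rfl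
  have hu : ∀ f : F, u f ∈ A.X.component ((f : H) : G) ∧ p * u f = u f ∧ u f ≠ 0 := fun f => by
    by_cases hf : f = 1
    · subst hf
      rw [hu1]
      exact ⟨hp, hpp, hp0⟩
    · simp only [u, if_neg hf]
      exact ⟨hv f, hpv f, hv0 f⟩
  have hγ : ∀ f f' : F, ∃ c : kˣ, u f * u f' = (c : k) • u (f * f') := fun f f' =>
    hunit _ _ (hu (f * f')).1 (hu _).2.1 (hu _).2.2 _ (ZG.mul_mem (hu f).1 (hu f').1)
      (by rw [← mul_assoc, (hu f).2.1]) (hmul0 _ _ (hu f).1 (hu f).2.1 (hu f).2.2 _ (hu f').2.1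
        (hu f').2.2)
  choose γ hγ using hγ
  have hε : ∀ (h : H) (f : F), ∃ c : kˣ,
      A.X.act (h : G) (u f) = (c : k) • u (MulAut.conjNormal h f) := fun h f =>
    hunit _ _ (hu (MulAut.conjNormal h f)).1 (hu _).2.1 (hu _).2.2 _ (by
      have := A.X.act_mem_component (f := (h : G)) (hu f).1
      simpa using this) (hpact h _ (hu f).2.1) (hact0 _ _ (hu f).2.2)
  choose ε hε using hε
  -- Every identity for γ and ε compares two coefficients of one nonzero `u f`; they express
  -- associativity, multiplicativity of the action and braided commutativity.
  have hcancel : ∀ (f : F) {c c' : kˣ}, (c : k) • u f = (c' : k) • u f → c = c' :=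
    fun f c c' h => Units.ext (smul_left_injective k (hu f).2.2 h)
  let Γ : TwoCocycle k F :=
    { toFun := γ
      one_left := fun f => hcancel f <| by
        have := hγ 1 f
        rw [hu1, (hu f).2.1, one_mul] at this
        rw [← this, Units.val_one, one_smul]
      one_right := fun f => hcancel f <| by
        have := hγ f 1
        rw [hu1, ← hpc, (hu f).2.1, mul_one] at this
        rw [← this, Units.val_one, one_smul]
      cocycle := fun f g h => hcancel (f * g * h) <| by
        have := mul_assoc (u f) (u g) (u h)
        rw [hγ, hγ, smul_mul_assoc, mul_smul_comm, hγ, hγ, smul_smul, smul_smul,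
          ← mul_assoc f] at this
        exact_mod_cast this }
  have hcompat : IsCompatible Γ ε :=
    { mul_act := fun g h f => hcancel (MulAut.conjNormal (g * h) f) <| by
        have := hε (g * h) f
        rw [Subgroup.coe_mul, ← ZG.act_act, hε, map_smul, hε, smul_smul] at this
        rw [← this, map_mul, MulAut.mul_apply, Units.val_mul, mul_comm]
      act_mul := fun h f g => hcancel (MulAut.conjNormal h (f * g)) <| by
        have := congrArg (A.X.act (h : G)) (hγ f g)
        rw [ZG.act_mul, hε, hε, map_smul, hε, smul_mul_assoc, mul_smul_comm, hγ, smul_smul,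
          smul_smul, smul_smul, ← map_mul] at this
        rw [Units.val_mul, Units.val_mul, Units.val_mul]
        exact this.symm
      comm := fun f g => hcancel (f * g) <| by
        have := hcomm _ _ (hu f).1 (u g)
        rw [hγ, hε, smul_mul_assoc, hγ, smul_smul] at this
        rw [show MulAut.conjNormal (f : H) g * f = f * g by ext; simp] at this
        rw [Units.val_mul]
        exact this.symm }
  refine ⟨H, F, hFn, Γ, ε, hcompat, ⟨⟨u, fun f => (hu f).1, hγ, hε, ?_, ?_, ?_, ?_⟩⟩⟩
  · rw [hu1]
    exact horth
  · rw [hu1]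
    exact hsum
  · rw [hu1]
    exact hp0
  · intro x
    rw [hu1, ← A.X.sum_proj x, Finset.mul_sum]
    refine Submodule.sum_mem _ fun a _ => ?_
    by_cases hpx : p * A.X.proj a x = 0
    · rw [hpx]
      exact Submodule.zero_mem _
    · have haH : a ∈ H := by
        by_contra h
        exact hpx (hsupp a h _ (A.X.proj_mem a x))
      have hx1 : p * A.X.proj a x ∈ A.X.component a := by
        have := ZG.mul_mem hp (A.X.proj_mem a x)
        rwa [one_mul] at this
      have hx2 : p * (p * A.X.proj a x) = p * A.X.proj a x := by rw [← mul_assoc, hpp]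
      let f : F := ⟨⟨a, haH⟩, ⟨_, hx1, hx2, hpx⟩⟩
      obtain ⟨c, hc⟩ := hline _ _ (hu f).1 (hu f).2.1 (hu f).2.2 _ hx1 hx2
      rw [hc]
      exact Submodule.smul_mem _ _ (Submodule.subset_span ⟨f, rfl⟩)

end Frame

end

noncomputable section

/-! ## The case `F = H` -/

namespace TwoCocycle

variable {k H : Type*} [Field k] [Group H] (γ : TwoCocycle k H)

/-- In the twisted group algebra the quotient γ(h, f)/γ(hfh⁻¹, h) is the scalar of conjugation by
u_h on u_f, and conjugation is multiplicative in h. Written additively, the identity is a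
combination of three cocycle relations. -/
theorem div_mul_act (g h f : H) :
    γ (g * h) f / γ (g * h * f * (g * h)⁻¹) (g * h) =
      γ g (h * f * h⁻¹) / γ (g * (h * f * h⁻¹) * g⁻¹) g * (γ h f / γ (h * f * h⁻¹) h) := by
  have h1 := congrArg Additive.ofMul (γ.cocycle g h f)
  have h2 := congrArg Additive.ofMul (γ.cocycle g (h * f * h⁻¹) h)
  have h3 := congrArg Additive.ofMul (γ.cocycle (g * (h * f * h⁻¹) * g⁻¹) g h)
  rw [inv_mul_cancel_right] at h2 h3
  rw [show g * h * f * (g * h)⁻¹ = g * (h * f * h⁻¹) * g⁻¹ by group]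
  apply Additive.ofMul.injective
  simp only [ofMul_mul, ofMul_div] at *
  linear_combination (norm := abel) h1 - h2 + h3

/-- The same scalars reflect that conjugation by u_h is an algebra automorphism of the twisted group
algebra. -/
theorem mul_div_mul (h f g : H) :
    γ f g * (γ h (f * g) / γ (h * (f * g) * h⁻¹) h) =
      γ h f / γ (h * f * h⁻¹) h * (γ h g / γ (h * g * h⁻¹) h) *
        γ (h * f * h⁻¹) (h * g * h⁻¹) := by
  have h1 := congrArg Additive.ofMul (γ.cocycle h f g)
  have h2 := congrArg Additive.ofMul (γ.cocycle (h * f * h⁻¹) h g)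
  have h3 := congrArg Additive.ofMul (γ.cocycle (h * f * h⁻¹) (h * g * h⁻¹) h)
  rw [inv_mul_cancel_right] at h2 h3
  rw [show h * f * h⁻¹ * (h * g * h⁻¹) = h * (f * g) * h⁻¹ by group] at h3
  apply Additive.ofMul.injective
  simp only [ofMul_mul, ofMul_div] at *
  linear_combination (norm := abel) h2 - h1 - h3

/-- With F = H the third condition is available for every h ∈ H and solves for ε. -/
theorem existsUnique_isCompatible :
    ∃! ε : H → (⊤ : Subgroup H) → kˣ, IsCompatible (γ.restrict ⊤) ε := by
  refine ⟨fun h f => γ h f / γ (h * f * h⁻¹) h, ⟨?_, ?_, ?_⟩, fun ε hε => ?_⟩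
  · exact fun g h f => γ.div_mul_act g h f
  · exact fun h f g => γ.mul_div_mul h f g
  · exact fun f g => (div_mul_cancel _ _).symm
  · funext h f
    exact eq_div_of_mul_eq' (hε.comm ⟨h, trivial⟩ f).symm

end TwoCocycle

namespace IsCompatible

variable {k H : Type*} [Field k] [Group H] {γ : TwoCocycle k H}
  {ε : H → (⊤ : Subgroup H) → kˣ}

theorem mul_apply_conj (hε : IsCompatible (γ.restrict ⊤) ε) (h : H) (f : (⊤ : Subgroup H)) :
    γ h f = ε h f * γ (h * f * h⁻¹) h :=
  hε.comm ⟨h, trivial⟩ f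

/-- A cochain that relates two cocycles relates the corresponding maps `ε`. -/
theorem apply_mul_eq {H' : Type*} [Group H'] {γ' : TwoCocycle k H'}
    {ε' : H' → (⊤ : Subgroup H') → kˣ} (hε : IsCompatible (γ.restrict ⊤) ε)
    (hε' : IsCompatible (γ'.restrict ⊤) ε') (e : H ≃* H') {c : H → kˣ}
    (hc : ∀ x y : H, c (x * y) * γ x y = γ' (e x) (e y) * c x * c y) (h : H)
    (f : (⊤ : Subgroup H)) :
    c f * ε' (e h) ⟨e f, trivial⟩ = ε h f * c (h * f * h⁻¹) := by
  have h1 := congrArg Additive.ofMul (hc h f)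
  have h2 := congrArg Additive.ofMul (hc (h * f * h⁻¹) h)
  have h3 := congrArg Additive.ofMul (hε.mul_apply_conj h f)
  have h4 := congrArg Additive.ofMul (hε'.mul_apply_conj (e h) ⟨e f, trivial⟩)
  rw [inv_mul_cancel_right] at h2
  simp only [map_mul, map_inv] at h2
  apply Additive.ofMul.injective
  simp only [ofMul_mul] at *
  linear_combination (norm := abel) h2 - h1 + h3 - h4

end IsCompatible

/-! ### Change of frame, and conjugacy of any two frames with F = H -/

namespace Frame

variable {k G : Type u} [Field k] [Group G] [Fintype G] {A : Mon (ZG k G)}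

/-- A frame of type `(H', H', γ', ε')` gives one of type `(H, H, γ, ε)` for each `H` conjugate to
`H'` and each cocycle `γ` that corresponds to `γ'` up to a coboundary. -/
def conj {H H' : Subgroup G} {γ : TwoCocycle k H} {γ' : TwoCocycle k H'}
    {ε : H → (⊤ : Subgroup H) → kˣ} {ε' : H' → (⊤ : Subgroup H') → kˣ}
    (𝔣 : Frame A (γ'.restrict ⊤) ε') (hε : IsCompatible (γ.restrict ⊤) ε)
    (hε' : IsCompatible (γ'.restrict ⊤) ε') (g : G) (e : H ≃* H')
    (he : ∀ x : H, (e x : G) = g * x * g⁻¹) (c : H → kˣ)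
    (hc : ∀ x y : H, c (x * y) * γ x y = γ' (e x) (e y) * c x * c y) :
    Frame A (γ.restrict ⊤) ε := by
  -- Normalisation of both cocycles forces this, so the new idempotent is exactly the g⁻¹-translate
  -- of the old one.
  have hc1 : c 1 = 1 := by
    have := hc 1 1
    rw [γ.one_left, map_one, γ'.one_left, mul_one, mul_one, one_mul] at this
    exact left_eq_mul.1 this
  have hu1 : ((c ((1 : (⊤ : Subgroup H)) : H) : kˣ) : k) • A.X.act g⁻¹
      (𝔣.u ⟨e ((1 : (⊤ : Subgroup H)) : H), trivial⟩) = A.X.act g⁻¹ (𝔣.u 1) := by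
    have h1 : (⟨e ((1 : (⊤ : Subgroup H)) : H), trivial⟩ : (⊤ : Subgroup H')) = 1 :=
      Subtype.ext (map_one e)
    rw [h1, Subgroup.coe_one, hc1, Units.val_one, one_smul]
  have hcard : Nat.card H = Nat.card H' := Nat.card_congr e.toEquiv
  have hmem : ∀ x : G, g * x * g⁻¹ ∈ H' → x ∈ H := fun x hx => by
    obtain ⟨y, hy⟩ := e.surjective ⟨_, hx⟩
    have : g * y * g⁻¹ = g * x * g⁻¹ := by rw [← he, hy]
    rw [← mul_left_cancel (mul_right_cancel this)]
    exact y.2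
  exact
    { u := fun x => ((c x : kˣ) : k) • A.X.act g⁻¹ (𝔣.u ⟨e x, trivial⟩)
      u_mem := fun x => by
        refine Submodule.smul_mem _ _ ?_
        have := A.X.act_mem_component (f := g⁻¹) (𝔣.u_mem ⟨e x, trivial⟩)
        have h1 : g⁻¹ * (e x : G) * g⁻¹⁻¹ = (x : H) := by rw [he]; group
        rwa [h1] at this
      u_mul := fun x y => by
        have h1 : (⟨e x, trivial⟩ : (⊤ : Subgroup H')) * ⟨e y, trivial⟩ =
          ⟨e ((x * y : (⊤ : Subgroup H)) : H), trivial⟩ := Subtype.ext (map_mul e _ _).symm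
        rw [smul_mul_assoc, mul_smul_comm, ← ZG.act_mul, 𝔣.u_mul, map_smul, smul_smul, smul_smul,
          smul_smul, h1]
        congr 1
        have := congrArg Units.val (hc x y)
        simp only [Units.val_mul] at this
        change (c x : k) * c y * (γ' (e x) (e y) : kˣ) = (γ x y : kˣ) * (c (x * y) : kˣ)
        linear_combination -this
      act_u := fun h x => by
        have h1 : (MulAut.conjNormal (e h) : MulAut (⊤ : Subgroup H')) ⟨e x, trivial⟩ =
            ⟨e (MulAut.conjNormal h x : (⊤ : Subgroup H)), trivial⟩ := Subtype.ext (by simp)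
        have h2 : (h : G) * g⁻¹ = g⁻¹ * e h := by rw [he]; group
        rw [map_smul, ZG.act_act, h2, ← ZG.act_act, 𝔣.act_u, map_smul, smul_smul, smul_smul, h1,
          ← Units.val_mul, ← Units.val_mul, hε.apply_mul_eq hε' e hc h x]
        rfl
      orth := fun x hx => by
        rw [hu1]
        have := 𝔣.orth (g * x * g⁻¹) fun h => hx (hmem x h)
        have h1 : x * g⁻¹ = g⁻¹ * (g * x * g⁻¹) := by group
        rw [ZG.act_act, h1, ← ZG.act_act, ← ZG.act_mul, this, map_zero]
      sum_act := by
        rw [hu1, hcard, ← 𝔣.sum_act]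
        simp only [ZG.act_act]
        exact Equiv.sum_comp (Equiv.mulRight g⁻¹) (fun x => A.X.act x (𝔣.u 1))
      u_one_ne := by
        rw [hu1]
        intro h
        have := congrArg (A.X.act g) h
        rw [ZG.act_act, mul_inv_cancel, ZG.act_one_apply, map_zero] at this
        exact 𝔣.u_one_ne this
      span := fun x => by
        rw [hu1]
        have h1 := Submodule.mem_map_of_mem (f := A.X.act g⁻¹) (𝔣.span (A.X.act g x))
        rw [ZG.act_mul, ZG.act_act, inv_mul_cancel, ZG.act_one_apply, Submodule.map_span,
          ← Set.range_comp] at h1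
        refine Submodule.span_le.2 ?_ h1
        rintro _ ⟨y, rfl⟩
        obtain ⟨z, hz⟩ := e.surjective y
        have h2 : A.X.act g⁻¹ (𝔣.u y) = ((c z : kˣ) : k)⁻¹ • ((c z : kˣ) : k) •
            A.X.act g⁻¹ (𝔣.u ⟨e z, trivial⟩) := by
          rw [smul_smul, inv_mul_cancel₀ (Units.ne_zero _), one_smul]
          congr 2
          exact Subtype.ext hz.symm
        change A.X.act g⁻¹ (𝔣.u y) ∈ _
        rw [h2]
        exact Submodule.smul_mem _ _ (Submodule.subset_span ⟨⟨z, trivial⟩, rfl⟩) }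

/-- Recovers H as the stabiliser of `u 1`, a nonzero idempotent orthogonal to its translates outside
H. -/
theorem mem_iff {H : Subgroup G} {F : Subgroup H} [F.Normal] {γ : TwoCocycle k F}
    {ε : H → F → kˣ} (𝔣 : Frame A γ ε) (hε : IsCompatible γ ε) (g : G) :
    g ∈ H ↔ A.X.act g (𝔣.u 1) = 𝔣.u 1 := by
  refine ⟨fun hg => 𝔣.act_u_one hε ⟨g, hg⟩, fun hg => ?_⟩
  by_contra h
  have := 𝔣.orth g h
  rw [hg, u_one_mul] at this
  exact 𝔣.u_one_ne this

/-- Two frames in the same algebra with `F = H` are conjugate. -/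
theorem exists_conj [CharZero k] (hA : IsCommMonObj A.X) {H H' : Subgroup G} {γ : TwoCocycle k H}
    {γ' : TwoCocycle k H'} {ε : H → (⊤ : Subgroup H) → kˣ} {ε' : H' → (⊤ : Subgroup H') → kˣ}
    (𝔣 : Frame A (γ.restrict ⊤) ε) (𝔣' : Frame A (γ'.restrict ⊤) ε')
    (hε : IsCompatible (γ.restrict ⊤) ε) (hε' : IsCompatible (γ'.restrict ⊤) ε') :
    ∃ (g : G) (e : H ≃* H') (c : H → kˣ), (∀ x : H, (e x : G) = g * x * g⁻¹) ∧
      ∀ x y : H, c (x * y) * γ x y = γ' (e x) (e y) * c x * c y := by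
  have hcomm := ZG.isCommMonObj_iff.1 hA
  have hmem1 : 𝔣.u 1 ∈ A.X.component 1 := by simpa using 𝔣.u_mem 1
  have hmem1' : 𝔣'.u 1 ∈ A.X.component 1 := by simpa using 𝔣'.u_mem 1
  have hactmem : ∀ (g : G) x, x ∈ A.X.component 1 → A.X.act g x ∈ A.X.component 1 :=
    fun g x hx => by simpa using A.X.act_mem_component (f := g) hx
  -- The translates of `𝔣.u 1` sum to a nonzero multiple of 1, so one of them is not orthogonal to
  -- `𝔣'.u 1`; by primitivity the two then coincide.
  obtain ⟨g, hg⟩ : ∃ g, 𝔣'.u 1 * A.X.act g (𝔣.u 1) ≠ 0 := by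
    by_contra! h
    refine 𝔣'.u_one_ne ?_
    rw [← mul_one (𝔣'.u 1), 𝔣.one_eq_sum, mul_smul_comm, Finset.mul_sum,
      show ∑ g, 𝔣'.u 1 * 𝔣.gen g 1 = 0 from Finset.sum_eq_zero fun g _ => h g, smul_zero]
  have hgu : 𝔣'.u 1 = A.X.act g (𝔣.u 1) := by
    obtain ⟨c, hc⟩ := 𝔣'.exists_u_one_mul 1 (x := A.X.act g (𝔣.u 1))
      (by simpa using hactmem g _ hmem1)
    obtain ⟨c', hc'⟩ := 𝔣.exists_u_one_mul 1 (x := A.X.act g⁻¹ (𝔣'.u 1))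
      (by simpa using hactmem g⁻¹ _ hmem1')
    have h2 := congrArg (A.X.act g) hc'
    have h3 := hcomm 1 _ hmem1' (A.X.act g (𝔣.u 1))
    rw [ZG.act_one_apply] at h3
    rw [ZG.act_mul, ZG.act_act, mul_inv_cancel, ZG.act_one_apply, map_smul, h3] at h2
    refine eq_of_primitive (𝔣'.u_one_mul 1) ?_ hc h2 hg
    rw [← ZG.act_mul, u_one_mul]
  have hH : ∀ x : G, x ∈ H ↔ g * x * g⁻¹ ∈ H' := fun x => by
    rw [𝔣.mem_iff hε, 𝔣'.mem_iff hε', hgu, ZG.act_act, inv_mul_cancel_right, ← ZG.act_act]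
    refine ⟨fun h => by rw [h], fun h => ?_⟩
    have := congrArg (A.X.act g⁻¹) h
    rwa [ZG.act_act, ZG.act_act, inv_mul_cancel, one_mul, ZG.act_act,
      inv_mul_cancel, ZG.act_one_apply] at this
  let e : H ≃* H' :=
    { toFun := fun x => ⟨g * x * g⁻¹, (hH x).1 x.2⟩
      invFun := fun y => ⟨g⁻¹ * y * g, (hH _).2 (by
        rw [show g * (g⁻¹ * (y : G) * g) * g⁻¹ = y by group]
        exact y.2)⟩
      left_inv := fun x => Subtype.ext <| by
        change g⁻¹ * (g * x * g⁻¹) * g = x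
        group
      right_inv := fun y => Subtype.ext <| by
        change g * (g⁻¹ * y * g) * g⁻¹ = y
        group
      map_mul' := fun x y => Subtype.ext <| by
        change g * (x * y) * g⁻¹ = g * x * g⁻¹ * (g * y * g⁻¹)
        group }
  let v : H → A.X.V := fun x => A.X.act g (𝔣.u ⟨x, trivial⟩)
  let w : H → A.X.V := fun x => 𝔣'.u ⟨e x, trivial⟩
  -- Once the idempotents agree, `v x` and `w x` are nonzero vectors on one line, the degree `e x`
  -- part of the common corner, and `c x` is their ratio.
  have hc : ∀ x : H, ∃ c : kˣ, v x = (c : k) • w x := fun x => by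
    have h1 : v x ∈ A.X.component (e x : G) := A.X.act_mem_component (𝔣.u_mem ⟨x, trivial⟩)
    obtain ⟨c, hc⟩ := 𝔣'.exists_u_one_mul ⟨e x, trivial⟩ h1
    rw [hgu, ← ZG.act_mul, u_one_mul] at hc
    have hc0 : c ≠ 0 := fun h => 𝔣.u_ne_zero ⟨x, trivial⟩ <| by
      rw [h, zero_smul] at hc
      have := congrArg (A.X.act g⁻¹) hc
      rwa [ZG.act_act, inv_mul_cancel, ZG.act_one_apply, map_zero] at this
    exact ⟨Units.mk0 c hc0, hc⟩
  choose c hc using hc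
  refine ⟨g, e, c, fun x => rfl, fun x y => ?_⟩
  have hv : v x * v y = ((γ x y : kˣ) : k) • v (x * y) := by
    change A.X.act g _ * A.X.act g _ = _ • A.X.act g _
    rw [← ZG.act_mul, 𝔣.u_mul, map_smul]
    rfl
  have hw : w x * w y = ((γ' (e x) (e y) : kˣ) : k) • w (x * y) := by
    change 𝔣'.u _ * 𝔣'.u _ = _ • 𝔣'.u _
    rw [𝔣'.u_mul]
    congr 2
    exact Subtype.ext (map_mul e x y).symm
  rw [hc, hc, hc, smul_mul_assoc, mul_smul_comm, hw, smul_smul, smul_smul, smul_smul] at hv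
  have := smul_left_injective k (𝔣'.u_ne_zero ⟨e (x * y), trivial⟩) hv
  refine Units.ext ?_
  simp only [Units.val_mul]
  linear_combination -this

end Frame

end

/-! ### The classification -/

theorem mainTheorem2 {k G : Type u} [Field k] [IsAlgClosed k] [CharZero k] [Group G] [Fintype G] :
    -- the algebra `A(H, F, γ, ε)` is trivialising if and only if `F = H`
    (∀ (H : Subgroup G) (F : Subgroup H) [F.Normal] (γ : TwoCocycle k F) (ε : H → F → kˣ)
      (hε : IsCompatible γ ε),
        IsCommSepIndec (algA H F γ ε hε) ∧ (IsTrivialising k (algA H F γ ε hε) ↔ F = ⊤)) ∧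
    -- for `F = H` the map `ε` exists and is determined by `γ`
    (∀ (H : Subgroup G) (γ : TwoCocycle k H),
      ∃! ε : H → (⊤ : Subgroup H) → kˣ, IsCompatible (γ.restrict ⊤) ε) ∧
    -- the trivialising algebras are, up to isomorphism, the algebras `A(H, H, γ, ε)`
    (∀ A : Mon (ZG k G), IsTrivialising k A ↔
      ∃ (H : Subgroup G) (γ : TwoCocycle k H) (ε : H → (⊤ : Subgroup H) → kˣ)
        (hε : IsCompatible (γ.restrict ⊤) ε), Nonempty (A ≅ algA H ⊤ (γ.restrict ⊤) ε hε)) ∧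
    -- two pairs give isomorphic algebras iff they agree up to conjugation and coboundaries
    (∀ (H H' : Subgroup G) (γ : TwoCocycle k H) (γ' : TwoCocycle k H')
      (ε : H → (⊤ : Subgroup H) → kˣ) (hε : IsCompatible (γ.restrict ⊤) ε)
      (ε' : H' → (⊤ : Subgroup H') → kˣ) (hε' : IsCompatible (γ'.restrict ⊤) ε'),
        Nonempty (algA H ⊤ (γ.restrict ⊤) ε hε ≅ algA H' ⊤ (γ'.restrict ⊤) ε' hε') ↔
          ∃ (g : G) (e : H ≃* H') (c : H → kˣ), (∀ x : H, (e x : G) = g * x * g⁻¹) ∧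
            ∀ x y : H, c (x * y) * γ x y = γ' (e x) (e y) * c x * c y) := by
  refine ⟨fun H F _ γ ε hε => ?_, fun H γ => γ.existsUnique_isCompatible,
    fun A => ⟨fun hA => ?_, ?_⟩, fun H H' γ γ' ε hε ε' hε' => ⟨?_, ?_⟩⟩
  · let 𝔣 := Frame.ofAlgA hε
    exact ⟨𝔣.isCommSepIndec hε, 𝔣.eq_top_of_isTrivialising hε, 𝔣.isTrivialising hε⟩
  · obtain ⟨H, F, _, γ, ε, hε, ⟨𝔣⟩⟩ := Frame.exists_of_isCommSepIndec hA.toIsCommSepIndec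
    obtain rfl := 𝔣.eq_top_of_isTrivialising hε hA
    -- A frame with F = ⊤ carries a cocycle on ⊤ as a subgroup of H; it is read as a cocycle on H,
    -- whose restriction is definitionally the original one.
    let γ' : TwoCocycle k H :=
      { toFun := fun x y => γ ⟨x, trivial⟩ ⟨y, trivial⟩
        one_left := fun x => γ.one_left _
        one_right := fun x => γ.one_right _
        cocycle := fun x y z => γ.cocycle ⟨x, trivial⟩ ⟨y, trivial⟩ ⟨z, trivial⟩ }
    have hγ : γ = γ'.restrict ⊤ := rfl
    rw [hγ] at hε
    obtain ⟨i⟩ := 𝔣.nonempty_iso hε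
    exact ⟨H, γ', ε, hε, ⟨i.symm⟩⟩
  · rintro ⟨H, γ, ε, hε, ⟨i⟩⟩
    exact ((Frame.ofAlgA hε).map i.symm).isTrivialising hε rfl
  · rintro ⟨i⟩
    exact Frame.exists_conj ((Frame.ofAlgA hε').isCommMonObj hε') ((Frame.ofAlgA hε).map i)
      (Frame.ofAlgA hε') hε hε'
  · rintro ⟨g, e, c, he, hc⟩
    exact ((Frame.ofAlgA hε').conj hε hε' g e he c hc).nonempty_iso hε
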